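/- **Channel.** An interference relay channel (IRC) is a memoryless channel $p(y_1,y_2,y_3|x_1,x_2,x_3)$ with inputs $x_1,x_2$ of two sources and $x_3$ of a relay, and outputs $y_1,y_2$ at two destinations and $y_3$ at the relay; all alphabets are nonempty standard Borel spaces. It is *injective semideterministic* (IS-IRC) if there are interference signals $\mathbf S_1=(S_1,S_3)$ and $S_2$ with conditional law $p(\mathbf s_1|x_1x_3)\,p(s_2|x_2)$ and measurable functions such that $Y_1=f_1(X_1,X_3,S_2)$, $Y_2=f_2'(X_2,S_1)$, $(Y_2,Y_3)=f_2(X_2,\mathbf S_1)$, where $f_1(x_1,x_3,\cdot)$, $f_2'(x_2,\cdot)$ and $f_2(x_2,\cdot)$ are injective for all $x_1,x_2,x_3$. It is assumed that the relay sees only source 1 (the conditional law of $Y_3$ given $(x_1,x_2,x_3)$ does not depend on $x_2$) and that there is no noise correlation in the outputs ($Y_1,Y_2,Y_3$ are conditionally independent given $(X_1,X_2,X_3)$). **Achievability.** A code of block length $n\ge 1$ consists of encoders $\mathrm{enc}_k:\{1,\dots,M_k\}\to\mathcal X_k^n$, measurable decoders $\mathrm{dec}_k:\mathcal Y_k^n\to\{1,\dots,M_k\}$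 ($k=1,2$) and measurable relay functions $\phi_i:\mathcal Y_3^{i-1}\to\mathcal X_3$, $x_{3i}=\phi_i(y_3^{i-1})$. A pair of nonnegative rates $(R_1,R_2)$ is achievable if for every $\epsilon>0$ there is a code of some block length $n\ge1$ with $M_k\ge 2^{n(R_k-\epsilon)}$, $k=1,2$, whose probability that $(\mathrm{dec}_1(Y_1^n),\mathrm{dec}_2(Y_2^n))\ne(m_1,m_2)$, averaged over all message pairs $(m_1,m_2)$, is at most $\epsilon$. **Outer region.** Let $\mathcal P_1$ be the set of joint distributions $p(q)\,p(x_1x_3|q)\,p(x_2|q)\,p(\mathbf v_1v_2|x_1x_2x_3q)$, with $Q$ taking finitely many values and $p(\mathbf v_1v_2|x_1x_2x_3q)=p_{\mathbf S_1|X_1X_3}(\mathbf v_1|x_1x_3)\,p_{S_2|X_2}(v_2|x_2)$; i.e. $(\mathbf V_1,V_2)$, with $\mathbf V_1=(V_1,V_3)$, is a conditionally independent copy of $(\mathbf S_1,S_2)$ given $(X_1,X_2,X_3)$. For $P_1\in\mathcal P_1$ let $\mathcal R_o(P_1)$ be the set of nonnegative pairs $(R_1,R_2)$ satisfying (mutual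 informations in bits, with values in $[0,\infty]$) \begin{align*} R_1&\le I(X_1;Y_1Y_3|X_2X_3Q),\\ R_1&\le I(X_1X_3;Y_1|X_2Q),\\ R_2&\le I(X_2;Y_2|X_1X_3Q),\\ R_1+R_2&\le I(X_1X_3;Y_1|V_1X_2Q)+I(X_1X_2X_3;Y_2|Q),\\ R_1+R_2&\le I(X_1X_2X_3;Y_1|V_1Q)+I(X_1X_2X_3;Y_2|V_2Q),\\ R_1+R_2&\le I(X_1X_2X_3;Y_1|Q)+I(X_2;Y_2|X_1V_2X_3Q),\\ R_1+R_2&\le I(X_1;Y_1Y_3|V_1X_2X_3Q)+I(X_1X_2X_3;Y_2|Q),\\ R_1+R_2&\le I(X_1X_2;Y_1Y_3|V_1X_3Q)+I(X_1X_2X_3;Y_2|V_2Q),\\ R_1+R_2&\le I(X_1X_2;Y_1Y_3|X_3Q)+I(X_2;Y_2|X_1V_2X_3Q),\\ R_1+R_2&\le I(X_1;Y_1Y_3|\mathbf V_1X_2X_3Q)+I(X_1X_2;Y_2Y_3|X_3Q),\\ R_1+R_2&\le I(X_1X_2;Y_1Y_3|\mathbf V_1X_3Q)+I(X_1X_2;Y_2Y_3|V_2X_3Q),\\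 2R_1+R_2&\le I(X_1X_3;Y_1|V_1X_2Q)+I(X_1X_2X_3;Y_1|Q)+I(X_1X_2X_3;Y_2|V_2Q),\\ 2R_1+R_2&\le I(X_1X_3;Y_1|V_1X_2Q)+I(X_1X_2;Y_1Y_3|X_3Q)+I(X_1X_2X_3;Y_2|V_2Q),\\ 2R_1+R_2&\le I(X_1;Y_1Y_3|V_1X_2X_3Q)+I(X_1X_2X_3;Y_1|Q)+I(X_1X_2X_3;Y_2|V_2Q),\\ 2R_1+R_2&\le I(X_1;Y_1Y_3|V_1X_2X_3Q)+I(X_1X_2;Y_1Y_3|X_3Q)+I(X_1X_2X_3;Y_2|V_2Q),\\ 2R_1+R_2&\le I(X_1;Y_1Y_3|\mathbf V_1X_2X_3Q)+I(X_1X_2X_3;Y_1|Q)+I(X_1X_2;Y_2Y_3|V_2X_3Q),\\ 2R_1+R_2&\le I(X_1;Y_1Y_3|\mathbf V_1X_2X_3Q)+I(X_1X_2;Y_1Y_3|X_3Q)+I(X_1X_2;Y_2Y_3|V_2X_3Q),\\ R_1+2R_2&\le I(X_1X_2X_3;Y_1|V_1Q)+I(X_2;Y_2|X_1V_2X_3Q)+I(X_1X_2X_3;Y_2|Q),\\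 R_1+2R_2&\le I(X_1X_2;Y_1Y_3|V_1X_3Q)+I(X_2;Y_2|X_1V_2X_3Q)+I(X_1X_2X_3;Y_2|Q),\\ R_1+2R_2&\le I(X_1X_2;Y_1Y_3|\mathbf V_1X_3Q)+I(X_2;Y_2|X_1V_2X_3Q)+I(X_1X_2;Y_2Y_3|X_3Q). \end{align*} **Theorem (outer bound).** Every achievable rate pair of such an IS-IRC lies in the closure of $\bigcup_{P_1\in\mathcal P_1}\mathcal R_o(P_1)$. If the input and output alphabets $\mathcal X_1,\mathcal X_2,\mathcal X_3,\mathcal Y_1,\mathcal Y_2,\mathcal Y_3$ are finite, it lies in $\bigcup_{P_1\in\mathcal P_1}\mathcal R_o(P_1)$ itself. -/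

import Mathlib

open MeasureTheory ProbabilityTheory InformationTheory
open scoped ENNReal

noncomputable section

namespace IRC

/-! ### Conditional mutual information -/

/-- The pair `(A, B)` of two random variables. -/
def rvPair {Ω α β : Type*} (A : Ω → α) (B : Ω → β) : Ω → α × β := fun ω => (A ω, B ω)

infixr:67 " ⋈ " => rvPair

/-- Conditional mutual information `I(A; B | C)` in bits: the Kullback-Leibler divergence of the
joint law of `(C, A, B)` from the law with the same marginals of `(C, A)` and `(C, B)` under which
`A` and `B` are conditionally independent given `C`. It takes values in `[0, ∞]`. -/
def condMI {Ω α β γ : Type*} [MeasurableSpace Ω] [MeasurableSpace α] [MeasurableSpace β]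
    [MeasurableSpace γ] [StandardBorelSpace α] [Nonempty α] [StandardBorelSpace β] [Nonempty β]
    (μ : Measure Ω) [IsFiniteMeasure μ] (A : Ω → α) (B : Ω → β) (C : Ω → γ) : ℝ≥0∞ :=
  klDiv (μ.map (C ⋈ A ⋈ B)) ((μ.map C) ⊗ₘ (condDistrib A C μ ×ₖ condDistrib B C μ))
    / ENNReal.ofReal (Real.log 2)

/-! ### Codes for an interference relay channel and achievable rates -/

section Coding

variable {𝓧₁ 𝓧₂ 𝓧₃ 𝓨₁ 𝓨₂ 𝓨₃ : Type*} [MeasurableSpace 𝓧₁] [MeasurableSpace 𝓧₂]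
  [MeasurableSpace 𝓧₃] [MeasurableSpace 𝓨₁] [MeasurableSpace 𝓨₂] [MeasurableSpace 𝓨₃]

/-- A causal relay: the input at time `i` (counted from `0`) is a function of the `i` relay outputs
observed before. A code of block length `n` uses the first `n` functions only. -/
structure Relay (𝓧₃ 𝓨₃ : Type*) [MeasurableSpace 𝓧₃] [MeasurableSpace 𝓨₃] where
  φ : (i : ℕ) → (Fin i → 𝓨₃) → 𝓧₃
  measurable_φ : ∀ i, Measurable (φ i)

/-- The three channel inputs at time `i`, given the source inputs `(x₁, x₂)` at that time and the
outputs up to that time. -/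
def Relay.inputs (r : Relay 𝓧₃ 𝓨₃) (i : ℕ) (x : 𝓧₁ × 𝓧₂) (h : Fin i → 𝓨₁ × 𝓨₂ × 𝓨₃) :
    𝓧₁ × 𝓧₂ × 𝓧₃ :=
  (x.1, x.2, r.φ i fun j => (h j).2.2)

lemma Relay.measurable_inputs (r : Relay 𝓧₃ 𝓨₃) (i : ℕ) (x : 𝓧₁ × 𝓧₂) :
    Measurable (r.inputs i x : (Fin i → 𝓨₁ × 𝓨₂ × 𝓨₃) → 𝓧₁ × 𝓧₂ × 𝓧₃) := by
  have h : Measurable fun h : Fin i → 𝓨₁ × 𝓨₂ × 𝓨₃ => r.φ i fun j => (h j).2.2 :=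
    (r.measurable_φ i).comp (by fun_prop)
  exact measurable_const.prodMk (measurable_const.prodMk h)

/-- The law of the outputs of `n` uses of the memoryless channel `W` (without feedback to the
sources) when the sources send the sequences `x = (x₁ⁿ, x₂ⁿ)` and the relay uses `r`. -/
def outputLaw (W : Kernel (𝓧₁ × 𝓧₂ × 𝓧₃) (𝓨₁ × 𝓨₂ × 𝓨₃)) (r : Relay 𝓧₃ 𝓨₃) :
    (n : ℕ) → (Fin n → 𝓧₁ × 𝓧₂) → Measure (Fin n → 𝓨₁ × 𝓨₂ × 𝓨₃)
  | 0, _ => Measure.dirac Fin.elim0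
  | n + 1, x =>
    (outputLaw W r n (Fin.init x) ⊗ₘ
      W.comap (r.inputs n (x (Fin.last n))) (r.measurable_inputs n (x (Fin.last n)))).map
        fun p : (Fin n → 𝓨₁ × 𝓨₂ × 𝓨₃) × (𝓨₁ × 𝓨₂ × 𝓨₃) =>
          (Fin.snoc p.1 p.2 : Fin (n + 1) → 𝓨₁ × 𝓨₂ × 𝓨₃)

/-- A code of block length `n` with `M₁` and `M₂` messages. -/
structure Code (𝓧₁ 𝓧₂ 𝓧₃ 𝓨₁ 𝓨₂ 𝓨₃ : Type*) [MeasurableSpace 𝓧₃] [MeasurableSpace 𝓨₁]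
    [MeasurableSpace 𝓨₂] [MeasurableSpace 𝓨₃] (n M₁ M₂ : ℕ) where
  enc₁ : Fin M₁ → Fin n → 𝓧₁
  enc₂ : Fin M₂ → Fin n → 𝓧₂
  relay : Relay 𝓧₃ 𝓨₃
  dec₁ : (Fin n → 𝓨₁) → Fin M₁
  dec₂ : (Fin n → 𝓨₂) → Fin M₂
  measurable_dec₁ : Measurable dec₁
  measurable_dec₂ : Measurable dec₂

/-- The average probability that at least one of the two messages is decoded wrongly. -/
def Code.errorProb {n M₁ M₂ : ℕ} (c : Code 𝓧₁ 𝓧₂ 𝓧₃ 𝓨₁ 𝓨₂ 𝓨₃ n M₁ M₂)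
    (W : Kernel (𝓧₁ × 𝓧₂ × 𝓧₃) (𝓨₁ × 𝓨₂ × 𝓨₃)) : ℝ≥0∞ :=
  (∑ m₁ : Fin M₁, ∑ m₂ : Fin M₂,
    outputLaw W c.relay n (fun i => (c.enc₁ m₁ i, c.enc₂ m₂ i))
      {y | (c.dec₁ (fun i => (y i).1), c.dec₂ (fun i => (y i).2.1)) ≠ (m₁, m₂)})
    / ((M₁ : ℝ≥0∞) * (M₂ : ℝ≥0∞))

/-- The pair of nonnegative rates `R = (R₁, R₂)`, in bits per channel use, is achievable. -/
def Achievable (W : Kernel (𝓧₁ × 𝓧₂ × 𝓧₃) (𝓨₁ × 𝓨₂ × 𝓨₃)) (R : ℝ × ℝ) : Prop :=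
  0 ≤ R.1 ∧ 0 ≤ R.2 ∧ ∀ ε : ℝ, 0 < ε →
    ∃ n : ℕ, 0 < n ∧ ∃ (M₁ M₂ : ℕ) (c : Code 𝓧₁ 𝓧₂ 𝓧₃ 𝓨₁ 𝓨₂ 𝓨₃ n M₁ M₂),
      (2 : ℝ) ^ ((n : ℝ) * (R.1 - ε)) ≤ (M₁ : ℝ) ∧ (2 : ℝ) ^ ((n : ℝ) * (R.2 - ε)) ≤ (M₂ : ℝ) ∧
      c.errorProb W ≤ ENNReal.ofReal ε

end Coding

/-! ### The injective semideterministic interference relay channel -/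

/-- An injective semideterministic interference relay channel in which the relay sees only source 1
and the channel outputs have no noise correlation. The vector interference signal is
`(S₁, S₃)`; the outputs are `Y₁ = f₁(X₁, X₃, S₂)`, `Y₂ = f₂'(X₂, S₁)` and
`Y₃ = f₃(X₂, (S₁, S₃))`, and `f₂ = (f₂', f₃)` gives the pair `(Y₂, Y₃)`. -/
structure ISIRC (𝓧₁ 𝓧₂ 𝓧₃ 𝓢₁ 𝓢₂ 𝓢₃ 𝓨₁ 𝓨₂ 𝓨₃ : Type*) [MeasurableSpace 𝓧₁] [MeasurableSpace 𝓧₂]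
    [MeasurableSpace 𝓧₃] [MeasurableSpace 𝓢₁] [MeasurableSpace 𝓢₂] [MeasurableSpace 𝓢₃]
    [MeasurableSpace 𝓨₁] [MeasurableSpace 𝓨₂] [MeasurableSpace 𝓨₃] where
  /-- the conditional law of `(S₁, S₃)` given `(X₁, X₃)` -/
  pS₁ : Kernel (𝓧₁ × 𝓧₃) (𝓢₁ × 𝓢₃)
  /-- the conditional law of `S₂` given `X₂` -/
  pS₂ : Kernel 𝓧₂ 𝓢₂
  markov₁ : IsMarkovKernel pS₁
  markov₂ : IsMarkovKernel pS₂
  f₁ : 𝓧₁ → 𝓧₃ → 𝓢₂ → 𝓨₁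
  f₂' : 𝓧₂ → 𝓢₁ → 𝓨₂
  f₃ : 𝓧₂ → 𝓢₁ × 𝓢₃ → 𝓨₃
  measurable_f₁ : Measurable fun p : 𝓧₁ × 𝓧₃ × 𝓢₂ => f₁ p.1 p.2.1 p.2.2
  measurable_f₂' : Measurable fun p : 𝓧₂ × 𝓢₁ => f₂' p.1 p.2
  measurable_f₃ : Measurable fun p : 𝓧₂ × (𝓢₁ × 𝓢₃) => f₃ p.1 p.2
  injective_f₁ : ∀ x₁ x₃, Function.Injective (f₁ x₁ x₃)
  injective_f₂' : ∀ x₂, Function.Injective (f₂' x₂)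
  injective_f₂ : ∀ x₂, Function.Injective fun s : 𝓢₁ × 𝓢₃ => (f₂' x₂ s.1, f₃ x₂ s)
  /-- the relay sees only source 1: the law of `Y₃` given the inputs does not depend on `x₂` -/
  relay_sees_source₁ : ∀ x₁ x₂ x₂' x₃,
    (pS₁ (x₁, x₃)).map (f₃ x₂) = (pS₁ (x₁, x₃)).map (f₃ x₂')
  /-- no noise correlation: `Y₂` and `Y₃` are conditionally independent given the inputs
  (`Y₁` is conditionally independent of `(Y₂, Y₃)` by construction) -/
  no_noise_correlation : ∀ x₁ x₂ x₃,
    IndepFun (fun s : 𝓢₁ × 𝓢₃ => f₂' x₂ s.1) (f₃ x₂) (pS₁ (x₁, x₃))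

attribute [instance] ISIRC.markov₁ ISIRC.markov₂

/-- A distribution `p(q) p(x₁ x₃ | q) p(x₂ | q)` of the time-sharing variable and the inputs. -/
structure InputLaw (𝓧₁ 𝓧₂ 𝓧₃ : Type*) [MeasurableSpace 𝓧₁] [MeasurableSpace 𝓧₂]
    [MeasurableSpace 𝓧₃] where
  /-- the number of values of the time-sharing variable `Q` -/
  m : ℕ
  pQ : Measure (Fin m)
  pX₁₃ : Kernel (Fin m) (𝓧₁ × 𝓧₃)
  pX₂ : Kernel (Fin m) 𝓧₂
  prob_pQ : IsProbabilityMeasure pQ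
  markov₁₃ : IsMarkovKernel pX₁₃
  markov₂ : IsMarkovKernel pX₂

attribute [instance] InputLaw.prob_pQ InputLaw.markov₁₃ InputLaw.markov₂

namespace ISIRC

variable {𝓧₁ 𝓧₂ 𝓧₃ 𝓢₁ 𝓢₂ 𝓢₃ 𝓨₁ 𝓨₂ 𝓨₃ : Type*} [MeasurableSpace 𝓧₁] [MeasurableSpace 𝓧₂]
  [MeasurableSpace 𝓧₃] [MeasurableSpace 𝓢₁] [MeasurableSpace 𝓢₂] [MeasurableSpace 𝓢₃]
  [MeasurableSpace 𝓨₁] [MeasurableSpace 𝓨₂] [MeasurableSpace 𝓨₃]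

/-- The conditional law of the interference signals `((S₁, S₃), S₂)` given the inputs
`(x₁, x₂, x₃)`, namely `p(s₁ s₃ | x₁ x₃) p(s₂ | x₂)`. -/
def signal (ch : ISIRC 𝓧₁ 𝓧₂ 𝓧₃ 𝓢₁ 𝓢₂ 𝓢₃ 𝓨₁ 𝓨₂ 𝓨₃) :
    Kernel (𝓧₁ × 𝓧₂ × 𝓧₃) ((𝓢₁ × 𝓢₃) × 𝓢₂) :=
  (ch.pS₁.comap (fun x : 𝓧₁ × 𝓧₂ × 𝓧₃ => (x.1, x.2.2)) (by fun_prop)) ×ₖ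
    (ch.pS₂.comap (fun x : 𝓧₁ × 𝓧₂ × 𝓧₃ => x.2.1) (by fun_prop))

instance (ch : ISIRC 𝓧₁ 𝓧₂ 𝓧₃ 𝓢₁ 𝓢₂ 𝓢₃ 𝓨₁ 𝓨₂ 𝓨₃) : IsMarkovKernel ch.signal := by
  unfold signal; infer_instance

/-- The outputs `(y₁, y₂, y₃)` as a function of the inputs and the interference signals. -/
def output (ch : ISIRC 𝓧₁ 𝓧₂ 𝓧₃ 𝓢₁ 𝓢₂ 𝓢₃ 𝓨₁ 𝓨₂ 𝓨₃)
    (p : (𝓧₁ × 𝓧₂ × 𝓧₃) × ((𝓢₁ × 𝓢₃) × 𝓢₂)) : 𝓨₁ × 𝓨₂ × 𝓨₃ :=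
  (ch.f₁ p.1.1 p.1.2.2 p.2.2, ch.f₂' p.1.2.1 p.2.1.1, ch.f₃ p.1.2.1 p.2.1)

lemma measurable_output (ch : ISIRC 𝓧₁ 𝓧₂ 𝓧₃ 𝓢₁ 𝓢₂ 𝓢₃ 𝓨₁ 𝓨₂ 𝓨₃) : Measurable ch.output := by
  have h1 : Measurable fun p : (𝓧₁ × 𝓧₂ × 𝓧₃) × ((𝓢₁ × 𝓢₃) × 𝓢₂) =>
      ch.f₁ p.1.1 p.1.2.2 p.2.2 :=
    ch.measurable_f₁.comp
      (f := fun p : (𝓧₁ × 𝓧₂ × 𝓧₃) × ((𝓢₁ × 𝓢₃) × 𝓢₂) => (p.1.1, p.1.2.2, p.2.2)) (by fun_prop)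
  have h2 : Measurable fun p : (𝓧₁ × 𝓧₂ × 𝓧₃) × ((𝓢₁ × 𝓢₃) × 𝓢₂) =>
      ch.f₂' p.1.2.1 p.2.1.1 :=
    ch.measurable_f₂'.comp
      (f := fun p : (𝓧₁ × 𝓧₂ × 𝓧₃) × ((𝓢₁ × 𝓢₃) × 𝓢₂) => (p.1.2.1, p.2.1.1)) (by fun_prop)
  have h3 : Measurable fun p : (𝓧₁ × 𝓧₂ × 𝓧₃) × ((𝓢₁ × 𝓢₃) × 𝓢₂) =>
      ch.f₃ p.1.2.1 p.2.1 :=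
    ch.measurable_f₃.comp
      (f := fun p : (𝓧₁ × 𝓧₂ × 𝓧₃) × ((𝓢₁ × 𝓢₃) × 𝓢₂) => (p.1.2.1, p.2.1)) (by fun_prop)
  exact h1.prodMk (h2.prodMk h3)

/-- The channel `p(y₁, y₂, y₃ | x₁, x₂, x₃)`. -/
def channel (ch : ISIRC 𝓧₁ 𝓧₂ 𝓧₃ 𝓢₁ 𝓢₂ 𝓢₃ 𝓨₁ 𝓨₂ 𝓨₃) :
    Kernel (𝓧₁ × 𝓧₂ × 𝓧₃) (𝓨₁ × 𝓨₂ × 𝓨₃) :=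
  (Kernel.id ×ₖ ch.signal).map ch.output

instance (ch : ISIRC 𝓧₁ 𝓧₂ 𝓧₃ 𝓢₁ 𝓢₂ 𝓢₃ 𝓨₁ 𝓨₂ 𝓨₃) : IsMarkovKernel ch.channel :=
  Kernel.IsMarkovKernel.map _ ch.measurable_output

/-- Sample points `((q, (x₁, x₃), x₂), ((s₁, s₃), s₂), ((v₁, v₃), v₂))`. -/
abbrev Sample (𝓧₁ 𝓧₂ 𝓧₃ 𝓢₁ 𝓢₂ 𝓢₃ : Type*) (m : ℕ) : Type _ :=
  (Fin m × (𝓧₁ × 𝓧₃) × 𝓧₂) × ((𝓢₁ × 𝓢₃) × 𝓢₂) × ((𝓢₁ × 𝓢₃) × 𝓢₂)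

/-- The joint law of `Q`, the inputs, the interference signals `((S₁, S₃), S₂)` and
`((V₁, V₃), V₂)`, a conditionally independent copy of them given `(X₁, X₂, X₃)`. -/
def jointLaw (ch : ISIRC 𝓧₁ 𝓧₂ 𝓧₃ 𝓢₁ 𝓢₂ 𝓢₃ 𝓨₁ 𝓨₂ 𝓨₃) (P : InputLaw 𝓧₁ 𝓧₂ 𝓧₃) :
    Measure (Sample 𝓧₁ 𝓧₂ 𝓧₃ 𝓢₁ 𝓢₂ 𝓢₃ P.m) :=
  (P.pQ ⊗ₘ (P.pX₁₃ ×ₖ P.pX₂)) ⊗ₘ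
    (ch.signal ×ₖ ch.signal).comap
      (fun w : Fin P.m × (𝓧₁ × 𝓧₃) × 𝓧₂ => (w.2.1.1, w.2.2, w.2.1.2)) (by fun_prop)

instance (ch : ISIRC 𝓧₁ 𝓧₂ 𝓧₃ 𝓢₁ 𝓢₂ 𝓢₃ 𝓨₁ 𝓨₂ 𝓨₃) (P : InputLaw 𝓧₁ 𝓧₂ 𝓧₃) :
    IsProbabilityMeasure (ch.jointLaw P) := by
  unfold jointLaw; infer_instance

variable [StandardBorelSpace 𝓧₁] [StandardBorelSpace 𝓧₂] [StandardBorelSpace 𝓧₃]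
  [StandardBorelSpace 𝓨₁] [StandardBorelSpace 𝓨₂] [StandardBorelSpace 𝓨₃]
  [Nonempty 𝓧₁] [Nonempty 𝓧₂] [Nonempty 𝓧₃] [Nonempty 𝓨₁] [Nonempty 𝓨₂] [Nonempty 𝓨₃]

/-- The region of the nonnegative rate pairs `R = (R₁, R₂)` that satisfy the twenty bounds for the
joint law given by `P`. -/
def outerRegion (ch : ISIRC 𝓧₁ 𝓧₂ 𝓧₃ 𝓢₁ 𝓢₂ 𝓢₃ 𝓨₁ 𝓨₂ 𝓨₃) (P : InputLaw 𝓧₁ 𝓧₂ 𝓧₃) :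
    Set (ℝ × ℝ) :=
  let Ω := Sample 𝓧₁ 𝓧₂ 𝓧₃ 𝓢₁ 𝓢₂ 𝓢₃ P.m
  let μ : Measure Ω := ch.jointLaw P
  let Q : Ω → Fin P.m := fun ω => ω.1.1
  let X₁ : Ω → 𝓧₁ := fun ω => ω.1.2.1.1
  let X₂ : Ω → 𝓧₂ := fun ω => ω.1.2.2
  let X₃ : Ω → 𝓧₃ := fun ω => ω.1.2.1.2
  let V₁ : Ω → 𝓢₁ := fun ω => ω.2.2.1.1
  let V₁vec : Ω → 𝓢₁ × 𝓢₃ := fun ω => ω.2.2.1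
  let V₂ : Ω → 𝓢₂ := fun ω => ω.2.2.2
  let Y₁ : Ω → 𝓨₁ := fun ω => (ch.output ((X₁ ω, X₂ ω, X₃ ω), ω.2.1)).1
  let Y₂ : Ω → 𝓨₂ := fun ω => (ch.output ((X₁ ω, X₂ ω, X₃ ω), ω.2.1)).2.1
  let Y₃ : Ω → 𝓨₃ := fun ω => (ch.output ((X₁ ω, X₂ ω, X₃ ω), ω.2.1)).2.2
  {R | 0 ≤ R.1 ∧ 0 ≤ R.2 ∧
    -- bounds on `R₁`
    ENNReal.ofReal R.1 ≤ condMI μ X₁ (Y₁ ⋈ Y₃) (X₂ ⋈ X₃ ⋈ Q) ∧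
    ENNReal.ofReal R.1 ≤ condMI μ (X₁ ⋈ X₃) Y₁ (X₂ ⋈ Q) ∧
    -- bound on `R₂`
    ENNReal.ofReal R.2 ≤ condMI μ X₂ Y₂ (X₁ ⋈ X₃ ⋈ Q) ∧
    -- bounds on `R₁ + R₂`
    ENNReal.ofReal (R.1 + R.2) ≤
      condMI μ (X₁ ⋈ X₃) Y₁ (V₁ ⋈ X₂ ⋈ Q) + condMI μ (X₁ ⋈ X₂ ⋈ X₃) Y₂ Q ∧
    ENNReal.ofReal (R.1 + R.2) ≤
      condMI μ (X₁ ⋈ X₂ ⋈ X₃) Y₁ (V₁ ⋈ Q) + condMI μ (X₁ ⋈ X₂ ⋈ X₃) Y₂ (V₂ ⋈ Q) ∧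
    ENNReal.ofReal (R.1 + R.2) ≤
      condMI μ (X₁ ⋈ X₂ ⋈ X₃) Y₁ Q + condMI μ X₂ Y₂ (X₁ ⋈ V₂ ⋈ X₃ ⋈ Q) ∧
    ENNReal.ofReal (R.1 + R.2) ≤
      condMI μ X₁ (Y₁ ⋈ Y₃) (V₁ ⋈ X₂ ⋈ X₃ ⋈ Q) + condMI μ (X₁ ⋈ X₂ ⋈ X₃) Y₂ Q ∧
    ENNReal.ofReal (R.1 + R.2) ≤
      condMI μ (X₁ ⋈ X₂) (Y₁ ⋈ Y₃) (V₁ ⋈ X₃ ⋈ Q) + condMI μ (X₁ ⋈ X₂ ⋈ X₃) Y₂ (V₂ ⋈ Q) ∧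
    ENNReal.ofReal (R.1 + R.2) ≤
      condMI μ (X₁ ⋈ X₂) (Y₁ ⋈ Y₃) (X₃ ⋈ Q) + condMI μ X₂ Y₂ (X₁ ⋈ V₂ ⋈ X₃ ⋈ Q) ∧
    ENNReal.ofReal (R.1 + R.2) ≤
      condMI μ X₁ (Y₁ ⋈ Y₃) (V₁vec ⋈ X₂ ⋈ X₃ ⋈ Q) +
        condMI μ (X₁ ⋈ X₂) (Y₂ ⋈ Y₃) (X₃ ⋈ Q) ∧
    ENNReal.ofReal (R.1 + R.2) ≤
      condMI μ (X₁ ⋈ X₂) (Y₁ ⋈ Y₃) (V₁vec ⋈ X₃ ⋈ Q) +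
        condMI μ (X₁ ⋈ X₂) (Y₂ ⋈ Y₃) (V₂ ⋈ X₃ ⋈ Q) ∧
    -- bounds on `2 R₁ + R₂`
    ENNReal.ofReal (2 * R.1 + R.2) ≤
      condMI μ (X₁ ⋈ X₃) Y₁ (V₁ ⋈ X₂ ⋈ Q) + condMI μ (X₁ ⋈ X₂ ⋈ X₃) Y₁ Q +
        condMI μ (X₁ ⋈ X₂ ⋈ X₃) Y₂ (V₂ ⋈ Q) ∧
    ENNReal.ofReal (2 * R.1 + R.2) ≤
      condMI μ (X₁ ⋈ X₃) Y₁ (V₁ ⋈ X₂ ⋈ Q) + condMI μ (X₁ ⋈ X₂) (Y₁ ⋈ Y₃) (X₃ ⋈ Q) +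
        condMI μ (X₁ ⋈ X₂ ⋈ X₃) Y₂ (V₂ ⋈ Q) ∧
    ENNReal.ofReal (2 * R.1 + R.2) ≤
      condMI μ X₁ (Y₁ ⋈ Y₃) (V₁ ⋈ X₂ ⋈ X₃ ⋈ Q) + condMI μ (X₁ ⋈ X₂ ⋈ X₃) Y₁ Q +
        condMI μ (X₁ ⋈ X₂ ⋈ X₃) Y₂ (V₂ ⋈ Q) ∧
    ENNReal.ofReal (2 * R.1 + R.2) ≤
      condMI μ X₁ (Y₁ ⋈ Y₃) (V₁ ⋈ X₂ ⋈ X₃ ⋈ Q) + condMI μ (X₁ ⋈ X₂) (Y₁ ⋈ Y₃) (X₃ ⋈ Q) +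
        condMI μ (X₁ ⋈ X₂ ⋈ X₃) Y₂ (V₂ ⋈ Q) ∧
    ENNReal.ofReal (2 * R.1 + R.2) ≤
      condMI μ X₁ (Y₁ ⋈ Y₃) (V₁vec ⋈ X₂ ⋈ X₃ ⋈ Q) + condMI μ (X₁ ⋈ X₂ ⋈ X₃) Y₁ Q +
        condMI μ (X₁ ⋈ X₂) (Y₂ ⋈ Y₃) (V₂ ⋈ X₃ ⋈ Q) ∧
    ENNReal.ofReal (2 * R.1 + R.2) ≤
      condMI μ X₁ (Y₁ ⋈ Y₃) (V₁vec ⋈ X₂ ⋈ X₃ ⋈ Q) + condMI μ (X₁ ⋈ X₂) (Y₁ ⋈ Y₃) (X₃ ⋈ Q) +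
        condMI μ (X₁ ⋈ X₂) (Y₂ ⋈ Y₃) (V₂ ⋈ X₃ ⋈ Q) ∧
    -- bounds on `R₁ + 2 R₂`
    ENNReal.ofReal (R.1 + 2 * R.2) ≤
      condMI μ (X₁ ⋈ X₂ ⋈ X₃) Y₁ (V₁ ⋈ Q) + condMI μ X₂ Y₂ (X₁ ⋈ V₂ ⋈ X₃ ⋈ Q) +
        condMI μ (X₁ ⋈ X₂ ⋈ X₃) Y₂ Q ∧
    ENNReal.ofReal (R.1 + 2 * R.2) ≤
      condMI μ (X₁ ⋈ X₂) (Y₁ ⋈ Y₃) (V₁ ⋈ X₃ ⋈ Q) + condMI μ X₂ Y₂ (X₁ ⋈ V₂ ⋈ X₃ ⋈ Q) +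
        condMI μ (X₁ ⋈ X₂ ⋈ X₃) Y₂ Q ∧
    ENNReal.ofReal (R.1 + 2 * R.2) ≤
      condMI μ (X₁ ⋈ X₂) (Y₁ ⋈ Y₃) (V₁vec ⋈ X₃ ⋈ Q) + condMI μ X₂ Y₂ (X₁ ⋈ V₂ ⋈ X₃ ⋈ Q) +
        condMI μ (X₁ ⋈ X₂) (Y₂ ⋈ Y₃) (X₃ ⋈ Q)}

end ISIRC

end IRC

end

noncomputable section

set_option linter.unusedSectionVars false

namespace IRC


/-! ### Kullback-Leibler divergence and re-encodings -/

/-! This is a genie argument in which the genie supplies conditionally independent copies of the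
interference. With uniform messages W₁, W₂, `procLaw` runs the code and draws at each time, besides
the true noise ((S₁, Y₃), S₂), a fresh copy ((V₁, V₃), V₂) given the same inputs; the relay hears
the true Y₃ only. By `fano`, I(W₁; Y₁ᴺ) and I(W₂; Y₂ᴺ) are at least N times the rates up to a
vanishing loss, so it remains to bound them by sums of single-letter informations.

To bound I(W₁; Y₁ᴺ), destination 1 is also given some of the copies, Y₃ᴺ or W₂. For each time the
chain rule (`cmi_le_sum_obs`) leaves a copy term and an output term. The copy term is at most
`info₁` or `info₁₃`, the information carried by the true interference, because a copy letter depends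
on the past only through the inputs and the copies have the law of the true signals (`cmi_copy₁_le`,
`cmi_copy₁₃_le`). If W₂ is not given, the output term leaves room: the single-letter information
also contains what the past says about Y₁ once W₁ is known, and this is at least `info₂`, since Y₁
reveals S₂ injectively to whoever knows X₁ and X₃ (`cmi_add_cmi_le`, `cmi_le_cmi_of_recover`). The
results have the form I(W₁; Y₁ᴺ) + a ≤ A + t for destination 1 and, with the roles exchanged, I(W₂;
Y₂ᴺ) + A ≤ a + t' for destination 2, where a and A are sums of such interference informations and
one of them may be absent. In suitable sums of the sixteen inequalities these quantities cancel, and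
the twenty bounds remain (`bounds_of_le`).

Since the relay sees only source 1, source 1 with the relay and source 2 evolve as independent
processes (`seqLaw_prod`). The lack of noise correlation and the injectivity of f₂' make S₁ and Y₃
conditionally independent given the inputs, so V₁, which is drawn independently of the true Y₃, can
stand for S₁ jointly with W₁ and the relay outputs (`procLaw_map_sourceRelay`).

On general alphabets entropies are not available, so everything is expressed through divergences in
[0, ∞]. The compensation identity `klDiv_compProd_comap_eq_add` yields the chain rule and data
processing. Cancellation needs finiteness: `info₂` and `info₁₃` are finite because messages are,
whereas `info₁` may be infinite, in which case the right-hand sides concerned are infinite too.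

Taking Q to be a uniform time turns the sums into the quantities of the outer region for slightly
smaller rates, which gives the closure. For finite alphabets the union of the regions is already
closed: the attainable vectors of sixteen informations form the convex hull of a continuous image of
a compact set, and the union is a projection along this compact hull. -/

lemma klDiv_map_of_leftInverse {α β : Type*} [MeasurableSpace α] [MeasurableSpace β]
    (μ ν : Measure α) [IsFiniteMeasure μ] [IsFiniteMeasure ν] {g : α → β} {h : β → α}
    (hg : Measurable g) (hh : Measurable h) (hgh : Function.LeftInverse h g) :
    klDiv (μ.map g) (ν.map g) = klDiv μ ν := by
  refine le_antisymm (klDiv_map_le μ ν hg) ?_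
  have := klDiv_map_le (μ.map g) (ν.map g) hh
  rwa [Measure.map_map hh hg, Measure.map_map hh hg, hgh.comp_eq_id, Measure.map_id,
    Measure.map_id] at this

/-! ### Regrouping of composition-products. -/

section CompProd

variable {α β γ : Type*} [MeasurableSpace α] [MeasurableSpace β] [MeasurableSpace γ]

lemma compProd_comap_fst_swap (ν : Measure γ) [SFinite ν] (κ : Kernel γ α) [IsSFiniteKernel κ]
    (η : Kernel γ β) [IsSFiniteKernel η] :
    ((ν ⊗ₘ κ) ⊗ₘ η.comap Prod.fst measurable_fst).map
        (fun p : (γ × α) × β => ((p.1.1, p.2), p.1.2)) =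
      (ν ⊗ₘ η) ⊗ₘ κ.comap Prod.fst measurable_fst := by
  refine Measure.ext_of_lintegral _ fun f hf => ?_
  rw [lintegral_map hf (by fun_prop), Measure.lintegral_compProd (by fun_prop),
    Measure.lintegral_compProd, Measure.lintegral_compProd hf, Measure.lintegral_compProd]
  · refine lintegral_congr fun c => ?_
    simp only [Kernel.comap_apply]
    exact lintegral_lintegral_swap (by fun_prop)
  · exact Measurable.lintegral_kernel_prod_right' (κ := κ.comap Prod.fst measurable_fst) hf
  · exact Measurable.lintegral_kernel_prod_right' (κ := η.comap Prod.fst measurable_fst)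
      (f := fun p : (γ × α) × β => f ((p.1.1, p.2), p.1.2)) (by fun_prop)

lemma compProd_prod_map_assoc (ν : Measure γ) [SFinite ν] (κ : Kernel γ α) [IsSFiniteKernel κ]
    (η : Kernel γ β) [IsSFiniteKernel η] :
    (ν ⊗ₘ (κ ×ₖ η)).map (fun p : γ × α × β => ((p.1, p.2.1), p.2.2)) =
      (ν ⊗ₘ κ) ⊗ₘ η.comap Prod.fst measurable_fst := by
  refine Measure.ext_of_lintegral _ fun f hf => ?_
  rw [lintegral_map hf (by fun_prop), Measure.lintegral_compProd (by fun_prop),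
    Measure.lintegral_compProd hf, Measure.lintegral_compProd]
  · refine lintegral_congr fun c => ?_
    simp only [Kernel.comap_apply, Kernel.prod_apply]
    rw [lintegral_prod _ (by fun_prop)]
  · exact Measurable.lintegral_kernel_prod_right' (κ := η.comap Prod.fst measurable_fst) hf

/-- Pushing forward a composition-product along a map of the first coordinate through which the
kernel factors. -/
lemma compProd_comap_map_prodMap {δ : Type*} [MeasurableSpace δ] (ν : Measure γ) [SFinite ν]
    (κ : Kernel δ β) [IsSFiniteKernel κ] {Z : γ → δ} (hZ : Measurable Z) {u : γ → α}
    (hu : Measurable u) {ζ : α → δ} (hζ : Measurable ζ) (h : ∀ x, ζ (u x) = Z x) :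
    (ν ⊗ₘ κ.comap Z hZ).map (Prod.map u id) = (ν.map u) ⊗ₘ κ.comap ζ hζ := by
  refine Measure.ext_of_lintegral _ fun f hf => ?_
  rw [lintegral_map hf (by fun_prop), Measure.lintegral_compProd (by fun_prop),
    Measure.lintegral_compProd hf, lintegral_map _ hu]
  · simp [Kernel.comap_apply, h]
  · exact Measurable.lintegral_kernel_prod_right' (κ := κ.comap ζ hζ) hf

end CompProd

/-! ### Conditional mutual information in nats -/

@[fun_prop]
lemma measurable_rvPair {Ω α β : Type*} [MeasurableSpace Ω] [MeasurableSpace α]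
    [MeasurableSpace β] {A : Ω → α} {B : Ω → β} (hA : Measurable A) (hB : Measurable B) :
    Measurable (A ⋈ B) := hA.prodMk hB

/-- Conditional mutual information in nats. -/
def cmi {Ω α β γ : Type*} [MeasurableSpace Ω] [MeasurableSpace α] [MeasurableSpace β]
    [MeasurableSpace γ] [StandardBorelSpace α] [Nonempty α] [StandardBorelSpace β] [Nonempty β]
    (μ : Measure Ω) [IsFiniteMeasure μ] (A : Ω → α) (B : Ω → β) (C : Ω → γ) : ℝ≥0∞ :=
  klDiv (μ.map (C ⋈ A ⋈ B)) ((μ.map C) ⊗ₘ (condDistrib A C μ ×ₖ condDistrib B C μ))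

section cmi

variable {Ω α β γ : Type*} [MeasurableSpace Ω] [MeasurableSpace α] [MeasurableSpace β]
  [MeasurableSpace γ] [StandardBorelSpace α] [Nonempty α] [StandardBorelSpace β] [Nonempty β]
  {μ : Measure Ω} [IsFiniteMeasure μ] {A : Ω → α} {B : Ω → β} {C : Ω → γ}

lemma condMI_eq_cmi_div : condMI μ A B C = cmi μ A B C / ENNReal.ofReal (Real.log 2) := rfl

lemma map_rvPair_eq_compProd (hB : Measurable B) :
    μ.map (C ⋈ B) = (μ.map C) ⊗ₘ condDistrib B C μ :=
  (compProd_map_condDistrib hB.aemeasurable).symm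

/-- Grouping (C, A) as the base and B as the fibre puts the definition in the form to which the
chain rule of the divergence applies. -/
lemma cmi_eq_klDiv_compProd (hA : Measurable A) (hB : Measurable B) (hC : Measurable C) :
    cmi μ A B C = klDiv (μ.map ((C ⋈ A) ⋈ B))
      ((μ.map (C ⋈ A)) ⊗ₘ (condDistrib B C μ).comap Prod.fst measurable_fst) := by
  have hm : Measurable (fun p : γ × α × β => ((p.1, p.2.1), p.2.2)) := by fun_prop
  have hm' : Measurable (fun p : (γ × α) × β => (p.1.1, p.1.2, p.2)) := by fun_prop
  rw [cmi, ← klDiv_map_of_leftInverse _ _ hm hm' (fun _ => rfl), compProd_prod_map_assoc,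
    Measure.map_map hm (by fun_prop : Measurable (C ⋈ A ⋈ B)), map_rvPair_eq_compProd hA]
  rfl

lemma cmi_comm (hA : Measurable A) (hB : Measurable B) (hC : Measurable C) :
    cmi μ A B C = cmi μ B A C := by
  have hm : Measurable (fun p : (γ × α) × β => ((p.1.1, p.2), p.1.2)) := by fun_prop
  have hm' : Measurable (fun p : (γ × β) × α => ((p.1.1, p.2), p.1.2)) := by fun_prop
  have hm'' : Measurable (fun p : γ × β × α => ((p.1, p.2.1), p.2.2)) := by fun_prop
  have hm3 : Measurable (fun p : (γ × β) × α => (p.1.1, p.1.2, p.2)) := by fun_prop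
  rw [cmi_eq_klDiv_compProd hA hB hC, ← klDiv_map_of_leftInverse _ _ hm hm' (fun _ => rfl),
    map_rvPair_eq_compProd hA, compProd_comap_fst_swap,
    Measure.map_map hm (by fun_prop : Measurable ((C ⋈ A) ⋈ B)), cmi_eq_klDiv_compProd hB hA hC,
    map_rvPair_eq_compProd hB]
  rfl

/-- Compensation identity: replacing the true conditional law of B given C by another kernel costs
exactly the divergence of the two. It is the chain rule of the divergence in the order C, B, A,
where the reference law of A given (C, B) is already that of A given C. -/
lemma klDiv_compProd_comap_eq_add (hA : Measurable A) (hB : Measurable B) (hC : Measurable C)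
    (η : Kernel γ β) [IsMarkovKernel η] :
    klDiv (μ.map ((C ⋈ A) ⋈ B)) ((μ.map (C ⋈ A)) ⊗ₘ η.comap Prod.fst measurable_fst) =
      klDiv (μ.map (C ⋈ B)) (μ.map C ⊗ₘ η) + cmi μ A B C := by
  have hm : Measurable (fun p : (γ × α) × β => ((p.1.1, p.2), p.1.2)) := by fun_prop
  have hm' : Measurable (fun p : (γ × β) × α => ((p.1.1, p.2), p.1.2)) := by fun_prop
  rw [cmi_comm hA hB hC, cmi_eq_klDiv_compProd hB hA hC,
    ← klDiv_map_of_leftInverse _ _ hm hm' (fun _ => rfl),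
    map_rvPair_eq_compProd hA, compProd_comap_fst_swap,
    Measure.map_map hm (by fun_prop : Measurable ((C ⋈ A) ⋈ B))]
  have : ((fun p : (γ × α) × β => ((p.1.1, p.2), p.1.2)) ∘ ((C ⋈ A) ⋈ B)) = (C ⋈ B) ⋈ A := rfl
  rw [this, map_rvPair_eq_compProd (C := C ⋈ B) hA, ← klDiv_compProd_eq_add]

/-- The conditional mutual information is the least divergence of the joint law from a law under
which `B` depends on `C` only. -/
lemma cmi_le_klDiv (hA : Measurable A) (hB : Measurable B) (hC : Measurable C)
    (η : Kernel γ β) [IsMarkovKernel η] :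
    cmi μ A B C ≤
      klDiv (μ.map ((C ⋈ A) ⋈ B)) ((μ.map (C ⋈ A)) ⊗ₘ η.comap Prod.fst measurable_fst) := by
  rw [klDiv_compProd_comap_eq_add hA hB hC]
  exact le_add_self

/-- If `B` has the conditional law `η` given `C` and given `(C, A)`, then `I(A; B | C) = 0`. -/
lemma cmi_eq_zero_of_map_eq (hA : Measurable A) (hB : Measurable B) (hC : Measurable C)
    (η : Kernel γ β) [IsMarkovKernel η]
    (h : μ.map ((C ⋈ A) ⋈ B) = (μ.map (C ⋈ A)) ⊗ₘ η.comap Prod.fst measurable_fst) :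
    cmi μ A B C = 0 := by
  refine le_antisymm ((cmi_le_klDiv hA hB hC η).trans ?_) zero_le
  rw [h, klDiv_self]

variable {Ω' α' β' γ' : Type*} [MeasurableSpace Ω'] [MeasurableSpace α'] [MeasurableSpace β']
  [MeasurableSpace γ'] [StandardBorelSpace α'] [Nonempty α'] [StandardBorelSpace β'] [Nonempty β']
  {μ' : Measure Ω'} [IsFiniteMeasure μ']

/-- Data processing, between two probability spaces: the law of `(C', A', B')` is the image of the
law of `(C, A, B)` under a map `(c, a, b) ↦ (e c, f (c, a), g (c, b))` with `e` injective on the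
values of `C`. -/
lemma cmi_le_of_map_eq {A' : Ω' → α'} {B' : Ω' → β'} {C' : Ω' → γ'} (hA : Measurable A)
    (hB : Measurable B) (hC : Measurable C) (hA' : Measurable A') (hB' : Measurable B')
    (hC' : Measurable C') {e : γ → γ'} {e' : γ' → γ} (he : Measurable e) (he' : Measurable e')
    (hee : ∀ ω, e' (e (C ω)) = C ω) {f : γ × α → α'} (hf : Measurable f) {g : γ × β → β'}
    (hg : Measurable g)
    (h : μ'.map ((C' ⋈ A') ⋈ B') = μ.map (fun ω => ((e (C ω), f (C ω, A ω)), g (C ω, B ω)))) :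
    cmi μ' A' B' C' ≤ cmi μ A B C := by
  set Φ : (γ × α) × β → (γ' × α') × β' := fun p => ((e p.1.1, f p.1), g (p.1.1, p.2)) with hΦ
  have hΦm : Measurable Φ := by fun_prop
  -- The image under `Φ` of the law with A and B conditionally independent is again a law under
  -- which B' is drawn from a kernel of C' alone, and `η` is this kernel. It need not be the
  -- conditional law of B', hence the use of `cmi_le_klDiv`.
  set η : Kernel γ' β' := (Kernel.id ×ₖ (condDistrib B C μ).comap e' he').map
    (fun p : γ' × β => g (e' p.1, p.2)) with hη
  have hgm : Measurable (fun p : γ' × β => g (e' p.1, p.2)) := by fun_prop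
  have : IsMarkovKernel η := Kernel.IsMarkovKernel.map _ hgm
  refine (cmi_le_klDiv hA' hB' hC' η).trans ?_
  rw [cmi_eq_klDiv_compProd hA hB hC]
  refine le_trans (le_of_eq ?_) (klDiv_map_le _ _ hΦm)
  have h1 : (μ.map ((C ⋈ A) ⋈ B)).map Φ = μ'.map ((C' ⋈ A') ⋈ B') := by
    rw [h, Measure.map_map hΦm (by fun_prop : Measurable ((C ⋈ A) ⋈ B))]
    rfl
  have h2 : μ'.map (C' ⋈ A') = μ.map (fun ω => (e (C ω), f (C ω, A ω))) := by
    have h3 := congrArg (fun m => Measure.map Prod.fst m) h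
    rw [Measure.map_map measurable_fst (by fun_prop : Measurable ((C' ⋈ A') ⋈ B')),
      Measure.map_map measurable_fst (by fun_prop)] at h3
    exact h3
  rw [h1]
  congr 1
  refine Measure.ext_of_lintegral _ fun F hF => ?_
  have hm1 : Measurable fun p : γ' × α' =>
      ∫⁻ b, F (p, b) ∂(η.comap Prod.fst measurable_fst) p :=
    Measurable.lintegral_kernel_prod_right' (κ := η.comap Prod.fst measurable_fst) hF
  have hm2 : Measurable fun p : γ × α =>
      ∫⁻ b, F (Φ (p, b)) ∂((condDistrib B C μ).comap Prod.fst measurable_fst) p :=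
    Measurable.lintegral_kernel_prod_right'
      (κ := (condDistrib B C μ).comap Prod.fst measurable_fst) (f := fun p => F (Φ p))
      (by fun_prop)
  rw [lintegral_map hF hΦm, Measure.lintegral_compProd hF, h2, lintegral_map hm1 (by fun_prop),
    Measure.lintegral_compProd (by fun_prop), lintegral_map hm2 (by fun_prop)]
  refine lintegral_congr fun ω => ?_
  rw [Kernel.comap_apply, Kernel.comap_apply, hη, Kernel.lintegral_map _ hgm _ (by fun_prop),
    Kernel.lintegral_prod _ _ _ (by fun_prop)]
  simp only [Kernel.comap_apply, Kernel.id_apply, hee ω, hΦ, rvPair]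
  rw [lintegral_dirac']
  · simp only [hee ω]
  · exact Measurable.lintegral_prod_right' (f := fun q : γ' × β =>
      F ((e (C ω), f (C ω, A ω)), g (e' q.1, q.2))) (by fun_prop)

/-- The conditional mutual information depends on the joint law only. -/
lemma cmi_congr_law {A' : Ω' → α} {B' : Ω' → β} {C' : Ω' → γ} (hA : Measurable A)
    (hB : Measurable B) (hC : Measurable C) (hA' : Measurable A') (hB' : Measurable B')
    (hC' : Measurable C') (h : μ'.map ((C' ⋈ A') ⋈ B') = μ.map ((C ⋈ A) ⋈ B)) :
    cmi μ' A' B' C' = cmi μ A B C :=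
  le_antisymm
    (cmi_le_of_map_eq hA hB hC hA' hB' hC' measurable_id measurable_id (fun _ => rfl)
      measurable_snd measurable_snd h)
    (cmi_le_of_map_eq hA' hB' hC' hA hB hC measurable_id measurable_id (fun _ => rfl)
      measurable_snd measurable_snd h.symm)

lemma cmi_map {A : Ω' → α} {B : Ω' → β} {C : Ω' → γ} {u : Ω → Ω'} (hu : Measurable u)
    (hA : Measurable A) (hB : Measurable B) (hC : Measurable C) :
    cmi (μ.map u) A B C = cmi μ (A ∘ u) (B ∘ u) (C ∘ u) := by
  refine cmi_congr_law (hA.comp hu) (hB.comp hu) (hC.comp hu) hA hB hC ?_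
  rw [Measure.map_map (by fun_prop) hu]
  rfl

/-- Data processing on one probability space. -/
lemma cmi_mono {A' : Ω → α'} {B' : Ω → β'} {C' : Ω → γ'} (hA : Measurable A)
    (hB : Measurable B) (hC : Measurable C) (e : γ → γ') (e' : γ' → γ) (f : γ × α → α')
    (g : γ × β → β') (he : Measurable e) (he' : Measurable e') (hf : Measurable f)
    (hg : Measurable g) (h1 : ∀ ω, C' ω = e (C ω)) (h2 : ∀ ω, C ω = e' (C' ω))
    (h3 : ∀ ω, A' ω = f (C ω, A ω)) (h4 : ∀ ω, B' ω = g (C ω, B ω)) :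
    cmi μ A' B' C' ≤ cmi μ A B C := by
  obtain rfl : C' = fun ω => e (C ω) := funext h1
  obtain rfl : A' = fun ω => f (C ω, A ω) := funext h3
  obtain rfl : B' = fun ω => g (C ω, B ω) := funext h4
  exact cmi_le_of_map_eq hA hB hC (by fun_prop) (by fun_prop) (by fun_prop) he he'
    (fun ω => (h2 ω).symm) hf hg rfl

/-- Re-encoding the conditioning variable. -/
lemma cmi_congr_cond {C' : Ω → γ'} (hA : Measurable A) (hB : Measurable B) (hC : Measurable C)
    (e : γ → γ') (e' : γ' → γ) (he : Measurable e) (he' : Measurable e')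
    (h1 : ∀ ω, C' ω = e (C ω)) (h2 : ∀ ω, C ω = e' (C' ω)) : cmi μ A B C' = cmi μ A B C := by
  have hC' : Measurable C' := (funext h1 : C' = fun ω => e (C ω)) ▸ (by fun_prop)
  exact le_antisymm
    (cmi_mono hA hB hC e e' Prod.snd Prod.snd he he' (by fun_prop) (by fun_prop) h1 h2
      (fun _ => rfl) (fun _ => rfl))
    (cmi_mono hA hB hC' e' e Prod.snd Prod.snd he' he (by fun_prop) (by fun_prop) h2 h1
      (fun _ => rfl) (fun _ => rfl))

/-- Chain rule: the compensation identity with base (C, A) and the kernel of B given C as reference.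
Its first term is I(A; B | C). -/
lemma cmi_prod_left {A' : Ω → α'} (hA : Measurable A) (hA' : Measurable A') (hB : Measurable B)
    (hC : Measurable C) :
    cmi μ (A ⋈ A') B C = cmi μ A B C + cmi μ A' B (C ⋈ A) := by
  have h := klDiv_compProd_comap_eq_add (μ := μ) (A := A') (C := C ⋈ A) hA' hB (by fun_prop)
    ((condDistrib B C μ).comap Prod.fst measurable_fst)
  rw [← cmi_eq_klDiv_compProd hA hB hC] at h
  rw [← h, cmi_eq_klDiv_compProd (by fun_prop) hB hC]
  have hm : Measurable (fun p : (γ × α × α') × β => (((p.1.1, p.1.2.1), p.1.2.2), p.2)) := by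
    fun_prop
  have hm' : Measurable (fun p : ((γ × α) × α') × β => ((p.1.1.1, p.1.1.2, p.1.2), p.2)) := by
    fun_prop
  rw [← klDiv_map_of_leftInverse _ _ hm hm' (fun _ => rfl),
    Measure.map_map hm (by fun_prop : Measurable ((C ⋈ A ⋈ A') ⋈ B))]
  have hu : Measurable (fun p : γ × α × α' => ((p.1, p.2.1), p.2.2)) := by fun_prop
  have h5 := compProd_comap_map_prodMap (μ.map (C ⋈ A ⋈ A')) (condDistrib B C μ)
    (Z := Prod.fst) measurable_fst hu (ζ := fun p : (γ × α) × α' => p.1.1) (by fun_prop)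
    (fun _ => rfl)
  rw [Measure.map_map hu (by fun_prop : Measurable (C ⋈ A ⋈ A'))] at h5
  congr 1

lemma cmi_prod_right {B' : Ω → β'} (hA : Measurable A) (hB : Measurable B) (hB' : Measurable B')
    (hC : Measurable C) :
    cmi μ A (B ⋈ B') C = cmi μ A B C + cmi μ A B' (C ⋈ B) := by
  rw [cmi_comm hA (by fun_prop) hC, cmi_prod_left hB hB' hA hC, cmi_comm hB hA hC,
    cmi_comm hB' hA (by fun_prop)]

/-- A part of the conditioning may be moved to the left variable. -/
lemma cmi_le_prod_left {γ₀ : Type*} [MeasurableSpace γ₀] [StandardBorelSpace γ] [Nonempty γ]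
    {C₀ : Ω → γ₀} (f : γ → γ₀) (hf : Measurable f) (hA : Measurable A) (hB : Measurable B)
    (hC : Measurable C) (h : ∀ ω, C₀ ω = f (C ω)) :
    cmi μ A B C ≤ cmi μ (C ⋈ A) B C₀ := by
  obtain rfl : C₀ = fun ω => f (C ω) := funext h
  rw [cmi_prod_left hC hA hB (by fun_prop)]
  refine le_trans ?_ le_add_self
  exact cmi_mono hA hB (by fun_prop) Prod.snd (fun c => (f c, c)) Prod.snd Prod.snd (by fun_prop)
    (by fun_prop) (by fun_prop) (by fun_prop) (fun _ => rfl) (fun _ => rfl) (fun _ => rfl)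
    (fun _ => rfl)

/-- If `A` determines `E` and `E` determines `C`, then conditioning on `E` instead of `C` does not
increase `I(A; B | ·)`. -/
lemma cmi_le_of_determines {ε : Type*} [MeasurableSpace ε] [StandardBorelSpace ε] [Nonempty ε]
    {E : Ω → ε} (f : ε → γ) (g : α → ε) (hf : Measurable f) (hg : Measurable g)
    (hA : Measurable A) (hB : Measurable B) (hC : ∀ ω, C ω = f (E ω))
    (hE : ∀ ω, E ω = g (A ω)) :
    cmi μ A B E ≤ cmi μ A B C := by
  obtain rfl : E = fun ω => g (A ω) := funext hE
  refine (cmi_le_prod_left f hf hA hB (by fun_prop) hC).trans ?_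
  obtain rfl : C = fun ω => f (g (A ω)) := funext hC
  exact cmi_mono hA hB (by fun_prop) id id (fun p => (g p.2, p.2)) Prod.snd (by fun_prop)
    (by fun_prop) (by fun_prop) (by fun_prop) (fun _ => rfl) (fun _ => rfl) (fun _ => rfl)
    (fun _ => rfl)

lemma cmi_eq_zero_of_indepFun {δ : Type*} [MeasurableSpace δ] [StandardBorelSpace δ] [Nonempty δ]
    {P : Measure Ω} [IsProbabilityMeasure P] {D : Ω → δ} (hD : Measurable D) (hB : Measurable B)
    (hC : Measurable C) (h : IndepFun (C ⋈ B) D P) : cmi P D B C = 0 := by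
  rw [cmi_comm hD hB hC]
  have : IsProbabilityMeasure (P.map D) := Measure.isProbabilityMeasure_map hD.aemeasurable
  refine cmi_eq_zero_of_map_eq hB hD hC (Kernel.const _ (P.map D)) ?_
  have h2 := (indepFun_iff_map_prod_eq_prod_map_map (by fun_prop) (by fun_prop)).1 h
  have h3 : (Kernel.const γ (P.map D)).comap Prod.fst measurable_fst =
      Kernel.const (γ × β) (P.map D) := rfl
  rw [h3, Measure.compProd_const, ← h2]
  rfl

/-- I(A; B | C) ≤ I(D, A; B | C) = I(D; B | C) + I(A; B | C, D), and the first summand vanishes by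
independence. -/
lemma cmi_le_of_indepFun {δ : Type*} [MeasurableSpace δ] [StandardBorelSpace δ] [Nonempty δ]
    {P : Measure Ω} [IsProbabilityMeasure P] {D : Ω → δ} (hA : Measurable A) (hB : Measurable B)
    (hC : Measurable C) (hD : Measurable D) (h : IndepFun (C ⋈ B) D P) :
    cmi P A B C ≤ cmi P A B (C ⋈ D) := by
  have h1 : cmi P A B C ≤ cmi P (D ⋈ A) B C :=
    cmi_mono (by fun_prop) hB hC id id (fun p => p.2.2) Prod.snd (by fun_prop)
      (by fun_prop) (by fun_prop) (by fun_prop) (fun _ => rfl) (fun _ => rfl) (fun _ => rfl)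
      (fun _ => rfl)
  rwa [cmi_prod_left hD hA hB hC, cmi_eq_zero_of_indepFun hD hB hC h, zero_add] at h1

/-- A variable drawn from a kernel that depends on `C` only is conditionally independent, given
`C`, of everything on the base space. -/
lemma cmi_compProd_comap_eq_zero {δ : Type*} [MeasurableSpace δ] (κ : Kernel δ β)
    [IsMarkovKernel κ] {Z : Ω → δ} (hZ : Measurable Z) (hA : Measurable A) (hC : Measurable C)
    {ζ : γ → δ} (hζ : Measurable ζ) (h : ∀ ω, ζ (C ω) = Z ω) :
    cmi (μ ⊗ₘ κ.comap Z hZ) (fun p => A p.1) Prod.snd (fun p => C p.1) = 0 := by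
  refine cmi_eq_zero_of_map_eq (by fun_prop) (by fun_prop) (by fun_prop) (κ.comap ζ hζ) ?_
  have h1 := compProd_comap_map_prodMap μ κ hZ (u := C ⋈ A) (by fun_prop)
    (ζ := fun p => ζ p.1) (by fun_prop) h
  have h2 : (μ ⊗ₘ κ.comap Z hZ).map (fun p => (C ⋈ A) p.1) = μ.map (C ⋈ A) := by
    have h3 : (μ ⊗ₘ κ.comap Z hZ).map Prod.fst = μ := Measure.fst_compProd μ (κ.comap Z hZ)
    conv_rhs => rw [← h3, Measure.map_map (by fun_prop) measurable_fst]
    rfl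
  have h4 : ((fun p : Ω × β => C p.1) ⋈ fun p => A p.1) = fun p => (C ⋈ A) p.1 := rfl
  rw [h4, h2]
  exact h1

end cmi


/-! ### Finiteness, mixtures and Fano's inequality -/

section KL

variable {α : Type*} [MeasurableSpace α]

/-- The density is at most c, and y log y + 1 - y ≤ y² + 1, so the integrand is bounded by c² + 1.
-/
lemma klDiv_ne_top_of_le_smul {μ ν : Measure α} [IsFiniteMeasure μ] [IsFiniteMeasure ν] {c : ℝ≥0∞}
    (hc : c ≠ ⊤) (h : μ ≤ c • ν) : klDiv μ ν ≠ ⊤ := by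
  have hac : μ ≪ ν := fun s hs => by
    have := Measure.le_iff'.1 h s
    rw [Measure.smul_apply, hs, smul_zero] at this
    exact le_antisymm this zero_le
  have hle : μ.rnDeriv ν ≤ᵐ[ν] fun _ => c := by
    refine ae_le_of_forall_setLIntegral_le_of_sigmaFinite (Measure.measurable_rnDeriv μ ν) ?_
    intro s hs _
    rw [Measure.setLIntegral_rnDeriv hac, setLIntegral_const]
    exact Measure.le_iff'.1 h s
  rw [klDiv_eq_lintegral_klFun_of_ac hac]
  refine ne_of_lt (lt_of_le_of_lt (lintegral_mono_ae
    (g := fun _ => ENNReal.ofReal (c.toReal ^ 2 + 1)) ?_) ?_)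
  · filter_upwards [hle] with x hx
    refine ENNReal.ofReal_le_ofReal ?_
    have hx' : (μ.rnDeriv ν x).toReal ≤ c.toReal := ENNReal.toReal_mono hc hx
    set y := (μ.rnDeriv ν x).toReal
    have hy : 0 ≤ y := ENNReal.toReal_nonneg
    rw [klFun_apply]
    have h1 : y * Real.log y ≤ y * y :=
      mul_le_mul_of_nonneg_left ((Real.log_le_self hy)) hy
    nlinarith
  · rw [lintegral_const]
    exact ENNReal.mul_lt_top ENNReal.ofReal_lt_top (measure_lt_top _ _)

lemma rnDeriv_restrict_restrict {μ ν : Measure α} [IsFiniteMeasure μ] [IsFiniteMeasure ν]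
    (h : μ ≪ ν) {s : Set α} (hs : MeasurableSet s) :
    (μ.restrict s).rnDeriv (ν.restrict s) =ᵐ[ν.restrict s] μ.rnDeriv ν := by
  have h1 : μ.restrict s = (ν.restrict s).withDensity (μ.rnDeriv ν) := by
    conv_lhs => rw [← Measure.withDensity_rnDeriv_eq μ ν h]
    exact restrict_withDensity hs _
  rw [h1]
  exact Measure.rnDeriv_withDensity _ (Measure.measurable_rnDeriv μ ν)

lemma lintegral_eq_sum_fiber {κ : Type*} [Fintype κ] [MeasurableSpace κ]
    [MeasurableSingletonClass κ] (μ : Measure α) {ι : α → κ} (hι : Measurable ι) (f : α → ℝ≥0∞) :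
    ∫⁻ x, f x ∂μ = ∑ q, ∫⁻ x in ι ⁻¹' {q}, f x ∂μ := by
  classical
  have h1 : (⋃ q ∈ (Finset.univ : Finset κ), ι ⁻¹' {q}) = Set.univ := by
    ext x; simp
  rw [← setLIntegral_univ, ← h1, lintegral_biUnion_finset]
  · intro q _ r _ hqr
    exact Disjoint.preimage _ (by simpa using hqr)
  · exact fun q _ => hι (measurableSet_singleton q)

/-- Densities are local, so the integral splits over the fibres. If absolute continuity fails, it
fails on one of the finitely many fibres and both sides are infinite. -/
lemma klDiv_eq_sum_fiber {κ : Type*} [Fintype κ] [MeasurableSpace κ]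
    [MeasurableSingletonClass κ] (μ ν : Measure α) [IsFiniteMeasure μ] [IsFiniteMeasure ν]
    {ι : α → κ} (hι : Measurable ι) :
    klDiv μ ν = ∑ q, klDiv (μ.restrict (ι ⁻¹' {q})) (ν.restrict (ι ⁻¹' {q})) := by
  have hm : ∀ q, MeasurableSet (ι ⁻¹' {q}) := fun q => hι (measurableSet_singleton q)
  by_cases h : μ ≪ ν
  · rw [klDiv_eq_lintegral_klFun_of_ac h, lintegral_eq_sum_fiber ν hι]
    refine Finset.sum_congr rfl fun q _ => ?_
    rw [klDiv_eq_lintegral_klFun_of_ac (h.restrict _)]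
    refine lintegral_congr_ae ?_
    filter_upwards [rnDeriv_restrict_restrict h (hm q)] with x hx
    rw [hx]
  · rw [klDiv_of_not_ac h]
    by_contra hne
    refine h fun s hs => ?_
    have hq : ∀ q, μ (s ∩ ι ⁻¹' {q}) = 0 := by
      intro q
      have h1 := fun h2 => hne (ENNReal.sum_eq_top.2 ⟨q, Finset.mem_univ q, h2⟩).symm
      have h2 := (klDiv_ne_top_iff.1 h1).1
      have h3 : (ν.restrict (ι ⁻¹' {q})) s = 0 :=
        le_antisymm ((Measure.restrict_apply_le _ _).trans hs.le) zero_le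
      rw [← Measure.restrict_apply' (hm q)]
      exact h2 h3
    have hs' : s = ⋃ q, s ∩ ι ⁻¹' {q} := by ext; simp
    rw [hs']
    exact measure_iUnion_null hq

/-- Data processing to the indicator of s: the log-sum inequality is applied on s and on its
complement. -/
lemma mul_log_add_mul_log_le_klDiv (μ ν : Measure α) [IsProbabilityMeasure μ]
    [IsProbabilityMeasure ν] {s : Set α} (hs : MeasurableSet s) :
    ENNReal.ofReal (μ.real s * Real.log (μ.real s / ν.real s) +
      (1 - μ.real s) * Real.log ((1 - μ.real s) / (1 - ν.real s))) ≤ klDiv μ ν := by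
  classical
  have hι : Measurable fun x => decide (x ∈ s) := measurable_to_bool (by
    convert hs using 1
    ext x
    simp)
  have h1 : (fun x => decide (x ∈ s)) ⁻¹' {true} = s := by ext; simp
  have h2 : (fun x => decide (x ∈ s)) ⁻¹' {false} = sᶜ := by ext; simp
  rw [klDiv_eq_sum_fiber μ ν hι, Fintype.sum_bool, h1, h2]
  have h3 := mul_log_le_klDiv (μ.restrict s) (ν.restrict s)
  have h4 := mul_log_le_klDiv (μ.restrict sᶜ) (ν.restrict sᶜ)
  simp only [measureReal_restrict_apply_univ] at h3 h4
  rw [probReal_compl_eq_one_sub hs, probReal_compl_eq_one_sub hs] at h4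
  refine le_trans ?_ (add_le_add h3 h4)
  refine le_trans (ENNReal.ofReal_le_ofReal ?_) ENNReal.ofReal_add_le
  linarith

end KL

section

variable {Ω α β γ : Type*} [MeasurableSpace Ω] [MeasurableSpace α] [MeasurableSpace β]
  [MeasurableSpace γ] [StandardBorelSpace α] [Nonempty α] [StandardBorelSpace β] [Nonempty β]
  {A : Ω → α} {B : Ω → β} {C : Ω → γ}

/-- A variable with finitely many values carries finite information. -/
lemma cmi_ne_top_of_finite [Finite α] {P : Measure Ω} [IsProbabilityMeasure P] (hA : Measurable A)
    (hB : Measurable B) (hC : Measurable C) : cmi P A B C ≠ ⊤ := by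
  classical
  have := Fintype.ofFinite α
  have hN0 : (Fintype.card α : ℝ≥0∞) ≠ 0 := by simp
  have hNt : (Fintype.card α : ℝ≥0∞) ≠ ⊤ := ENNReal.natCast_ne_top _
  -- The uniform law serves as the reference: any law on α has density at most the cardinality of α
  -- with respect to it.
  set U : Measure α := (Fintype.card α : ℝ≥0∞)⁻¹ • Measure.count with hU
  have hUp : IsProbabilityMeasure U := ⟨by
    simp [hU, Measure.smul_apply, Measure.count_univ, ENNReal.inv_mul_cancel hN0 hNt]⟩
  rw [cmi_comm hA hB hC]
  refine ne_top_of_le_ne_top ?_ (cmi_le_klDiv hB hA hC (Kernel.const γ U))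
  have h3 : (Kernel.const γ U).comap Prod.fst measurable_fst = Kernel.const (γ × β) U := rfl
  rw [h3, map_rvPair_eq_compProd (C := C ⋈ B) hA]
  refine klDiv_ne_top_of_le_smul hNt (Measure.le_iff.2 fun s hs => ?_)
  rw [Measure.smul_apply, Measure.compProd_apply hs, Measure.compProd_apply hs, smul_eq_mul,
    ← lintegral_const_mul' _ _ hNt]
  refine lintegral_mono fun x => ?_
  rw [Kernel.const_apply, hU, Measure.smul_apply, smul_eq_mul, ← mul_assoc,
    ENNReal.mul_inv_cancel hN0 hNt, one_mul]
  rcases Set.eq_empty_or_nonempty (Prod.mk x ⁻¹' s) with h | h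
  · simp [h]
  · refine prob_le_one.trans ?_
    rw [Measure.count_apply (measurable_prodMk_left hs)]
    exact_mod_cast Order.one_le_iff_ne_zero.2 (by simpa [Set.encard_eq_zero] using h.ne_empty)

end

/-! ### Mixtures whose component can be read off from a variable. -/

section Mixture

variable {Ω κ : Type*} [MeasurableSpace Ω] [Fintype κ] [MeasurableSpace κ]
  [MeasurableSingletonClass κ] {μ : Measure Ω} {p : κ → NNReal} {ν : κ → Measure Ω}

/-- The components live on disjoint fibres of Q, so restricting the mixture to a fibre isolates one
of them. -/
lemma restrict_fiber_of_eq_sum (h : μ = ∑ q, p q • ν q) {Q : Ω → κ}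
    (hQ : Measurable Q) (hν : ∀ q, ∀ᵐ ω ∂(ν q), Q ω = q) (q : κ) :
    μ.restrict (Q ⁻¹' {q}) = p q • ν q := by
  classical
  have hm : MeasurableSet (Q ⁻¹' {q}) := hQ (measurableSet_singleton q)
  have h1 : ∀ r, (ν r).restrict (Q ⁻¹' {q}) = if r = q then ν q else 0 := by
    intro r
    split_ifs with hr
    · subst hr
      exact Measure.restrict_eq_self_of_ae_mem (hν r)
    · refine Measure.restrict_eq_zero.2 ?_
      refine measure_mono_null ?_ (ae_iff.1 (hν r))
      intro ω hω
      simp only [Set.mem_preimage, Set.mem_singleton_iff] at hω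
      simp only [Set.mem_ofPred_eq, hω]
      exact fun h => hr h.symm
  rw [h]
  ext s hs
  simp only [Measure.restrict_apply hs, Measure.coe_finsetSum, Finset.sum_apply,
    Measure.smul_apply]
  have h2 : ∀ r, (ν r) (s ∩ Q ⁻¹' {q}) = (if r = q then ν q else 0) s := by
    intro r
    rw [← h1 r, Measure.restrict_apply hs]
  simp only [h2]
  rw [Finset.sum_eq_single q]
  · simp
  · intro r _ hr; simp [hr]
  · simp

lemma map_restrict_fiber_of_eq_sum (h : μ = ∑ q, p q • ν q) {Q : Ω → κ}
    (hQ : Measurable Q) (hν : ∀ q, ∀ᵐ ω ∂(ν q), Q ω = q) {δ : Type*} [MeasurableSpace δ]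
    {D : Ω → δ} (hD : Measurable D) {ι : δ → κ} (hι : Measurable ι) (hιD : ∀ ω, ι (D ω) = Q ω)
    (q : κ) : (μ.map D).restrict (ι ⁻¹' {q}) = p q • (ν q).map D := by
  rw [Measure.restrict_map hD (hι (measurableSet_singleton q))]
  have : D ⁻¹' (ι ⁻¹' {q}) = Q ⁻¹' {q} := by
    ext ω; simp [hιD]
  rw [this, restrict_fiber_of_eq_sum h hQ hν q, Measure.map_smul]

lemma compProd_restrict_fst {α β : Type*} [MeasurableSpace α] [MeasurableSpace β] (ρ : Measure α)
    [SFinite ρ] (η : Kernel α β) [IsSFiniteKernel η] {s : Set α} (hs : MeasurableSet s) :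
    (ρ ⊗ₘ η).restrict (Prod.fst ⁻¹' s) = (ρ.restrict s) ⊗ₘ η := by
  ext t ht
  rw [Measure.restrict_apply ht, Measure.compProd_apply (ht.inter (measurable_fst hs)),
    Measure.compProd_apply ht, ← lintegral_indicator hs]
  refine lintegral_congr fun x => ?_
  by_cases hx : x ∈ s
  · simp [hx, Set.preimage_inter]
    congr 1
    ext y
    simp [hx]
  · simp [hx, Set.preimage_inter]
    have : Prod.mk x ⁻¹' (Prod.fst ⁻¹' s) = (∅ : Set β) := by ext y; simp [hx]
    simp [this]

variable {α β γ : Type*} [MeasurableSpace α] [MeasurableSpace β]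
  [MeasurableSpace γ] [StandardBorelSpace α] [Nonempty α] [StandardBorelSpace β] [Nonempty β]
  {A : Ω → α} {B : Ω → β} {C : Ω → γ} [IsProbabilityMeasure μ] [∀ q, IsProbabilityMeasure (ν q)]

/-- Conditional mutual information of a mixture, when the conditioning determines the component. -/
lemma cmi_eq_sum_of_mixture (h : μ = ∑ q, p q • ν q) {r : γ → κ} (hr : Measurable r)
    (hA : Measurable A) (hB : Measurable B) (hC : Measurable C)
    (hν : ∀ q, ∀ᵐ ω ∂(ν q), r (C ω) = q) :
    cmi μ A B C = ∑ q, (p q : ℝ≥0∞) * cmi (ν q) A B C := by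
  set η := condDistrib B C μ with hη
  have hrC : Measurable fun ω => r (C ω) := by fun_prop
  have hι1 : Measurable fun x : (γ × α) × β => r x.1.1 := by fun_prop
  have hι2 : Measurable fun x : γ × β => r x.1 := by fun_prop
  have hι3 : Measurable fun x : γ × α => r x.1 := by fun_prop
  rw [cmi_eq_klDiv_compProd hA hB hC, klDiv_eq_sum_fiber _ _ hι1]
  refine Finset.sum_congr rfl fun q _ => ?_
  have e1 := map_restrict_fiber_of_eq_sum h hrC hν (D := (C ⋈ A) ⋈ B) (by fun_prop) hι1
    (fun _ => rfl) q
  have e2 : ((μ.map (C ⋈ A)) ⊗ₘ η.comap Prod.fst measurable_fst).restrict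
      ((fun x : (γ × α) × β => r x.1.1) ⁻¹' {q}) =
      p q • (((ν q).map (C ⋈ A)) ⊗ₘ η.comap Prod.fst measurable_fst) := by
    have := compProd_restrict_fst (μ.map (C ⋈ A)) (η.comap Prod.fst measurable_fst)
      (hι3 (measurableSet_singleton q))
    rw [map_restrict_fiber_of_eq_sum h hrC hν (D := C ⋈ A) (by fun_prop) hι3
      (fun _ => rfl) q] at this
    refine this.trans ?_
    exact Measure.compProd_smul_left (p q : ℝ≥0∞)
  rw [e1, e2, klDiv_smul_same, klDiv_compProd_comap_eq_add hA hB hC]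
  by_cases hp : p q = 0
  · simp [hp]
  congr 1
  -- On the fibre over q the conditional law of B under the mixture is also a conditional law under
  -- the component, so the first term of the compensation identity vanishes.
  have e3 : (p q : ℝ≥0∞) • (ν q).map (C ⋈ B) = (p q : ℝ≥0∞) • ((ν q).map C ⊗ₘ η) := by
    have f1 := map_restrict_fiber_of_eq_sum h hrC hν (D := C ⋈ B) (by fun_prop) hι2 (fun _ => rfl) q
    rw [map_rvPair_eq_compProd hB] at f1
    have f2 := compProd_restrict_fst (μ.map C) η (hr (measurableSet_singleton q))
    rw [map_restrict_fiber_of_eq_sum h hrC hν (D := C) hC hr (fun _ => rfl) q] at f2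
    rw [← Measure.compProd_smul_left]
    exact f1.symm.trans f2
  have e4 : (ν q).map (C ⋈ B) = (ν q).map C ⊗ₘ η := by
    have h0 : (p q : ℝ≥0∞) ≠ 0 := by exact_mod_cast hp
    ext s hs
    have := congrArg (fun m : Measure (γ × β) => m s) e3
    simp only [Measure.smul_apply, smul_eq_mul] at this
    exact (ENNReal.mul_right_inj h0 ENNReal.coe_ne_top).1 this
  rw [e4, klDiv_self, zero_add]

end Mixture

/-! ### Fano's inequality. -/

section Fano

variable {Ω β γ : Type*} [MeasurableSpace Ω] [MeasurableSpace β] [MeasurableSpace γ]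
  [StandardBorelSpace β] [Nonempty β] {P : Measure Ω} [IsProbabilityMeasure P]

/-- Fano's inequality for a uniformly distributed message. -/
lemma fano {M : ℕ} [NeZero M] {W : Ω → Fin M} {Y : Ω → β} (hW : Measurable W) (hY : Measurable Y)
    (hunif : ∀ w, P (W ⁻¹' {w}) = (M : ℝ≥0∞)⁻¹) {dec : β → Fin M} (hdec : Measurable dec)
    {ε : ℝ} (hε : 0 ≤ ε) (hε2 : ε ≤ 2⁻¹) (herr : P {ω | dec (Y ω) ≠ W ω} ≤ ENNReal.ofReal ε) :
    ENNReal.ofReal ((1 - ε) * Real.log M - Real.binEntropy ε) ≤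
      cmi P W Y (fun _ => ()) := by
  have hwm : Measurable fun ω => dec (Y ω) := by fun_prop
  have hmono : cmi P W (fun ω => dec (Y ω)) (fun _ => ()) ≤ cmi P W Y (fun _ => ()) :=
    cmi_mono hW hY measurable_const id id Prod.snd (fun q => dec q.2) (by fun_prop) (by fun_prop)
      (by fun_prop) (by fun_prop) (fun _ => rfl) (fun _ => rfl) (fun _ => rfl) (fun _ => rfl)
  refine le_trans ?_ hmono
  set C : Ω → Unit := fun _ => () with hC
  set V : Ω → Fin M := fun ω => dec (Y ω) with hV
  have hCm : Measurable C := measurable_const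
  rw [cmi_eq_klDiv_compProd hW hwm hCm]
  set η := condDistrib V C P
  have p1 : IsProbabilityMeasure (P.map ((C ⋈ W) ⋈ V)) :=
    Measure.isProbabilityMeasure_map (by fun_prop)
  have p2 : IsProbabilityMeasure (P.map (C ⋈ W)) := Measure.isProbabilityMeasure_map (by fun_prop)
  set s : Set ((Unit × Fin M) × Fin M) := {x | x.2 = x.1.2} with hs
  have hsm : MeasurableSet s := measurableSet_eq_fun (by fun_prop) (by fun_prop)
  -- Under the reference law the decision is independent of the message, so it hits the uniform
  -- message with probability exactly 1/M, whatever its own law.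
  have hν : ((P.map (C ⋈ W)) ⊗ₘ η.comap Prod.fst measurable_fst) s = (M : ℝ≥0∞)⁻¹ := by
    rw [Measure.compProd_apply hsm, lintegral_map (Kernel.measurable_kernel_prodMk_left hsm)
      (by fun_prop)]
    have h1 : ∫⁻ ω, ((η.comap Prod.fst measurable_fst : Kernel (Unit × Fin M) (Fin M))
        ((C ⋈ W) ω)) (Prod.mk ((C ⋈ W) ω) ⁻¹' s) ∂P = ∫⁻ ω, η () {W ω} ∂P :=
      lintegral_congr fun ω => rfl
    rw [h1]
    have h2 := lintegral_map (μ := P) (f := fun w => η () {w}) (g := W)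
      (measurable_of_finite _) hW
    rw [← h2, lintegral_fintype]
    have h3 : ∀ w, (P.map W) {w} = (M : ℝ≥0∞)⁻¹ := fun w => by
      rw [Measure.map_apply hW (measurableSet_singleton w), hunif]
    simp only [h3]
    rw [← Finset.sum_mul, sum_measure_singleton]
    simp
  have hμ : 1 - ε ≤ (P.map ((C ⋈ W) ⋈ V)).real s := by
    rw [map_measureReal_apply (by fun_prop) hsm]
    have h1 : ((C ⋈ W) ⋈ V) ⁻¹' s = {ω | dec (Y ω) ≠ W ω}ᶜ := by
      ext ω
      simp [hs, hV, rvPair]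
    have hm : MeasurableSet {ω | dec (Y ω) ≠ W ω} := (measurableSet_eq_fun hwm hW).compl
    rw [h1, probReal_compl_eq_one_sub hm]
    have : P.real {ω | dec (Y ω) ≠ W ω} ≤ ε := ENNReal.toReal_le_of_le_ofReal hε herr
    linarith
  refine le_trans (ENNReal.ofReal_le_ofReal ?_) (mul_log_add_mul_log_le_klDiv _ _ hsm)
  rw [measureReal_def (μ := (P.map (C ⋈ W)) ⊗ₘ η.comap Prod.fst measurable_fst), hν]
  set p := (P.map ((C ⋈ W) ⋈ V)).real s
  have hp1 : p ≤ 1 := measureReal_le_one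
  have hp0 : 0 ≤ p := measureReal_nonneg
  have hM : (1 : ℝ) ≤ M := by exact_mod_cast NeZero.one_le
  have hlogM : 0 ≤ Real.log M := Real.log_nonneg hM
  have hq : ((M : ℝ≥0∞)⁻¹).toReal = (M : ℝ)⁻¹ := by simp
  rw [hq]
  have t1 : p * Real.log (p / (M : ℝ)⁻¹) = p * Real.log p + p * Real.log M := by
    rcases hp0.eq_or_lt with h | h
    · simp [← h]
    · rw [div_inv_eq_mul, Real.log_mul h.ne' (by positivity)]
      ring
  have t2 : (1 - p) * Real.log (1 - p) ≤ (1 - p) * Real.log ((1 - p) / (1 - (M : ℝ)⁻¹)) := by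
    rcases hp1.eq_or_lt with h | h
    · simp [h]
    have hinv : (M : ℝ)⁻¹ ≤ 1 := inv_le_one_of_one_le₀ hM
    have hinv0 : 0 < (M : ℝ)⁻¹ := by positivity
    refine mul_le_mul_of_nonneg_left ?_ (by linarith)
    rcases hinv.eq_or_lt with h2 | h2
    -- Here M = 1 and the quotient is 0 by convention; the claim reduces to log (1 - p) ≤ 0.
    · simp [h2, Real.log_nonpos (by linarith : 0 ≤ 1 - p) (by linarith)]
    · refine Real.log_le_log (by linarith) ?_
      rw [le_div_iff₀ (by linarith)]
      nlinarith
  -- The binary entropy is increasing on [0, 1/2], and 1 - p ≤ ε ≤ 1/2.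
  have t3 : Real.binEntropy p ≤ Real.binEntropy ε := by
    rw [← Real.binEntropy_one_sub]
    exact Real.binEntropy_strictMonoOn.monotoneOn ⟨by linarith, by linarith⟩
      ⟨by linarith, by linarith⟩ (by linarith)
  rw [Real.binEntropy_eq_negMulLog_add_negMulLog_one_sub] at t3
  simp only [Real.negMulLog] at t3
  have t4 : (1 - ε) * Real.log M ≤ p * Real.log M := mul_le_mul_of_nonneg_right hμ hlogM
  linarith

end Fano


namespace ISIRC

variable {𝓧₁ 𝓧₂ 𝓧₃ 𝓢₁ 𝓢₂ 𝓢₃ 𝓨₁ 𝓨₂ 𝓨₃ : Type*} [MeasurableSpace 𝓧₁] [MeasurableSpace 𝓧₂]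
  [MeasurableSpace 𝓧₃] [MeasurableSpace 𝓢₁] [MeasurableSpace 𝓢₂] [MeasurableSpace 𝓢₃]
  [MeasurableSpace 𝓨₁] [MeasurableSpace 𝓨₂] [MeasurableSpace 𝓨₃]

/-! ### The channel in terms of independent noise components -/

section Noise

variable [Nonempty 𝓧₂] (ch : ISIRC 𝓧₁ 𝓧₂ 𝓧₃ 𝓢₁ 𝓢₂ 𝓢₃ 𝓨₁ 𝓨₂ 𝓨₃)

/-- The relay output as a function of the vector interference signal, for a fixed input of
source 2. -/
def relayOut (s : 𝓢₁ × 𝓢₃) : 𝓨₃ := ch.f₃ (Classical.arbitrary 𝓧₂) s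

lemma measurable_f₃_left (x₂ : 𝓧₂) : Measurable (ch.f₃ x₂) :=
  ch.measurable_f₃.comp (f := fun s => (x₂, s)) (by fun_prop)

@[fun_prop]
lemma measurable_relayOut : Measurable ch.relayOut := ch.measurable_f₃_left _

/-- The conditional law of `S₁` given `(X₁, X₃)`. -/
def kS : Kernel (𝓧₁ × 𝓧₃) 𝓢₁ := ch.pS₁.map Prod.fst

/-- The conditional law of `Y₃` given `(X₁, X₃)`. -/
def kT : Kernel (𝓧₁ × 𝓧₃) 𝓨₃ := ch.pS₁.map ch.relayOut

instance : IsMarkovKernel ch.kS := Kernel.IsMarkovKernel.map _ measurable_fst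

instance : IsMarkovKernel ch.kT := Kernel.IsMarkovKernel.map _ ch.measurable_relayOut

/-- The conditional law of `((S₁, Y₃), S₂)` given the inputs: the three components are
conditionally independent. -/
def noise : Kernel (𝓧₁ × 𝓧₂ × 𝓧₃) ((𝓢₁ × 𝓨₃) × 𝓢₂) :=
  ((ch.kS ×ₖ ch.kT).comap (fun x : 𝓧₁ × 𝓧₂ × 𝓧₃ => (x.1, x.2.2)) (by fun_prop)) ×ₖ
    (ch.pS₂.comap (fun x : 𝓧₁ × 𝓧₂ × 𝓧₃ => x.2.1) (by fun_prop))

instance : IsMarkovKernel ch.noise := by unfold noise; infer_instance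

/-- The outputs as a function of the inputs and `((S₁, Y₃), S₂)`. -/
def out (z : 𝓧₁ × 𝓧₂ × 𝓧₃) (o : (𝓢₁ × 𝓨₃) × 𝓢₂) : 𝓨₁ × 𝓨₂ × 𝓨₃ :=
  (ch.f₁ z.1 z.2.2 o.2, ch.f₂' z.2.1 o.1.1, o.1.2)

@[fun_prop]
lemma measurable_f₁_comp {δ : Type*} [MeasurableSpace δ] {a : δ → 𝓧₁} {b : δ → 𝓧₃} {c : δ → 𝓢₂}
    (ha : Measurable a) (hb : Measurable b) (hc : Measurable c) :
    Measurable fun d => ch.f₁ (a d) (b d) (c d) :=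
  ch.measurable_f₁.comp (ha.prodMk (hb.prodMk hc))

@[fun_prop]
lemma measurable_f₂'_comp {δ : Type*} [MeasurableSpace δ] {a : δ → 𝓧₂} {b : δ → 𝓢₁}
    (ha : Measurable a) (hb : Measurable b) : Measurable fun d => ch.f₂' (a d) (b d) :=
  ch.measurable_f₂'.comp (ha.prodMk hb)

lemma measurable_out_uncurry : Measurable fun p : (𝓧₁ × 𝓧₂ × 𝓧₃) × ((𝓢₁ × 𝓨₃) × 𝓢₂) =>
    ch.out p.1 p.2 := by
  unfold out
  fun_prop

@[fun_prop]
lemma measurable_out {δ : Type*} [MeasurableSpace δ] {a : δ → 𝓧₁ × 𝓧₂ × 𝓧₃}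
    {b : δ → (𝓢₁ × 𝓨₃) × 𝓢₂} (ha : Measurable a) (hb : Measurable b) :
    Measurable fun d => ch.out (a d) (b d) :=
  ch.measurable_out_uncurry.comp (ha.prodMk hb)

variable [StandardBorelSpace 𝓢₁] [StandardBorelSpace 𝓢₂] [StandardBorelSpace 𝓨₁]
  [StandardBorelSpace 𝓨₂]

/-- Independence of Y₂ and Y₃ passes to S₁ and Y₃ by applying the measurable inverse of the
injective map f₂'(x₂, ·) to Y₂. The law of Y₃ may then be computed with any fixed second input,
since the relay sees only source 1. -/
lemma map_fst_f₃_eq (x₂ : 𝓧₂) (x : 𝓧₁ × 𝓧₃) :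
    (ch.pS₁ x).map (fun s => (s.1, ch.f₃ x₂ s)) = (ch.kS x).prod (ch.kT x) := by
  have hne : Nonempty (𝓢₁ × 𝓢₃) := (ch.pS₁ x).nonempty_of_neZero
  have : Nonempty 𝓢₁ := hne.map Prod.fst
  have hm : Measurable (ch.f₂' x₂) := by fun_prop
  have hemb := hm.measurableEmbedding (ch.injective_f₂' x₂)
  have hind := (ch.no_noise_correlation x.1 x₂ x.2).comp hemb.measurable_invFun measurable_id
  have h1 : (hemb.invFun ∘ fun s : 𝓢₁ × 𝓢₃ => ch.f₂' x₂ s.1) = Prod.fst := by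
    ext s
    exact hemb.leftInverse_invFun s.1
  rw [h1] at hind
  have h2 := (indepFun_iff_map_prod_eq_prod_map_map (by fun_prop)
    (ch.measurable_f₃_left x₂).aemeasurable).1 hind
  rw [kS, kT, Kernel.map_apply _ measurable_fst, Kernel.map_apply _ ch.measurable_relayOut]
  refine h2.trans ?_
  congr 1
  exact ch.relay_sees_source₁ _ _ _ _

lemma map_relayOut_eq : ch.pS₁.map (fun s => (s.1, ch.relayOut s)) = ch.kS ×ₖ ch.kT := by
  ext1 x
  rw [Kernel.map_apply _ (by fun_prop), Kernel.prod_apply]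
  exact ch.map_fst_f₃_eq _ x

/-- The channel can be simulated by drawing S₁, Y₃ and S₂ independently given the inputs. In this
form Y₃ is itself a noise letter and no longer involves x₂. -/
lemma channel_apply (z : 𝓧₁ × 𝓧₂ × 𝓧₃) : ch.channel z = (ch.noise z).map (ch.out z) := by
  have h3 := ch.measurable_f₃_left z.2.1
  rw [channel, Kernel.map_apply _ ch.measurable_output, Kernel.prod_apply, Kernel.id_apply,
    noise, Kernel.prod_apply, Kernel.comap_apply, Kernel.comap_apply, Kernel.prod_apply,
    ← ch.map_fst_f₃_eq z.2.1, Measure.dirac_prod,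
    Measure.map_map ch.measurable_output (by fun_prop),
    signal, Kernel.prod_apply, Kernel.comap_apply, Kernel.comap_apply]
  have h4 := Measure.map_prod_map (ch.pS₁ (z.1, z.2.2)) (ch.pS₂ z.2.1)
    (f := fun s : 𝓢₁ × 𝓢₃ => (s.1, ch.f₃ z.2.1 s)) (g := id) (by fun_prop) measurable_id
  rw [Measure.map_id] at h4
  rw [h4, Measure.map_map (by fun_prop) (by fun_prop)]
  rfl

end Noise

/-! ### The single-letter quantities -/

section Terms

variable [StandardBorelSpace 𝓧₁] [StandardBorelSpace 𝓧₂] [StandardBorelSpace 𝓧₃]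
  [StandardBorelSpace 𝓨₁] [StandardBorelSpace 𝓨₂] [StandardBorelSpace 𝓨₃]
  [Nonempty 𝓧₁] [Nonempty 𝓧₂] [Nonempty 𝓧₃] [Nonempty 𝓨₁] [Nonempty 𝓨₂] [Nonempty 𝓨₃]

/-- Values of `Q`, of the inputs, of the copies `((V₁, V₃), V₂)` and of the outputs. -/
abbrev View (κ 𝓧₁ 𝓧₂ 𝓧₃ 𝓢₁ 𝓢₂ 𝓢₃ 𝓨₁ 𝓨₂ 𝓨₃ : Type*) : Type _ :=
  κ × (𝓧₁ × 𝓧₂ × 𝓧₃) × ((𝓢₁ × 𝓢₃) × 𝓢₂) × (𝓨₁ × 𝓨₂ × 𝓨₃)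

variable {κ : Type*} [MeasurableSpace κ]

/-- The sixteen mutual informations (in nats) from which the bounds are made. -/
def terms (θ : Measure (View κ 𝓧₁ 𝓧₂ 𝓧₃ 𝓢₁ 𝓢₂ 𝓢₃ 𝓨₁ 𝓨₂ 𝓨₃)) [IsFiniteMeasure θ] :
    Fin 16 → ℝ≥0∞ :=
  let Ω := View κ 𝓧₁ 𝓧₂ 𝓧₃ 𝓢₁ 𝓢₂ 𝓢₃ 𝓨₁ 𝓨₂ 𝓨₃
  let Q : Ω → κ := fun ω => ω.1
  let X₁ : Ω → 𝓧₁ := fun ω => ω.2.1.1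
  let X₂ : Ω → 𝓧₂ := fun ω => ω.2.1.2.1
  let X₃ : Ω → 𝓧₃ := fun ω => ω.2.1.2.2
  let V₁ : Ω → 𝓢₁ := fun ω => ω.2.2.1.1.1
  let V₁vec : Ω → 𝓢₁ × 𝓢₃ := fun ω => ω.2.2.1.1
  let V₂ : Ω → 𝓢₂ := fun ω => ω.2.2.1.2
  let Y₁ : Ω → 𝓨₁ := fun ω => ω.2.2.2.1
  let Y₂ : Ω → 𝓨₂ := fun ω => ω.2.2.2.2.1
  let Y₃ : Ω → 𝓨₃ := fun ω => ω.2.2.2.2.2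
  ![cmi θ X₁ (Y₁ ⋈ Y₃) (X₂ ⋈ X₃ ⋈ Q),
    cmi θ (X₁ ⋈ X₃) Y₁ (X₂ ⋈ Q),
    cmi θ (X₁ ⋈ X₃) Y₁ (V₁ ⋈ X₂ ⋈ Q),
    cmi θ (X₁ ⋈ X₂ ⋈ X₃) Y₁ (V₁ ⋈ Q),
    cmi θ (X₁ ⋈ X₂ ⋈ X₃) Y₁ Q,
    cmi θ X₁ (Y₁ ⋈ Y₃) (V₁ ⋈ X₂ ⋈ X₃ ⋈ Q),
    cmi θ (X₁ ⋈ X₂) (Y₁ ⋈ Y₃) (V₁ ⋈ X₃ ⋈ Q),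
    cmi θ (X₁ ⋈ X₂) (Y₁ ⋈ Y₃) (X₃ ⋈ Q),
    cmi θ X₁ (Y₁ ⋈ Y₃) (V₁vec ⋈ X₂ ⋈ X₃ ⋈ Q),
    cmi θ (X₁ ⋈ X₂) (Y₁ ⋈ Y₃) (V₁vec ⋈ X₃ ⋈ Q),
    cmi θ X₂ Y₂ (X₁ ⋈ X₃ ⋈ Q),
    cmi θ (X₁ ⋈ X₂ ⋈ X₃) Y₂ Q,
    cmi θ (X₁ ⋈ X₂ ⋈ X₃) Y₂ (V₂ ⋈ Q),
    cmi θ X₂ Y₂ (X₁ ⋈ V₂ ⋈ X₃ ⋈ Q),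
    cmi θ (X₁ ⋈ X₂) (Y₂ ⋈ Y₃) (X₃ ⋈ Q),
    cmi θ (X₁ ⋈ X₂) (Y₂ ⋈ Y₃) (V₂ ⋈ X₃ ⋈ Q)]

/-- The twenty bounds, in terms of the sixteen quantities. -/
def Bounds (R : ℝ × ℝ) (t : Fin 16 → ℝ≥0∞) : Prop :=
  ENNReal.ofReal R.1 ≤ t 0 ∧ ENNReal.ofReal R.1 ≤ t 1 ∧ ENNReal.ofReal R.2 ≤ t 10 ∧
  ENNReal.ofReal (R.1 + R.2) ≤ t 2 + t 11 ∧
  ENNReal.ofReal (R.1 + R.2) ≤ t 3 + t 12 ∧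
  ENNReal.ofReal (R.1 + R.2) ≤ t 4 + t 13 ∧
  ENNReal.ofReal (R.1 + R.2) ≤ t 5 + t 11 ∧
  ENNReal.ofReal (R.1 + R.2) ≤ t 6 + t 12 ∧
  ENNReal.ofReal (R.1 + R.2) ≤ t 7 + t 13 ∧
  ENNReal.ofReal (R.1 + R.2) ≤ t 8 + t 14 ∧
  ENNReal.ofReal (R.1 + R.2) ≤ t 9 + t 15 ∧
  ENNReal.ofReal (2 * R.1 + R.2) ≤ t 2 + t 4 + t 12 ∧
  ENNReal.ofReal (2 * R.1 + R.2) ≤ t 2 + t 7 + t 12 ∧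
  ENNReal.ofReal (2 * R.1 + R.2) ≤ t 5 + t 4 + t 12 ∧
  ENNReal.ofReal (2 * R.1 + R.2) ≤ t 5 + t 7 + t 12 ∧
  ENNReal.ofReal (2 * R.1 + R.2) ≤ t 8 + t 4 + t 15 ∧
  ENNReal.ofReal (2 * R.1 + R.2) ≤ t 8 + t 7 + t 15 ∧
  ENNReal.ofReal (R.1 + 2 * R.2) ≤ t 3 + t 13 + t 11 ∧
  ENNReal.ofReal (R.1 + 2 * R.2) ≤ t 6 + t 13 + t 11 ∧
  ENNReal.ofReal (R.1 + 2 * R.2) ≤ t 9 + t 13 + t 14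

variable (ch : ISIRC 𝓧₁ 𝓧₂ 𝓧₃ 𝓢₁ 𝓢₂ 𝓢₃ 𝓨₁ 𝓨₂ 𝓨₃)

/-- The values seen at a sample point. -/
def toView {m : ℕ} (ω : Sample 𝓧₁ 𝓧₂ 𝓧₃ 𝓢₁ 𝓢₂ 𝓢₃ m) :
    View (Fin m) 𝓧₁ 𝓧₂ 𝓧₃ 𝓢₁ 𝓢₂ 𝓢₃ 𝓨₁ 𝓨₂ 𝓨₃ :=
  (ω.1.1, (ω.1.2.1.1, ω.1.2.2, ω.1.2.1.2), ω.2.2,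
    ch.output ((ω.1.2.1.1, ω.1.2.2, ω.1.2.1.2), ω.2.1))

lemma measurable_toView {m : ℕ} : Measurable (ch.toView (m := m)) := by
  have h : Measurable fun ω : Sample 𝓧₁ 𝓧₂ 𝓧₃ 𝓢₁ 𝓢₂ 𝓢₃ m =>
      ch.output ((ω.1.2.1.1, ω.1.2.2, ω.1.2.1.2), ω.2.1) := ch.measurable_output.comp (by fun_prop)
  unfold toView
  fun_prop

/-- All twenty bounds depend only on the law of the view, so the code and the single-letter law can
be compared through image measures. -/
lemma mem_outerRegion_iff (P : InputLaw 𝓧₁ 𝓧₂ 𝓧₃) (R : ℝ × ℝ) :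
    R ∈ ch.outerRegion P ↔ 0 ≤ R.1 ∧ 0 ≤ R.2 ∧
      Bounds R fun k =>
        terms ((ch.jointLaw P).map ch.toView) k / ENNReal.ofReal (Real.log 2) := by
  have hm := ch.measurable_toView (m := P.m)
  simp only [outerRegion, condMI_eq_cmi_div, Bounds, terms, Matrix.cons_val]
  repeat rw [cmi_map hm (by fun_prop) (by fun_prop) (by fun_prop)]
  rfl

end Terms

end ISIRC


namespace ISIRC

variable {𝓧₁ 𝓧₂ 𝓧₃ 𝓢₁ 𝓢₂ 𝓢₃ 𝓨₁ 𝓨₂ 𝓨₃ : Type*} [MeasurableSpace 𝓧₁] [MeasurableSpace 𝓧₂]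
  [MeasurableSpace 𝓧₃] [MeasurableSpace 𝓢₁] [MeasurableSpace 𝓢₂] [MeasurableSpace 𝓢₃]
  [MeasurableSpace 𝓨₁] [MeasurableSpace 𝓨₂] [MeasurableSpace 𝓨₃]
  [StandardBorelSpace 𝓧₁] [StandardBorelSpace 𝓧₂] [StandardBorelSpace 𝓧₃]
  [StandardBorelSpace 𝓨₁] [StandardBorelSpace 𝓨₂] [StandardBorelSpace 𝓨₃]
  [Nonempty 𝓧₁] [Nonempty 𝓧₂] [Nonempty 𝓧₃] [Nonempty 𝓨₁] [Nonempty 𝓨₂] [Nonempty 𝓨₃]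
  (ch : ISIRC 𝓧₁ 𝓧₂ 𝓧₃ 𝓢₁ 𝓢₂ 𝓢₃ 𝓨₁ 𝓨₂ 𝓨₃)

/-! ### Time sharing -/

/-- The law of the inputs `(X₁, X₂, X₃)` when `(X₁, X₃)` and `X₂` are independent. -/
def inputsLaw (ξ₁₃ : Measure (𝓧₁ × 𝓧₃)) (ξ₂ : Measure 𝓧₂) : Measure (𝓧₁ × 𝓧₂ × 𝓧₃) :=
  (ξ₁₃.prod ξ₂).map fun p => (p.1.1, p.2, p.1.2)

instance (ξ₁₃ : Measure (𝓧₁ × 𝓧₃)) (ξ₂ : Measure 𝓧₂) [IsProbabilityMeasure ξ₁₃]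
    [IsProbabilityMeasure ξ₂] : IsProbabilityMeasure (inputsLaw ξ₁₃ ξ₂) :=
  Measure.isProbabilityMeasure_map (by fun_prop)

variable {κ : Type*} [MeasurableSpace κ]

/-- The law of the view when the value of `Q` is `q` and the inputs have the law `ζ`. -/
def viewLaw (q : κ) (ζ : Measure (𝓧₁ × 𝓧₂ × 𝓧₃)) :
    Measure (View κ 𝓧₁ 𝓧₂ 𝓧₃ 𝓢₁ 𝓢₂ 𝓢₃ 𝓨₁ 𝓨₂ 𝓨₃) :=
  (ζ ⊗ₘ (ch.signal ×ₖ ch.channel)).map fun p => (q, p)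

instance (q : κ) (ζ : Measure (𝓧₁ × 𝓧₂ × 𝓧₃)) [IsProbabilityMeasure ζ] :
    IsProbabilityMeasure (ch.viewLaw q ζ) :=
  Measure.isProbabilityMeasure_map (by fun_prop)

lemma viewLaw_eq_map_unit (q : κ) (ζ : Measure (𝓧₁ × 𝓧₂ × 𝓧₃)) :
    ch.viewLaw q ζ = (ch.viewLaw () ζ).map fun p => (q, p.2) := by
  rw [viewLaw, viewLaw, Measure.map_map (by fun_prop) (by fun_prop)]
  rfl

lemma ae_viewLaw_fst [MeasurableSingletonClass κ] (q : κ) (ζ : Measure (𝓧₁ × 𝓧₂ × 𝓧₃)) :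
    ∀ᵐ ω ∂(ch.viewLaw q ζ), ω.1 = q := by
  rw [viewLaw, ae_map_iff (by fun_prop)]
  · simp
  · exact measurable_fst (measurableSet_singleton q)

lemma terms_viewLaw (q : κ) (ζ : Measure (𝓧₁ × 𝓧₂ × 𝓧₃)) [IsProbabilityMeasure ζ] (k : Fin 16) :
    terms (ch.viewLaw q ζ) k = terms (ch.viewLaw () ζ) k := by
  have hu : Measurable fun p : View Unit 𝓧₁ 𝓧₂ 𝓧₃ 𝓢₁ 𝓢₂ 𝓢₃ 𝓨₁ 𝓨₂ 𝓨₃ => (q, p.2) := by fun_prop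
  simp only [ch.viewLaw_eq_map_unit q ζ]
  fin_cases k
  all_goals
    refine (cmi_map hu (by fun_prop) (by fun_prop) (by fun_prop)).trans ?_
    -- The four alternatives correspond to the depth at which Q stands in the tuple of conditioning
    -- variables.
    first
    | exact cmi_congr_cond (by fun_prop) (by fun_prop) (by fun_prop) (fun c => q)
        (fun c => ()) (by fun_prop) (by fun_prop) (fun _ => rfl) (fun _ => rfl)
    | exact cmi_congr_cond (by fun_prop) (by fun_prop) (by fun_prop) (fun c => (c.1, q))
        (fun c => (c.1, ())) (by fun_prop) (by fun_prop) (fun _ => rfl) (fun _ => rfl)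
    | exact cmi_congr_cond (by fun_prop) (by fun_prop) (by fun_prop) (fun c => (c.1, c.2.1, q))
        (fun c => (c.1, c.2.1, ())) (by fun_prop) (by fun_prop) (fun _ => rfl) (fun _ => rfl)
    | exact cmi_congr_cond (by fun_prop) (by fun_prop) (by fun_prop)
        (fun c => (c.1, c.2.1, c.2.2.1, q)) (fun c => (c.1, c.2.1, c.2.2.1, ())) (by fun_prop)
        (by fun_prop) (fun _ => rfl) (fun _ => rfl)

/-- Every one of the sixteen informations is conditioned on Q, so it is the average of its values
given Q = q. -/
lemma terms_eq_sum {m : ℕ} {p : Fin m → NNReal}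
    {θ : Measure (View (Fin m) 𝓧₁ 𝓧₂ 𝓧₃ 𝓢₁ 𝓢₂ 𝓢₃ 𝓨₁ 𝓨₂ 𝓨₃)} [IsProbabilityMeasure θ]
    {ζ : Fin m → Measure (𝓧₁ × 𝓧₂ × 𝓧₃)} [∀ q, IsProbabilityMeasure (ζ q)]
    (h : θ = ∑ q, p q • ch.viewLaw q (ζ q)) (k : Fin 16) :
    terms θ k = ∑ q, (p q : ℝ≥0∞) * terms (ch.viewLaw () (ζ q)) k := by
  have hae := fun q => ch.ae_viewLaw_fst q (ζ q)
  simp_rw [← fun q => ch.terms_viewLaw q (ζ q)]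
  fin_cases k
  all_goals
    first
    | exact cmi_eq_sum_of_mixture h (r := fun c => c) (by fun_prop) (by fun_prop)
        (by fun_prop) (by fun_prop) hae
    | exact cmi_eq_sum_of_mixture h (r := fun c => c.2) (by fun_prop) (by fun_prop)
        (by fun_prop) (by fun_prop) hae
    | exact cmi_eq_sum_of_mixture h (r := fun c => c.2.2) (by fun_prop) (by fun_prop)
        (by fun_prop) (by fun_prop) hae
    | exact cmi_eq_sum_of_mixture h (r := fun c => c.2.2.2) (by fun_prop) (by fun_prop)
        (by fun_prop) (by fun_prop) hae

lemma map_toView_jointLaw (P : InputLaw 𝓧₁ 𝓧₂ 𝓧₃) :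
    (ch.jointLaw P).map ch.toView =
      ∑ q, (P.pQ {q}).toNNReal • ch.viewLaw q (inputsLaw (P.pX₁₃ q) (P.pX₂ q)) := by
  refine Measure.ext_of_lintegral _ fun F hF => ?_
  have hv := ch.measurable_toView (m := P.m)
  have ho := ch.measurable_output
  rw [lintegral_map hF hv, jointLaw, Measure.lintegral_compProd (by fun_prop),
    Measure.lintegral_compProd (by
      exact Measurable.lintegral_kernel_prod_right' (f := fun p => F (ch.toView p)) (by fun_prop)),
    lintegral_fintype, lintegral_finsetSum_measure]
  refine Finset.sum_congr rfl fun q _ => ?_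
  have hp : ((P.pQ {q}).toNNReal : ℝ≥0∞) = P.pQ {q} :=
    ENNReal.coe_toNNReal (measure_ne_top _ _)
  have hs : ∀ θ : Measure (View (Fin P.m) 𝓧₁ 𝓧₂ 𝓧₃ 𝓢₁ 𝓢₂ 𝓢₃ 𝓨₁ 𝓨₂ 𝓨₃),
      (P.pQ {q}).toNNReal • θ = P.pQ {q} • θ := by
    intro θ
    rw [← hp]
    rfl
  rw [hs, lintegral_smul_measure, smul_eq_mul, mul_comm]
  congr 1
  rw [viewLaw, lintegral_map hF (by fun_prop), Measure.lintegral_compProd (by fun_prop), inputsLaw,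
    lintegral_map (by
      exact Measurable.lintegral_kernel_prod_right'
        (f := fun p : (𝓧₁ × 𝓧₂ × 𝓧₃) × (((𝓢₁ × 𝓢₃) × 𝓢₂) × 𝓨₁ × 𝓨₂ × 𝓨₃) => F (q, p))
        (by fun_prop)) (by fun_prop), Kernel.prod_apply]
  refine lintegral_congr fun x => ?_
  -- The joint law lists the signals before their copies, the view lists the copies before the
  -- outputs; the order of integration is exchanged here.
  rw [Kernel.comap_apply, Kernel.prod_apply, Kernel.prod_apply, lintegral_prod_symm _ (by fun_prop),
    lintegral_prod _ (by fun_prop)]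
  refine lintegral_congr fun v => ?_
  rw [channel, Kernel.lintegral_map _ ho _ (by fun_prop), Kernel.prod_apply, Kernel.id_apply,
    Measure.dirac_prod, lintegral_map (by fun_prop) (by fun_prop)]
  rfl

end ISIRC


/-! ### Sequences drawn letter by letter -/

section SeqLaw

variable {𝓜 𝓛 : Type*} [MeasurableSpace 𝓜] [MeasurableSpace 𝓛]

/-- Appending a letter to a sequence. -/
def snocHist {n : ℕ} (p : (𝓜 × (Fin n → 𝓛)) × 𝓛) : 𝓜 × (Fin (n + 1) → 𝓛) :=
  (p.1.1, Fin.snoc p.1.2 p.2)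

lemma measurable_snoc {δ : Type*} [MeasurableSpace δ] {n : ℕ} {h : δ → Fin n → 𝓛} {l : δ → 𝓛}
    (hh : Measurable h) (hl : Measurable l) :
    Measurable fun d => (Fin.snoc (h d) (l d) : Fin (n + 1) → 𝓛) := by
  refine measurable_pi_iff.2 fun j => ?_
  refine Fin.lastCases ?_ (fun i => ?_) j
  · simpa using hl
  · simpa using (measurable_pi_iff.1 hh i)

@[fun_prop]
lemma measurable_snocHist {n : ℕ} :
    Measurable (snocHist : (𝓜 × (Fin n → 𝓛)) × 𝓛 → 𝓜 × (Fin (n + 1) → 𝓛)) :=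
  (by fun_prop : Measurable fun p : (𝓜 × (Fin n → 𝓛)) × 𝓛 => p.1.1).prodMk
    (measurable_snoc (by fun_prop) (by fun_prop))

/-- The law of a message and of `n` letters, each drawn given the message and the letters before. -/
def seqLaw (π : Measure 𝓜) (k : ∀ n, Kernel (𝓜 × (Fin n → 𝓛)) 𝓛) :
    (n : ℕ) → Measure (𝓜 × (Fin n → 𝓛))
  | 0 => π.map fun m => (m, Fin.elim0)
  | n + 1 => (seqLaw π k n ⊗ₘ k n).map snocHist

variable {π : Measure 𝓜} {k : ∀ n, Kernel (𝓜 × (Fin n → 𝓛)) 𝓛}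

instance [IsProbabilityMeasure π] [∀ n, IsMarkovKernel (k n)] (n : ℕ) :
    IsProbabilityMeasure (seqLaw π k n) := by
  induction n with
  | zero => exact Measure.isProbabilityMeasure_map (by fun_prop)
  | succ n ih => exact Measure.isProbabilityMeasure_map (by fun_prop)

variable {𝓜' 𝓛' : Type*} [MeasurableSpace 𝓜'] [MeasurableSpace 𝓛']

/-- If the law of the image of a letter depends on the past only through the images, the sequence of
images is again drawn letter by letter. -/
lemma seqLaw_map [IsProbabilityMeasure π] [∀ n, IsMarkovKernel (k n)]
    {k' : ∀ n, Kernel (𝓜' × (Fin n → 𝓛')) 𝓛'} [∀ n, IsMarkovKernel (k' n)]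
    {φ : 𝓜 → 𝓜'} {ψ : 𝓛 → 𝓛'} (hφ : Measurable φ) (hψ : Measurable ψ)
    (h : ∀ n p, (k n p).map ψ = k' n (φ p.1, fun j => ψ (p.2 j))) (n : ℕ) :
    (seqLaw π k n).map (fun p => (φ p.1, fun j => ψ (p.2 j))) = seqLaw (π.map φ) k' n := by
  have : IsProbabilityMeasure (π.map φ) := Measure.isProbabilityMeasure_map hφ.aemeasurable
  induction n with
  | zero =>
    rw [seqLaw, seqLaw, Measure.map_map (by fun_prop) (by fun_prop),
      Measure.map_map (by fun_prop) hφ]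
    congr 1
    ext m j
    · rfl
    · exact j.elim0
  | succ n ih =>
    rw [seqLaw, seqLaw, ← ih, Measure.map_map (by fun_prop) (by fun_prop)]
    refine Measure.ext_of_lintegral _ fun F hF => ?_
    have hu : Measurable fun p : 𝓜 × (Fin (n + 1) → 𝓛) => (φ p.1, fun j => ψ (p.2 j)) := by
      fun_prop
    have hus := hu.comp (measurable_snocHist (𝓜 := 𝓜) (𝓛 := 𝓛) (n := n))
    rw [lintegral_map hF hus, lintegral_map hF (by fun_prop),
      Measure.lintegral_compProd (by exact hF.comp hus), Measure.lintegral_compProd (by fun_prop),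
      lintegral_map (by
        exact Measurable.lintegral_kernel_prod_right' (f := fun p => F (snocHist p)) (by fun_prop))
        (by fun_prop)]
    refine lintegral_congr fun p => ?_
    rw [← h, lintegral_map (by fun_prop) hψ]
    refine lintegral_congr fun l => ?_
    congr 1
    simp only [Function.comp_apply, snocHist, Prod.mk.injEq, true_and]
    funext j
    refine Fin.lastCases ?_ (fun i => ?_) j <;> simp

variable {𝓜₁ 𝓜₂ 𝓛₁ 𝓛₂ : Type*} [MeasurableSpace 𝓜₁] [MeasurableSpace 𝓜₂] [MeasurableSpace 𝓛₁]
  [MeasurableSpace 𝓛₂] {π₁ : Measure 𝓜₁} {π₂ : Measure 𝓜₂} [IsProbabilityMeasure π₁]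
  [IsProbabilityMeasure π₂]

/-- Two streams whose next letters are drawn independently, each from its own past, stay
independent. -/
lemma seqLaw_prod {k : ∀ n, Kernel ((𝓜₁ × 𝓜₂) × (Fin n → 𝓛₁ × 𝓛₂)) (𝓛₁ × 𝓛₂)}
    {k₁ : ∀ n, Kernel (𝓜₁ × (Fin n → 𝓛₁)) 𝓛₁} {k₂ : ∀ n, Kernel (𝓜₂ × (Fin n → 𝓛₂)) 𝓛₂}
    [∀ n, IsMarkovKernel (k n)] [∀ n, IsMarkovKernel (k₁ n)] [∀ n, IsMarkovKernel (k₂ n)]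
    (h : ∀ n p, k n p = (k₁ n (p.1.1, fun j => (p.2 j).1)).prod (k₂ n (p.1.2, fun j => (p.2 j).2)))
    (n : ℕ) :
    (seqLaw (π₁.prod π₂) k n).map
        (fun p => ((p.1.1, fun j => (p.2 j).1), (p.1.2, fun j => (p.2 j).2))) =
      (seqLaw π₁ k₁ n).prod (seqLaw π₂ k₂ n) := by
  induction n with
  | zero =>
    rw [seqLaw, seqLaw, seqLaw, Measure.map_map (by fun_prop) (by fun_prop),
      Measure.map_prod_map _ _ (by fun_prop) (by fun_prop)]
    congr 1
    ext m j
    · rfl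
    · exact j.elim0
    · rfl
    · exact j.elim0
  | succ n ih =>
    rw [seqLaw, seqLaw, seqLaw, Measure.map_map (by fun_prop) (by fun_prop),
      Measure.map_prod_map _ _ (by fun_prop) (by fun_prop)]
    refine Measure.ext_of_lintegral _ fun F hF => ?_
    have hF1 : Measurable fun p : ((𝓜₁ × (Fin n → 𝓛₁)) × 𝓛₁) × ((𝓜₂ × (Fin n → 𝓛₂)) × 𝓛₂) =>
        F (Prod.map snocHist snocHist p) := by fun_prop
    have hF2 : Measurable fun p : (𝓜₁ × (Fin n → 𝓛₁)) × (𝓜₂ × (Fin n → 𝓛₂)) =>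
        ∫⁻ l, F (snocHist (p.1, l.1), snocHist (p.2, l.2))
          ∂(((k₁ n).comap Prod.fst measurable_fst ×ₖ (k₂ n).comap Prod.snd measurable_snd) p) :=
      Measurable.lintegral_kernel_prod_right' (f := fun q : (((𝓜₁ × (Fin n → 𝓛₁)) ×
        (𝓜₂ × (Fin n → 𝓛₂))) × (𝓛₁ × 𝓛₂)) => F (snocHist (q.1.1, q.2.1), snocHist (q.1.2, q.2.2)))
        (by fun_prop)
    have hu : Measurable fun p : (𝓜₁ × 𝓜₂) × (Fin (n + 1) → 𝓛₁ × 𝓛₂) =>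
      ((p.1.1, fun j => (p.2 j).1), (p.1.2, fun j => (p.2 j).2)) := by fun_prop
    have hus := hu.comp (measurable_snocHist (𝓜 := 𝓜₁ × 𝓜₂) (𝓛 := 𝓛₁ × 𝓛₂) (n := n))
    calc _ = ∫⁻ p, ∫⁻ l, F (snocHist ((p.1.1, fun j => (p.2 j).1), l.1),
          snocHist ((p.1.2, fun j => (p.2 j).2), l.2)) ∂(k n p) ∂(seqLaw (π₁.prod π₂) k n) := by
          rw [lintegral_map hF hus, Measure.lintegral_compProd (by exact hF.comp hus)]
          refine lintegral_congr fun p => lintegral_congr fun l => ?_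
          congr 1
          simp only [Function.comp_apply, snocHist, Prod.mk.injEq, true_and]
          constructor <;> funext j <;> refine Fin.lastCases ?_ (fun i => ?_) j <;> simp
      _ = ∫⁻ p, ∫⁻ l, F (snocHist (p.1, l.1), snocHist (p.2, l.2))
          ∂(((k₁ n).comap Prod.fst measurable_fst ×ₖ (k₂ n).comap Prod.snd measurable_snd) p)
          ∂((seqLaw π₁ k₁ n).prod (seqLaw π₂ k₂ n)) := by
          rw [← ih, lintegral_map hF2 (by fun_prop)]
          refine lintegral_congr fun p => ?_
          rw [h, Kernel.prod_apply, Kernel.comap_apply, Kernel.comap_apply]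
      _ = _ := by
          rw [lintegral_map hF (by fun_prop), lintegral_prod _ hF2.aemeasurable,
            lintegral_prod _ (by fun_prop),
            Measure.lintegral_compProd (by fun_prop)]
          refine lintegral_congr fun a => ?_
          simp_rw [Kernel.prod_apply, Kernel.comap_apply]
          have e1 : ∀ b, ∫⁻ l, F (snocHist (a, l.1), snocHist (b, l.2)) ∂((k₁ n a).prod (k₂ n b)) =
              ∫⁻ l₁, ∫⁻ l₂, F (snocHist (a, l₁), snocHist (b, l₂)) ∂(k₂ n b) ∂(k₁ n a) :=
            fun b => lintegral_prod _ (by fun_prop)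
          simp_rw [e1]
          -- The new letter of the first stream does not depend on the past of the second, so these
          -- two integrals commute.
          rw [lintegral_lintegral_swap]
          · refine lintegral_congr fun l₁ => ?_
            rw [Measure.lintegral_compProd (by fun_prop)]
            rfl
          · have := Measurable.lintegral_kernel_prod_right'
              (κ := (k₂ n).comap (Prod.fst : (𝓜₂ × (Fin n → 𝓛₂)) × 𝓛₁ → _) measurable_fst)
              (f := fun q : ((𝓜₂ × (Fin n → 𝓛₂)) × 𝓛₁) × 𝓛₂ =>
                F (snocHist (a, q.1.2), snocHist (q.1.1, q.2))) (by fun_prop)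
            exact this.aemeasurable

end SeqLaw


/-! ### One letter drawn from a kernel -/

section OneLetter

variable {Ξ α β β' γ γ₀ δ ζ : Type*} [MeasurableSpace Ξ] [MeasurableSpace α] [MeasurableSpace β]
  [MeasurableSpace β'] [MeasurableSpace γ] [MeasurableSpace γ₀] [MeasurableSpace δ]
  [MeasurableSpace ζ] [StandardBorelSpace Ξ] [Nonempty Ξ] [StandardBorelSpace α] [Nonempty α]
  [StandardBorelSpace β] [Nonempty β] [StandardBorelSpace β'] [Nonempty β']
  [StandardBorelSpace γ] [Nonempty γ] [StandardBorelSpace ζ] [Nonempty ζ]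
  {μ : Measure Ξ} [IsProbabilityMeasure μ] {κ : Kernel δ β'} [IsMarkovKernel κ] {Z : Ξ → δ}
  {hZ : Measurable Z} {A : Ξ → α} {C : Ξ → γ} {C₀ : Ξ → γ₀} {Z' : Ξ → ζ} {g : δ × β' → β}

/-- The information about an output splits into what `A` says and what the past says given `A`. -/
lemma cmi_add_cmi_le (hA : Measurable A) (hC : Measurable C) (hC₀ : Measurable C₀)
    (hZ' : Measurable Z') (hg : Measurable g) {f : γ → γ₀} (hf : Measurable f)
    (hfC : ∀ x, C₀ x = f (C x)) {h : γ₀ × ζ → δ} (hh : Measurable h)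
    (hhZ : ∀ x, h (C₀ x, Z' x) = Z x) :
    cmi (μ ⊗ₘ κ.comap Z hZ) (fun p => A p.1) (fun p => g (Z p.1, p.2)) (fun p => C p.1) +
        cmi (μ ⊗ₘ κ.comap Z hZ) Prod.fst (fun p => g (Z p.1, p.2)) (fun p => (C p.1, A p.1)) ≤
      cmi (μ ⊗ₘ κ.comap Z hZ) (fun p => Z' p.1) (fun p => g (Z p.1, p.2)) (fun p => C₀ p.1) := by
  set P := μ ⊗ₘ κ.comap Z hZ
  set Y : Ξ × β' → β := fun p => g (Z p.1, p.2)
  have hY : Measurable Y := by fun_prop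
  have h1 := cmi_prod_left (μ := P) (A := fun p => A p.1) (A' := Prod.fst) (B := Y)
    (C := fun p => C p.1) (by fun_prop) (by fun_prop) hY (by fun_prop)
  have h2 : cmi P (fun p => A p.1) Y (fun p => C p.1) +
      cmi P Prod.fst Y (fun p => (C p.1, A p.1)) =
      cmi P ((fun p => A p.1) ⋈ Prod.fst) Y (fun p => C p.1) := h1.symm
  rw [h2]
  refine (cmi_le_prod_left (C₀ := fun p => C₀ p.1) f hf (by fun_prop) hY (by fun_prop)
    (fun p => hfC p.1)).trans ?_
  have h3 : cmi P ((fun p => C p.1) ⋈ (fun p => A p.1) ⋈ Prod.fst) Y (fun p => C₀ p.1) ≤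
      cmi P ((fun p => Z' p.1) ⋈ Prod.fst) Y (fun p => C₀ p.1) :=
    cmi_mono (by fun_prop) hY (by fun_prop) id id (fun q => (C q.2.2, A q.2.2, q.2.2)) Prod.snd
      (by fun_prop) (by fun_prop) (by fun_prop) (by fun_prop) (fun _ => rfl) (fun _ => rfl)
      (fun _ => rfl) (fun _ => rfl)
  refine h3.trans ?_
  rw [cmi_prod_left (by fun_prop) (by fun_prop) hY (by fun_prop)]
  -- Markov property: (C₀, Z') determines the state of the kernel, hence the past says nothing more
  -- about the output.
  have h4 : cmi P Prod.fst Y ((fun p => C₀ p.1) ⋈ fun p => Z' p.1) = 0 := by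
    refine le_antisymm ?_ zero_le
    rw [← cmi_compProd_comap_eq_zero (μ := μ) κ hZ (A := id) (C := C₀ ⋈ Z') (by fun_prop)
      (by fun_prop)
      hh hhZ]
    exact cmi_mono (by fun_prop) (by fun_prop) (by fun_prop) id id Prod.snd
      (fun q => g (h q.1, q.2)) (by fun_prop) (by fun_prop) (by fun_prop) (by fun_prop)
      (fun _ => rfl) (fun _ => rfl) (fun _ => rfl)
      (fun p => by
        have : (C₀ ⋈ Z') p.1 = (C₀ p.1, Z' p.1) := rfl
        rw [this, hhZ])
  rw [h4, add_zero]

/-- Single-letterization: C₀ is the part of the conditioning that is kept, and Z' completes it to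
the inputs that govern the letter. -/
lemma cmi_le_cmi_state (hA : Measurable A) (hC : Measurable C) (hC₀ : Measurable C₀)
    (hZ' : Measurable Z') (hg : Measurable g) {f : γ → γ₀} (hf : Measurable f)
    (hfC : ∀ x, C₀ x = f (C x)) {h : γ₀ × ζ → δ} (hh : Measurable h)
    (hhZ : ∀ x, h (C₀ x, Z' x) = Z x) :
    cmi (μ ⊗ₘ κ.comap Z hZ) (fun p => A p.1) (fun p => g (Z p.1, p.2)) (fun p => C p.1) ≤
      cmi (μ ⊗ₘ κ.comap Z hZ) (fun p => Z' p.1) (fun p => g (Z p.1, p.2)) (fun p => C₀ p.1) :=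
  le_self_add.trans (cmi_add_cmi_le hA hC hC₀ hZ' hg hf hfC hh hhZ)

end OneLetter

/-- The uniform distribution of a message. -/
def unif (M : ℕ) : Measure (Fin M) := (M : ℝ≥0∞)⁻¹ • Measure.count

instance (M : ℕ) [NeZero M] : IsProbabilityMeasure (unif M) := ⟨by
  have h0 : (M : ℝ≥0∞) ≠ 0 := by exact_mod_cast NeZero.ne M
  rw [unif, Measure.smul_apply, Measure.count_univ, smul_eq_mul]
  simp [ENNReal.inv_mul_cancel h0 (ENNReal.natCast_ne_top M)]⟩

lemma unif_singleton (M : ℕ) (w : Fin M) : unif M {w} = (M : ℝ≥0∞)⁻¹ := by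
  simp [unif]

/-- The encoders (as infinite sequences) and the relay of a code. -/
structure Scheme (𝓧₁ 𝓧₂ 𝓧₃ 𝓨₃ : Type*) [MeasurableSpace 𝓧₃] [MeasurableSpace 𝓨₃]
    (M₁ M₂ : ℕ) where
  e₁ : Fin M₁ → ℕ → 𝓧₁
  e₂ : Fin M₂ → ℕ → 𝓧₂
  r : Relay 𝓧₃ 𝓨₃

/-! ### The process of messages, copies and noise generated by a code. -/

namespace ISIRC

variable {𝓧₁ 𝓧₂ 𝓧₃ 𝓢₁ 𝓢₂ 𝓢₃ 𝓨₁ 𝓨₂ 𝓨₃ : Type*} [MeasurableSpace 𝓧₁] [MeasurableSpace 𝓧₂]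
  [MeasurableSpace 𝓧₃] [MeasurableSpace 𝓢₁] [MeasurableSpace 𝓢₂] [MeasurableSpace 𝓢₃]
  [MeasurableSpace 𝓨₁] [MeasurableSpace 𝓨₂] [MeasurableSpace 𝓨₃]
  {M₁ M₂ : ℕ}

/-- The copies `((V₁, V₃), V₂)` and the noise `((S₁, Y₃), S₂)` of one channel use. -/
abbrev Letter (𝓢₁ 𝓢₂ 𝓢₃ 𝓨₃ : Type*) : Type _ := ((𝓢₁ × 𝓢₃) × 𝓢₂) × ((𝓢₁ × 𝓨₃) × 𝓢₂)

/-- The messages and the letters of `n` channel uses. -/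
abbrev Hist (M₁ M₂ : ℕ) (𝓢₁ 𝓢₂ 𝓢₃ 𝓨₃ : Type*) (n : ℕ) : Type _ :=
  (Fin M₁ × Fin M₂) × (Fin n → Letter 𝓢₁ 𝓢₂ 𝓢₃ 𝓨₃)

/-- The history and the letter of the next channel use. -/
abbrev Step (M₁ M₂ : ℕ) (𝓢₁ 𝓢₂ 𝓢₃ 𝓨₃ : Type*) (n : ℕ) : Type _ :=
  (Hist M₁ M₂ 𝓢₁ 𝓢₂ 𝓢₃ 𝓨₃ n × ((𝓢₁ × 𝓢₃) × 𝓢₂)) × ((𝓢₁ × 𝓨₃) × 𝓢₂)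

/-- The history after one more channel use. -/
def Step.next {n : ℕ} (p : Step M₁ M₂ 𝓢₁ 𝓢₂ 𝓢₃ 𝓨₃ n) : Hist M₁ M₂ 𝓢₁ 𝓢₂ 𝓢₃ 𝓨₃ (n + 1) :=
  snocHist (p.1.1, (p.1.2, p.2))

@[fun_prop]
lemma measurable_next {n : ℕ} :
    Measurable (Step.next : Step M₁ M₂ 𝓢₁ 𝓢₂ 𝓢₃ 𝓨₃ n → _) := by
  exact measurable_snocHist.comp (by fun_prop)

/-- The sequence of the values of a function of the letter and of the history before it. -/
def hist {𝓓 : Type*} (d : ∀ n, Step M₁ M₂ 𝓢₁ 𝓢₂ 𝓢₃ 𝓨₃ n → 𝓓) {n : ℕ}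
    (γ : Hist M₁ M₂ 𝓢₁ 𝓢₂ 𝓢₃ 𝓨₃ n) : Fin n → 𝓓 :=
  fun j => d j (((γ.1, fun l : Fin j => γ.2 (l.castLE j.2.le)), (γ.2 j).1), (γ.2 j).2)

@[fun_prop]
lemma measurable_hist {𝓓 : Type*} [MeasurableSpace 𝓓] {d : ∀ n, Step M₁ M₂ 𝓢₁ 𝓢₂ 𝓢₃ 𝓨₃ n → 𝓓}
    (hd : ∀ n, Measurable (d n)) {n : ℕ} :
    Measurable (hist d : Hist M₁ M₂ 𝓢₁ 𝓢₂ 𝓢₃ 𝓨₃ n → _) :=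
  measurable_pi_iff.2 fun j => (hd j).comp (by fun_prop)

/-- The value at time j sees only the letters up to j, so appending a letter leaves the earlier
values unchanged. -/
lemma hist_next {𝓓 : Type*} (d : ∀ n, Step M₁ M₂ 𝓢₁ 𝓢₂ 𝓢₃ 𝓨₃ n → 𝓓) {n : ℕ}
    (p : Step M₁ M₂ 𝓢₁ 𝓢₂ 𝓢₃ 𝓨₃ n) :
    hist d p.next = (Fin.snoc (hist d p.1.1) (d n p) : Fin (n + 1) → 𝓓) := by
  have hc : ∀ (j : Fin (n + 1)) (l : Fin j),
      (Fin.snoc p.1.1.2 (p.1.2, p.2) : Fin (n + 1) → Letter 𝓢₁ 𝓢₂ 𝓢₃ 𝓨₃) (l.castLE j.2.le) =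
        p.1.1.2 (l.castLE (Nat.lt_succ_iff.1 j.2)) := by
    intro j l
    have : l.castLE j.2.le = (l.castLE (Nat.lt_succ_iff.1 j.2)).castSucc := rfl
    rw [this, Fin.snoc_castSucc]
  funext j
  refine Fin.lastCases ?_ (fun i => ?_) j
  · simp only [hist, Step.next, snocHist, hc, Fin.snoc_last]
    rfl
  · simp only [hist, Step.next, snocHist, hc, Fin.snoc_castSucc]
    rfl

variable (ch : ISIRC 𝓧₁ 𝓧₂ 𝓧₃ 𝓢₁ 𝓢₂ 𝓢₃ 𝓨₁ 𝓨₂ 𝓨₃) (c : Scheme 𝓧₁ 𝓧₂ 𝓧₃ 𝓨₃ M₁ M₂)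

/-- The channel inputs at time `n`. -/
def inp {n : ℕ} (γ : Hist M₁ M₂ 𝓢₁ 𝓢₂ 𝓢₃ 𝓨₃ n) : 𝓧₁ × 𝓧₂ × 𝓧₃ :=
  (c.e₁ γ.1.1 n, c.e₂ γ.1.2 n, c.r.φ n fun j => (γ.2 j).2.1.2)

@[fun_prop]
lemma measurable_inp {n : ℕ} :
    Measurable (inp c : Hist M₁ M₂ 𝓢₁ 𝓢₂ 𝓢₃ 𝓨₃ n → 𝓧₁ × 𝓧₂ × 𝓧₃) := by
  have h1 : Measurable fun w => c.e₁ w n := measurable_of_finite _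
  have h2 : Measurable fun w => c.e₂ w n := measurable_of_finite _
  have h3 := c.r.measurable_φ n
  unfold inp
  fun_prop

variable [Nonempty 𝓧₂] [NeZero M₁] [NeZero M₂]

/-- The law of the messages and of `n` channel uses. -/
def procLaw (n : ℕ) : Measure (Hist M₁ M₂ 𝓢₁ 𝓢₂ 𝓢₃ 𝓨₃ n) :=
  seqLaw ((unif M₁).prod (unif M₂))
    (fun n => (ch.signal ×ₖ ch.noise).comap (inp c) (measurable_inp c (n := n))) n

instance (n : ℕ) : IsProbabilityMeasure (ch.procLaw c n) := by
  unfold procLaw; infer_instance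

/-- The law of the history, of the copies of the next channel use, and of its noise. -/
def stepLaw (n : ℕ) : Measure (Step M₁ M₂ 𝓢₁ 𝓢₂ 𝓢₃ 𝓨₃ n) :=
  (ch.procLaw c n ⊗ₘ ch.signal.comap (inp c) (measurable_inp c)) ⊗ₘ
    ch.noise.comap (fun p => inp c p.1) ((measurable_inp c).comp measurable_fst)

instance (n : ℕ) : IsProbabilityMeasure (ch.stepLaw c n) := by
  unfold stepLaw; infer_instance

lemma stepLaw_map_next (n : ℕ) : (ch.stepLaw c n).map Step.next = ch.procLaw c (n + 1) := by
  have h := compProd_prod_map_assoc (ch.procLaw c n)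
    (ch.signal.comap (inp c) (measurable_inp c)) (ch.noise.comap (inp c) (measurable_inp c))
  have h2 : ch.stepLaw c n = (ch.procLaw c n ⊗ₘ
      (ch.signal ×ₖ ch.noise).comap (inp c) (measurable_inp c)).map
        (fun p => ((p.1, p.2.1), p.2.2)) := h.symm.trans (by
    congr 2
    ext1 γ
    simp only [Kernel.prod_apply, Kernel.comap_apply])
  rw [h2, Measure.map_map (by fun_prop) (by fun_prop)]
  rfl

lemma stepLaw_map_fst (n : ℕ) : (ch.stepLaw c n).map (fun p => p.1) =
    ch.procLaw c n ⊗ₘ ch.signal.comap (inp c) (measurable_inp c) :=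
  Measure.fst_compProd _ _

lemma stepLaw_map_hist (n : ℕ) : (ch.stepLaw c n).map (fun p => p.1.1) = ch.procLaw c n := by
  have h1 : (ch.procLaw c n ⊗ₘ ch.signal.comap (inp c) (measurable_inp c)).map Prod.fst =
      ch.procLaw c n := Measure.fst_compProd _ _
  conv_rhs => rw [← h1, ← stepLaw_map_fst, Measure.map_map (by fun_prop) (by fun_prop)]
  rfl

/-- The kernel of the letters `(a, y₃)` of source 1 and the relay. -/
def sourceRelayKernel {α : Type*} [MeasurableSpace α] (κ : Kernel (𝓧₁ × 𝓧₃) (α × 𝓨₃)) (n : ℕ) :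
    Kernel (Fin M₁ × (Fin n → α × 𝓨₃)) (α × 𝓨₃) :=
  κ.comap (fun p => (c.e₁ p.1 n, c.r.φ n fun j => (p.2 j).2)) (by
    have h1 : Measurable fun w => c.e₁ w n := measurable_of_finite _
    have h3 := c.r.measurable_φ n
    fun_prop)

/-- The law of the message of source 1 and of letters `(a, y₃)`. -/
def sourceRelayLaw {α : Type*} [MeasurableSpace α] (κ : Kernel (𝓧₁ × 𝓧₃) (α × 𝓨₃)) (n : ℕ) :
    Measure (Fin M₁ × (Fin n → α × 𝓨₃)) :=
  seqLaw (unif M₁) (sourceRelayKernel c κ) n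

/-- The law of the message of source 2 and of the letters `S₂`. -/
def source₂Law (n : ℕ) : Measure (Fin M₂ × (Fin n → 𝓢₂)) :=
  seqLaw (unif M₂) (fun n => ch.pS₂.comap (fun p => c.e₂ p.1 n) (by
      have h1 : Measurable fun w => c.e₂ w n := measurable_of_finite _
      fun_prop)) n

instance {α : Type*} [MeasurableSpace α] (κ : Kernel (𝓧₁ × 𝓧₃) (α × 𝓨₃)) [IsMarkovKernel κ]
    (n : ℕ) : IsMarkovKernel (sourceRelayKernel c κ n) := by
  unfold sourceRelayKernel; infer_instance

instance {α : Type*} [MeasurableSpace α] (κ : Kernel (𝓧₁ × 𝓧₃) (α × 𝓨₃)) [IsMarkovKernel κ]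
    (n : ℕ) : IsProbabilityMeasure (sourceRelayLaw c κ n) := by
  unfold sourceRelayLaw; infer_instance

instance (n : ℕ) : IsProbabilityMeasure (ch.source₂Law c n) := by unfold source₂Law; infer_instance

/-- The relay input is a function of past Y₃ only. Hence, when Y₃ is grouped with source 1 and the
letter law splits accordingly, the two groups run as separate processes. This covers both the choice
of copies on the side of source 1 and the choice of true noise there. -/
lemma procLaw_map_eq_prod {α : Type*} [MeasurableSpace α] (κ : Kernel (𝓧₁ × 𝓧₃) (α × 𝓨₃))
    [IsMarkovKernel κ] {ψ : Letter 𝓢₁ 𝓢₂ 𝓢₃ 𝓨₃ → (α × 𝓨₃) × 𝓢₂} (hψ : Measurable ψ)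
    (hψT : ∀ l, (ψ l).1.2 = l.2.1.2)
    (h : ∀ z, ((ch.signal z).prod (ch.noise z)).map ψ = (κ (z.1, z.2.2)).prod (ch.pS₂ z.2.1))
    (n : ℕ) :
    (ch.procLaw c n).map (fun γ => ((γ.1.1, fun j => (ψ (γ.2 j)).1),
      (γ.1.2, fun j => (ψ (γ.2 j)).2))) = (sourceRelayLaw c κ n).prod (ch.source₂Law c n) := by
  have h1 : ∀ n, Measurable fun p : (Fin M₁ × Fin M₂) × (Fin n → (α × 𝓨₃) × 𝓢₂) =>
      (c.e₁ p.1.1 n, c.e₂ p.1.2 n, c.r.φ n fun j => (p.2 j).1.2) := by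
    intro n
    have h1 : Measurable fun w => c.e₁ w n := measurable_of_finite _
    have h2 : Measurable fun w => c.e₂ w n := measurable_of_finite _
    have h3 := c.r.measurable_φ n
    fun_prop
  have e1 := seqLaw_map (π := (unif M₁).prod (unif M₂)) (φ := id) (ψ := ψ)
    (k := fun n => (ch.signal ×ₖ ch.noise).comap (inp c) (measurable_inp c (n := n)))
    (k' := fun n => ((κ.comap (fun z => (z.1, z.2.2)) (by fun_prop)) ×ₖ
      (ch.pS₂.comap (fun z => z.2.1) (by fun_prop))).comap _ (h1 n)) measurable_id hψ
      (fun m p => by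
        simp only [Kernel.comap_apply, Kernel.prod_apply, h, inp, id, hψT]) n
  have e2 := seqLaw_prod (π₁ := unif M₁) (π₂ := unif M₂)
    (k := fun n => ((κ.comap (fun z => (z.1, z.2.2)) (by fun_prop)) ×ₖ
      (ch.pS₂.comap (fun z => z.2.1) (by fun_prop))).comap _ (h1 n))
    (k₁ := sourceRelayKernel c κ)
    (k₂ := fun n => ch.pS₂.comap (fun p => c.e₂ p.1 n) (by
      have h1 : Measurable fun w => c.e₂ w n := measurable_of_finite _
      fun_prop)) (fun m p => by
        simp only [sourceRelayKernel, Kernel.comap_apply, Kernel.prod_apply]) n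
  rw [Measure.map_id] at e1
  rw [sourceRelayLaw, source₂Law, ← e2, ← e1, procLaw,
    Measure.map_map (by fun_prop) (by fun_prop)]
  rfl

/-! ### Marginals of product laws. -/

section Prod

variable {a b d e f : Type*} [MeasurableSpace a] [MeasurableSpace b] [MeasurableSpace d]
  [MeasurableSpace e] [MeasurableSpace f] (μa : Measure a) (μb : Measure b) (μd : Measure d)
  (μe : Measure e) (μf : Measure f) [IsProbabilityMeasure μa] [IsProbabilityMeasure μb]
  [IsProbabilityMeasure μd] [IsProbabilityMeasure μe] [IsProbabilityMeasure μf]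

lemma prod_map_first_fourth_fifth :
    ((μa.prod μb).prod ((μd.prod μe).prod μf)).map (fun l => ((l.1.1, l.2.1.2), l.2.2)) =
      (μa.prod μe).prod μf := by
  have h1 : ((μd.prod μe).prod μf).map (Prod.map Prod.snd id) = μe.prod μf := by
    rw [← Measure.map_prod_map _ _ measurable_snd measurable_id, Measure.map_id,
      Measure.map_snd_prod, measure_univ, one_smul]
  have h2 : ((μa.prod μb).prod ((μd.prod μe).prod μf)).map
      (Prod.map Prod.fst (Prod.map Prod.snd id)) = μa.prod (μe.prod μf) := by
    rw [← Measure.map_prod_map _ _ measurable_fst (by fun_prop), h1, Measure.map_fst_prod,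
      measure_univ, one_smul]
  have h3 := Measure.prodAssoc_prod (μ := μa) (ν := μe) (τ := μf)
  rw [MeasurableEquiv.map_apply_eq_iff_map_symm_apply_eq] at h3
  rw [h3, ← h2, Measure.map_map (by fun_prop) (by fun_prop)]
  rfl

lemma prod_map_third_fourth_second :
    ((μa.prod μb).prod ((μd.prod μe).prod μf)).map (fun l => (l.2.1, l.1.2)) =
      (μd.prod μe).prod μb := by
  have h2 : ((μa.prod μb).prod ((μd.prod μe).prod μf)).map
      (Prod.map Prod.snd Prod.fst) = μb.prod (μd.prod μe) := by
    rw [← Measure.map_prod_map _ _ measurable_snd measurable_fst, Measure.map_fst_prod,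
      Measure.map_snd_prod, measure_univ, one_smul, measure_univ, one_smul]
  have h3 : (μb.prod (μd.prod μe)).map Prod.swap = (μd.prod μe).prod μb := Measure.prod_swap
  rw [← h3, ← h2, Measure.map_map (by fun_prop) (by fun_prop)]
  rfl

end Prod

end ISIRC


/-! ### Independent streams and the recovery of a letter. -/

lemma indepFun_of_map_eq_prod {Ω α β : Type*} [MeasurableSpace Ω] [MeasurableSpace α]
    [MeasurableSpace β] {P : Measure Ω} [IsProbabilityMeasure P] {A : Ω → α} {B : Ω → β}
    (hA : Measurable A) (hB : Measurable B) {μ : Measure α} {ν : Measure β}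
    [IsProbabilityMeasure μ] [IsProbabilityMeasure ν] (h : P.map (A ⋈ B) = μ.prod ν) :
    IndepFun A B P ∧ P.map A = μ ∧ P.map B = ν := by
  have h1 : P.map A = μ := by
    have : (P.map (A ⋈ B)).map Prod.fst = μ := by
      rw [h, Measure.map_fst_prod, measure_univ, one_smul]
    rw [← this, Measure.map_map (by fun_prop) (by fun_prop)]
    rfl
  have h2 : P.map B = ν := by
    have : (P.map (A ⋈ B)).map Prod.snd = ν := by
      rw [h, Measure.map_snd_prod, measure_univ, one_smul]
    rw [← this, Measure.map_map (by fun_prop) (by fun_prop)]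
    rfl
  refine ⟨?_, h1, h2⟩
  rw [indepFun_iff_map_prod_eq_prod_map_map hA.aemeasurable hB.aemeasurable, h1, h2]
  exact h

/-- A lower bound for the information of the past about an output from which the letter `S` of an
independent stream can be recovered. -/
lemma cmi_le_cmi_of_recover {Ω α β γ δ η σ υ : Type*} [MeasurableSpace Ω] [MeasurableSpace α]
    [MeasurableSpace β] [MeasurableSpace γ] [MeasurableSpace δ] [MeasurableSpace η]
    [MeasurableSpace σ] [MeasurableSpace υ] [StandardBorelSpace α] [Nonempty α]
    [StandardBorelSpace β] [Nonempty β] [StandardBorelSpace δ] [Nonempty δ]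
    [StandardBorelSpace η] [Nonempty η] [StandardBorelSpace σ] [Nonempty σ]
    [StandardBorelSpace υ] [Nonempty υ] {P : Measure Ω} [IsProbabilityMeasure P]
    {A : Ω → α} {S : Ω → σ} {H : Ω → η} {F : Ω → δ} {B : Ω → β} {Y : Ω → υ} {C : Ω → γ}
    (hB : Measurable B) (hY : Measurable Y) (hS : Measurable S) {a : β → α} (ha : Measurable a)
    (hA : ∀ ω, A ω = a (B ω)) {η' : β → η} (hη : Measurable η') (hH : ∀ ω, H ω = η' (B ω))
    {δ' : β → δ} (hδ : Measurable δ') (hF : ∀ ω, F ω = δ' (B ω)) (hind : IndepFun (H ⋈ S) F P)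
    {f : η × δ → γ} (hf : Measurable f) (hC : ∀ ω, C ω = f (H ω, F ω))
    {ψ : (η × δ) × υ → σ} (hψ : Measurable ψ) (hψS : ∀ ω, S ω = ψ ((H ω, F ω), Y ω)) :
    cmi P A S H ≤ cmi P B Y C := by
  obtain rfl : A = fun ω => a (B ω) := funext hA
  obtain rfl : H = fun ω => η' (B ω) := funext hH
  obtain rfl : F = fun ω => δ' (B ω) := funext hF
  -- Independence allows F to be added to the conditioning. Then (H, F), which is determined by B
  -- and determines C, replaces C, and Y yields S once (H, F) is known.
  refine (cmi_le_of_indepFun (D := fun ω => δ' (B ω)) (by fun_prop) hS (by fun_prop) (by fun_prop)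
    hind).trans ?_
  refine le_trans ?_ (cmi_le_of_determines (E := fun ω => (η' (B ω), δ' (B ω))) f
    (fun b => (η' b, δ' b)) hf (by fun_prop) hB hY hC (fun _ => rfl))
  exact cmi_mono hB hY (by fun_prop) id id (fun q => a q.2) ψ measurable_id measurable_id
    (by fun_prop) hψ (fun _ => rfl) (fun _ => rfl) (fun _ => rfl) hψS

namespace ISIRC

variable {𝓧₁ 𝓧₂ 𝓧₃ 𝓢₁ 𝓢₂ 𝓢₃ 𝓨₁ 𝓨₂ 𝓨₃ : Type*} [MeasurableSpace 𝓧₁] [MeasurableSpace 𝓧₂]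
  [MeasurableSpace 𝓧₃] [MeasurableSpace 𝓢₁] [MeasurableSpace 𝓢₂] [MeasurableSpace 𝓢₃]
  [MeasurableSpace 𝓨₁] [MeasurableSpace 𝓨₂] [MeasurableSpace 𝓨₃]
  {M₁ M₂ : ℕ}

/-- The sequence of the values of a function of the letters. -/
def lets {𝓓 : Type*} (ψ : Letter 𝓢₁ 𝓢₂ 𝓢₃ 𝓨₃ → 𝓓) {n : ℕ}
    (γ : Hist M₁ M₂ 𝓢₁ 𝓢₂ 𝓢₃ 𝓨₃ n) : Fin n → 𝓓 := fun j => ψ (γ.2 j)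

@[fun_prop]
lemma measurable_lets {𝓓 : Type*} [MeasurableSpace 𝓓] {ψ : Letter 𝓢₁ 𝓢₂ 𝓢₃ 𝓨₃ → 𝓓}
    (hψ : Measurable ψ) {n : ℕ} :
    Measurable (lets ψ : Hist M₁ M₂ 𝓢₁ 𝓢₂ 𝓢₃ 𝓨₃ n → _) := by
  unfold lets; fun_prop

lemma lets_next_castSucc {𝓓 : Type*} (ψ : Letter 𝓢₁ 𝓢₂ 𝓢₃ 𝓨₃ → 𝓓) {n : ℕ}
    (p : Step M₁ M₂ 𝓢₁ 𝓢₂ 𝓢₃ 𝓨₃ n) (j : Fin n) :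
    lets ψ p.next j.castSucc = lets ψ p.1.1 j := by
  simp only [lets, Step.next, snocHist, Fin.snoc_castSucc]

lemma lets_next_last {𝓓 : Type*} (ψ : Letter 𝓢₁ 𝓢₂ 𝓢₃ 𝓨₃ → 𝓓) {n : ℕ}
    (p : Step M₁ M₂ 𝓢₁ 𝓢₂ 𝓢₃ 𝓨₃ n) :
    lets ψ p.next (Fin.last n) = ψ (p.1.2, p.2) := by
  simp only [lets, Step.next, snocHist, Fin.snoc_last]

variable (ch : ISIRC 𝓧₁ 𝓧₂ 𝓧₃ 𝓢₁ 𝓢₂ 𝓢₃ 𝓨₁ 𝓨₂ 𝓨₃) (c : Scheme 𝓧₁ 𝓧₂ 𝓧₃ 𝓨₃ M₁ M₂)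
  [Nonempty 𝓧₂] [NeZero M₁] [NeZero M₂]

/-! ### Independent streams and equal laws -/

/-- The letters `((V₁, V₃), Y₃)` and `S₂`. -/
def copyStream (l : Letter 𝓢₁ 𝓢₂ 𝓢₃ 𝓨₃) : ((𝓢₁ × 𝓢₃) × 𝓨₃) × 𝓢₂ := ((l.1.1, l.2.1.2), l.2.2)

/-- The letters `(S₁, Y₃)` and `V₂`. -/
def noiseStream (l : Letter 𝓢₁ 𝓢₂ 𝓢₃ 𝓨₃) : (𝓢₁ × 𝓨₃) × 𝓢₂ := (l.2.1, l.1.2)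

@[fun_prop]
lemma measurable_copyStream : Measurable (copyStream : Letter 𝓢₁ 𝓢₂ 𝓢₃ 𝓨₃ → _) := by
  unfold copyStream; fun_prop

@[fun_prop]
lemma measurable_noiseStream : Measurable (noiseStream : Letter 𝓢₁ 𝓢₂ 𝓢₃ 𝓨₃ → _) := by
  unfold noiseStream; fun_prop

lemma procLaw_map_copyStream (n : ℕ) :
    (ch.procLaw c n).map ((fun γ => (γ.1.1, lets (fun l => (copyStream l).1) γ)) ⋈
      fun γ => (γ.1.2, lets (fun l => (copyStream l).2) γ)) =
      (sourceRelayLaw c (ch.pS₁ ×ₖ ch.kT) n).prod (ch.source₂Law c n) := by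
  refine procLaw_map_eq_prod ch c (ch.pS₁ ×ₖ ch.kT) measurable_copyStream (fun _ => rfl)
    (fun z => ?_) n
  simp only [signal, noise, Kernel.prod_apply, Kernel.comap_apply]
  exact prod_map_first_fourth_fifth _ _ _ _ _

lemma procLaw_map_noiseStream (n : ℕ) :
    (ch.procLaw c n).map ((fun γ => (γ.1.1, lets (fun l => (noiseStream l).1) γ)) ⋈
      fun γ => (γ.1.2, lets (fun l => (noiseStream l).2) γ)) =
      (sourceRelayLaw c (ch.kS ×ₖ ch.kT) n).prod (ch.source₂Law c n) := by
  refine procLaw_map_eq_prod ch c (ch.kS ×ₖ ch.kT) measurable_noiseStream (fun _ => rfl)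
    (fun z => ?_) n
  simp only [signal, noise, Kernel.prod_apply, Kernel.comap_apply]
  exact prod_map_third_fourth_second _ _ _ _ _

/-- Forgetting V₃ turns the law of the copy (V₁, V₃) into that of S₁. Both kernels draw Y₃
independently of the other letter. -/
lemma sourceRelayLaw_map (n : ℕ) :
    (sourceRelayLaw c (ch.pS₁ ×ₖ ch.kT) n).map (fun p => (p.1, fun j => ((p.2 j).1.1, (p.2 j).2))) =
      sourceRelayLaw c (ch.kS ×ₖ ch.kT) n := by
  have h := seqLaw_map (π := unif M₁) (k := sourceRelayKernel c (ch.pS₁ ×ₖ ch.kT))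
    (k' := sourceRelayKernel c (ch.kS ×ₖ ch.kT)) (φ := id) (ψ := Prod.map Prod.fst id)
    measurable_id (by fun_prop) (fun m p => by
      simp only [sourceRelayKernel, Kernel.comap_apply, Kernel.prod_apply, kS]
      rw [← Measure.map_prod_map _ _ measurable_fst measurable_id, Measure.map_id,
        Kernel.map_apply _ measurable_fst]
      rfl) n
  rw [Measure.map_id] at h
  exact h

lemma procLaw_map_source₂ (n : ℕ) :
    (ch.procLaw c n).map (fun γ => (γ.1.2, lets (fun l => l.1.2) γ)) =
      (ch.procLaw c n).map (fun γ => (γ.1.2, lets (fun l => l.2.2) γ)) :=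
  (indepFun_of_map_eq_prod (by fun_prop) (by fun_prop) (procLaw_map_noiseStream ch c n)).2.2.trans
    (indepFun_of_map_eq_prod (by fun_prop) (by fun_prop) (procLaw_map_copyStream ch c n)).2.2.symm

/-- V₁ is drawn independently of the true Y₃ given the inputs, and so is S₁ because the noise is
uncorrelated. This is what allows the copies to replace the true interference in the presence of the
relay outputs. -/
lemma procLaw_map_sourceRelay (n : ℕ) :
    (ch.procLaw c n).map (fun γ => (γ.1.1, lets (fun l => (l.1.1.1, l.2.1.2)) γ)) =
      (ch.procLaw c n).map (fun γ => (γ.1.1, lets (fun l => l.2.1) γ)) := by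
  have h1 := (indepFun_of_map_eq_prod (by fun_prop) (by fun_prop)
    (procLaw_map_noiseStream ch c n)).2.1
  have h2 := (indepFun_of_map_eq_prod (by fun_prop) (by fun_prop)
    (procLaw_map_copyStream ch c n)).2.1
  refine Eq.trans ?_ h1.symm
  rw [← sourceRelayLaw_map, ← h2, Measure.map_map (by fun_prop) (by fun_prop)]
  rfl

lemma indepFun_next {n : ℕ} {α β α' β' : Type*} [MeasurableSpace α] [MeasurableSpace β]
    [MeasurableSpace α'] [MeasurableSpace β'] {A : Hist M₁ M₂ 𝓢₁ 𝓢₂ 𝓢₃ 𝓨₃ (n + 1) → α}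
    {B : Hist M₁ M₂ 𝓢₁ 𝓢₂ 𝓢₃ 𝓨₃ (n + 1) → β} (hA : Measurable A) (hB : Measurable B)
    (h : IndepFun A B (ch.procLaw c (n + 1))) {a : α → α'} {b : β → β'} (ha : Measurable a)
    (hb : Measurable b) :
    IndepFun (fun p : Step M₁ M₂ 𝓢₁ 𝓢₂ 𝓢₃ 𝓨₃ n => b (B p.next)) (fun p => a (A p.next))
      (ch.stepLaw c n) := by
  rw [← stepLaw_map_next] at h
  have h2 : IndepFun (A ∘ Step.next) (B ∘ Step.next) (ch.stepLaw c n) := by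
    rw [indepFun_iff_map_prod_eq_prod_map_map (hA.comp measurable_next).aemeasurable
      (hB.comp measurable_next).aemeasurable]
    rw [indepFun_iff_map_prod_eq_prod_map_map hA.aemeasurable hB.aemeasurable,
      Measure.map_map (by fun_prop) (by fun_prop), Measure.map_map (by fun_prop) (by fun_prop),
      Measure.map_map (by fun_prop) (by fun_prop)] at h
    exact h
  exact (h2.comp ha hb).symm

/-- The messages and letters of source 1, the relay and the copies of `(S₁, S₃)`, which are
independent of the letters `S₂`. -/
def past₁ {n : ℕ} (x : Hist M₁ M₂ 𝓢₁ 𝓢₂ 𝓢₃ 𝓨₃ n × ((𝓢₁ × 𝓢₃) × 𝓢₂)) :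
    Fin M₁ × (Fin n → (𝓢₁ × 𝓢₃) × 𝓨₃) × (𝓢₁ × 𝓢₃) :=
  (x.1.1.1, lets (fun l => (l.1.1, l.2.1.2)) x.1, x.2.1)

/-- The messages of source 2 and the copies of `S₂`, which are independent of the letters
`(S₁, Y₃)`. -/
def past₂ {n : ℕ} (x : Hist M₁ M₂ 𝓢₁ 𝓢₂ 𝓢₃ 𝓨₃ n × ((𝓢₁ × 𝓢₃) × 𝓢₂)) :
    Fin M₂ × (Fin n → 𝓢₂) × 𝓢₂ :=
  (x.1.1.2, lets (fun l => l.1.2) x.1, x.2.2)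

@[fun_prop]
lemma measurable_past₁ {n : ℕ} : Measurable
    (past₁ : Hist M₁ M₂ 𝓢₁ 𝓢₂ 𝓢₃ 𝓨₃ n × ((𝓢₁ × 𝓢₃) × 𝓢₂) → _) := by unfold past₁; fun_prop

@[fun_prop]
lemma measurable_past₂ {n : ℕ} : Measurable
    (past₂ : Hist M₁ M₂ 𝓢₁ 𝓢₂ 𝓢₃ 𝓨₃ n × ((𝓢₁ × 𝓢₃) × 𝓢₂) → _) := by unfold past₂; fun_prop

/-- This is the independence of the two groups of streams after n + 1 uses, with the last letter
split off and the last Y₃ discarded. -/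
lemma indepFun_past₁ (n : ℕ) :
    IndepFun ((fun p : Step M₁ M₂ 𝓢₁ 𝓢₂ 𝓢₃ 𝓨₃ n => lets (fun l => l.2.2) p.1.1) ⋈ fun p => p.2.2)
      (fun p => past₁ p.1) (ch.stepLaw c n) := by
  have h := indepFun_next ch c (by fun_prop) (by fun_prop) (indepFun_of_map_eq_prod (by fun_prop)
    (by fun_prop) (procLaw_map_copyStream ch c (n + 1))).1
    (a := fun q => (q.1, (fun j : Fin n => q.2 j.castSucc), (q.2 (Fin.last n)).1))
    (b := fun q => ((fun j : Fin n => q.2 j.castSucc), q.2 (Fin.last n)))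
    (by fun_prop) (by fun_prop)
  simp only [lets_next_castSucc, lets_next_last] at h
  exact h

lemma indepFun_past₂ (n : ℕ) :
    IndepFun ((fun p : Step M₁ M₂ 𝓢₁ 𝓢₂ 𝓢₃ 𝓨₃ n => lets (fun l => l.2.1) p.1.1) ⋈ fun p => p.2.1)
      (fun p => past₂ p.1) (ch.stepLaw c n) := by
  have h := (indepFun_of_map_eq_prod (by fun_prop)
    (by fun_prop) (procLaw_map_noiseStream ch c (n + 1))).1
  have h := indepFun_next ch c (by fun_prop) (by fun_prop) h.symm
    (a := fun q => (q.1, (fun j : Fin n => q.2 j.castSucc), q.2 (Fin.last n)))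
    (b := fun q => ((fun j : Fin n => q.2 j.castSucc), q.2 (Fin.last n)))
    (by fun_prop) (by fun_prop)
  simp only [lets_next_castSucc, lets_next_last] at h
  exact h

end ISIRC


namespace ISIRC

variable {𝓧₁ 𝓧₂ 𝓧₃ 𝓢₁ 𝓢₂ 𝓢₃ 𝓨₁ 𝓨₂ 𝓨₃ : Type*} [MeasurableSpace 𝓧₁] [MeasurableSpace 𝓧₂]
  [MeasurableSpace 𝓧₃] [MeasurableSpace 𝓢₁] [MeasurableSpace 𝓢₂] [MeasurableSpace 𝓢₃]
  [MeasurableSpace 𝓨₁] [MeasurableSpace 𝓨₂] [MeasurableSpace 𝓨₃]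
  [StandardBorelSpace 𝓧₁] [StandardBorelSpace 𝓧₂] [StandardBorelSpace 𝓧₃]
  [StandardBorelSpace 𝓢₁] [StandardBorelSpace 𝓢₂] [StandardBorelSpace 𝓢₃]
  [StandardBorelSpace 𝓨₁] [StandardBorelSpace 𝓨₂] [StandardBorelSpace 𝓨₃]
  [Nonempty 𝓧₁] [Nonempty 𝓧₂] [Nonempty 𝓧₃] [Nonempty 𝓢₁] [Nonempty 𝓢₂] [Nonempty 𝓢₃]
  [Nonempty 𝓨₁] [Nonempty 𝓨₂] [Nonempty 𝓨₃]
  {M₁ M₂ : ℕ} (ch : ISIRC 𝓧₁ 𝓧₂ 𝓧₃ 𝓢₁ 𝓢₂ 𝓢₃ 𝓨₁ 𝓨₂ 𝓨₃) (c : Scheme 𝓧₁ 𝓧₂ 𝓧₃ 𝓨₃ M₁ M₂)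
  [NeZero M₁] [NeZero M₂]

/-- `I(W₂; S₂ₙ | S₂ⁿ⁻¹)`. -/
def info₂ (n : ℕ) : ℝ≥0∞ :=
  cmi (ch.stepLaw c n) (fun p => p.1.1.1.2) (fun p => p.2.2) (fun p => lets (fun l => l.2.2) p.1.1)

/-- `I(W₁, Y₃ⁿ⁻¹; S₁ₙ | S₁ⁿ⁻¹)`. -/
def info₁ (n : ℕ) : ℝ≥0∞ :=
  cmi (ch.stepLaw c n) (fun p => (p.1.1.1.1, lets (fun l => l.2.1.2) p.1.1)) (fun p => p.2.1.1)
    (fun p => lets (fun l => l.2.1.1) p.1.1)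

/-- `I(W₁; S₁ₙ, Y₃ₙ | S₁ⁿ⁻¹, Y₃ⁿ⁻¹)`. -/
def info₁₃ (n : ℕ) : ℝ≥0∞ :=
  cmi (ch.stepLaw c n) (fun p => p.1.1.1.1) (fun p => p.2.1) (fun p => lets (fun l => l.2.1) p.1.1)

lemma stepLaw_map_copy₁ (n : ℕ) : (ch.stepLaw c n).map (fun p => (p.1.1, p.1.2.1)) =
    ch.procLaw c n ⊗ₘ ch.pS₁.comap (fun γ => ((inp c γ).1, (inp c γ).2.2))
      ((measurable_inp c).fst.prodMk (measurable_inp c).snd.snd) := by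
  have h : ch.pS₁.comap (fun γ : Hist M₁ M₂ 𝓢₁ 𝓢₂ 𝓢₃ 𝓨₃ n => ((inp c γ).1, (inp c γ).2.2))
      ((measurable_inp c).fst.prodMk (measurable_inp c).snd.snd) =
      (ch.signal.comap (inp c) (measurable_inp c)).map Prod.fst := by
    ext1 γ
    rw [Kernel.map_apply _ measurable_fst, Kernel.comap_apply, Kernel.comap_apply, signal,
      Kernel.prod_apply, Measure.map_fst_prod, measure_univ, one_smul, Kernel.comap_apply]
  rw [h, Measure.compProd_map measurable_fst, ← stepLaw_map_fst,
    Measure.map_map (by fun_prop) (by fun_prop)]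
  rfl

lemma stepLaw_map_copy₂ (n : ℕ) : (ch.stepLaw c n).map (fun p => (p.1.1, p.1.2.2)) =
    ch.procLaw c n ⊗ₘ ch.pS₂.comap (fun γ => (inp c γ).2.1) (measurable_inp c).snd.fst := by
  have h : ch.pS₂.comap (fun γ : Hist M₁ M₂ 𝓢₁ 𝓢₂ 𝓢₃ 𝓨₃ n => (inp c γ).2.1)
      (measurable_inp c).snd.fst = (ch.signal.comap (inp c) (measurable_inp c)).map Prod.snd := by
    ext1 γ
    rw [Kernel.map_apply _ measurable_snd, Kernel.comap_apply, Kernel.comap_apply, signal,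
      Kernel.prod_apply, Measure.map_snd_prod, measure_univ, one_smul, Kernel.comap_apply]
  rw [h, Measure.compProd_map measurable_snd, ← stepLaw_map_fst,
    Measure.map_map (by fun_prop) (by fun_prop)]
  rfl

lemma stepLaw_map_noise₁ (n : ℕ) : (ch.stepLaw c n).map (fun p => (p.1.1, p.2.1)) =
    ch.procLaw c n ⊗ₘ (ch.kS ×ₖ ch.kT).comap (fun γ => ((inp c γ).1, (inp c γ).2.2))
      ((measurable_inp c).fst.prodMk (measurable_inp c).snd.snd) := by
  have h1 : (ch.stepLaw c n).map (Prod.map Prod.fst id) =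
      ch.procLaw c n ⊗ₘ ch.noise.comap (inp c) (measurable_inp c) := by
    rw [stepLaw, compProd_comap_map_prodMap _ ch.noise _ measurable_fst (measurable_inp c)
      (fun _ => rfl)]
    have := Measure.fst_compProd (ch.procLaw c n) (ch.signal.comap (inp c) (measurable_inp c))
    rw [Measure.fst] at this
    rw [this]
  have h : (ch.kS ×ₖ ch.kT).comap (fun γ : Hist M₁ M₂ 𝓢₁ 𝓢₂ 𝓢₃ 𝓨₃ n =>
      ((inp c γ).1, (inp c γ).2.2))
      ((measurable_inp c).fst.prodMk (measurable_inp c).snd.snd) =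
      (ch.noise.comap (inp c) (measurable_inp c)).map Prod.fst := by
    ext1 γ
    rw [Kernel.map_apply _ measurable_fst, Kernel.comap_apply, Kernel.comap_apply, noise,
      Kernel.prod_apply (κ := (ch.kS ×ₖ ch.kT).comap _ _), Measure.map_fst_prod, measure_univ,
      one_smul, Kernel.comap_apply]
  rw [h, Measure.compProd_map measurable_fst, ← h1, Measure.map_map (by fun_prop) (by fun_prop)]
  rfl

lemma stepLaw_map_congr {n : ℕ} {α β : Type*} [MeasurableSpace α] [MeasurableSpace β]
    {A B : Hist M₁ M₂ 𝓢₁ 𝓢₂ 𝓢₃ 𝓨₃ (n + 1) → α} (hA : Measurable A) (hB : Measurable B)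
    (h : (ch.procLaw c (n + 1)).map A = (ch.procLaw c (n + 1)).map B) {q : α → β}
    (hq : Measurable q) : (ch.stepLaw c n).map (fun p => q (A p.next)) =
      (ch.stepLaw c n).map (fun p => q (B p.next)) := by
  rw [← stepLaw_map_next, Measure.map_map hA measurable_next,
    Measure.map_map hB measurable_next] at h
  have h2 := congrArg (Measure.map q) h
  rwa [Measure.map_map hq (hA.comp measurable_next),
    Measure.map_map hq (hB.comp measurable_next)] at h2

/-- The copies V₂ have the same joint law with W₂ as the true S₂. -/
lemma info₂_eq_copy (n : ℕ) : ch.info₂ c n = cmi (ch.stepLaw c n) (fun p => p.1.1.1.2)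
    (fun p => p.1.2.2) (fun p => lets (fun l => l.1.2) p.1.1) := by
  refine cmi_congr_law (by fun_prop) (by fun_prop) (by fun_prop) (by fun_prop) (by fun_prop)
    (by fun_prop) ?_
  have h := stepLaw_map_congr ch c (by fun_prop) (by fun_prop) (procLaw_map_source₂ ch c (n + 1))
    (q := fun q => (((fun j : Fin n => q.2 j.castSucc), q.1), q.2 (Fin.last n))) (by fun_prop)
  simp only [lets_next_castSucc, lets_next_last] at h
  exact h.symm

/-- Only S₁ is exchanged for V₁; the relay outputs remain the true ones, as they determine X₃. -/
lemma info₁_eq_copy (n : ℕ) : ch.info₁ c n = cmi (ch.stepLaw c n)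
    (fun p => (p.1.1.1.1, lets (fun l => l.2.1.2) p.1.1)) (fun p => p.1.2.1.1)
    (fun p => lets (fun l => l.1.1.1) p.1.1) := by
  refine cmi_congr_law (by fun_prop) (by fun_prop) (by fun_prop) (by fun_prop) (by fun_prop)
    (by fun_prop) ?_
  have h := stepLaw_map_congr ch c (by fun_prop) (by fun_prop)
    (procLaw_map_sourceRelay ch c (n + 1))
    (q := fun q => (((fun j : Fin n => (q.2 j.castSucc).1),
      (q.1, fun j : Fin n => (q.2 j.castSucc).2)), (q.2 (Fin.last n)).1)) (by fun_prop)
  simp only [lets_next_castSucc, lets_next_last] at h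
  exact h.symm

/-- The relay output computed from the copy is a copy of Y₃: given the history, its joint law with
V₁ is that of (S₁, Y₃). -/
lemma stepLaw_map_relayOut (n : ℕ) :
    (ch.stepLaw c n).map (fun p => (p.1.1, (p.1.2.1.1, ch.relayOut p.1.2.1))) =
      (ch.stepLaw c n).map (fun p => (p.1.1, p.2.1)) := by
  have hm : Measurable fun s : 𝓢₁ × 𝓢₃ => (s.1, ch.relayOut s) := by fun_prop
  rw [stepLaw_map_noise₁, ← map_relayOut_eq]
  have h : (ch.pS₁.map (fun s => (s.1, ch.relayOut s))).comap
      (fun γ : Hist M₁ M₂ 𝓢₁ 𝓢₂ 𝓢₃ 𝓨₃ n => ((inp c γ).1, (inp c γ).2.2))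
      ((measurable_inp c).fst.prodMk (measurable_inp c).snd.snd) =
      (ch.pS₁.comap (fun γ : Hist M₁ M₂ 𝓢₁ 𝓢₂ 𝓢₃ 𝓨₃ n => ((inp c γ).1, (inp c γ).2.2))
      ((measurable_inp c).fst.prodMk (measurable_inp c).snd.snd)).map
        (fun s => (s.1, ch.relayOut s)) := by
    ext1 γ
    rw [Kernel.map_apply _ hm, Kernel.comap_apply, Kernel.comap_apply, Kernel.map_apply _ hm]
  rw [h, Measure.compProd_map hm, ← stepLaw_map_copy₁, Measure.map_map (by fun_prop) (by fun_prop)]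
  rfl

/-- The next letter depends on the history only through W₁ and the past of the true Y₃, so past S₁
may be exchanged for past V₁ and, at the same time, the new noise letter for the copied one. -/
lemma stepLaw_map_copy_eq_noise (n : ℕ) :
    (ch.stepLaw c n).map (fun p => ((p.1.1.1.1, lets (fun l => (l.1.1.1, l.2.1.2)) p.1.1),
      (p.1.2.1.1, ch.relayOut p.1.2.1))) =
      (ch.stepLaw c n).map (fun p => ((p.1.1.1.1, lets (fun l => l.2.1) p.1.1), p.2.1)) := by
  have hζ : Measurable fun q : Fin M₁ × (Fin n → 𝓢₁ × 𝓨₃) =>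
      (c.e₁ q.1 n, c.r.φ n fun j => (q.2 j).2) := by
    have h1 : Measurable fun w => c.e₁ w n := measurable_of_finite _
    have h3 := c.r.measurable_φ n
    fun_prop
  have hZ := (measurable_inp c (n := n) (𝓢₁ := 𝓢₁) (𝓢₂ := 𝓢₂) (𝓢₃ := 𝓢₃)).fst.prodMk
    (measurable_inp c).snd.snd
  have h := stepLaw_map_noise₁ ch c n
  have h1 := congrArg (Measure.map (Prod.map
    (fun γ => (γ.1.1, lets (fun l => (l.1.1.1, l.2.1.2)) γ)) id)) h
  have h2 := congrArg (Measure.map (Prod.map (fun γ => (γ.1.1, lets (fun l => l.2.1) γ)) id)) h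
  rw [compProd_comap_map_prodMap _ _ hZ (u := fun γ : Hist M₁ M₂ 𝓢₁ 𝓢₂ 𝓢₃ 𝓨₃ n =>
    (γ.1.1, lets (fun l => (l.1.1.1, l.2.1.2)) γ)) (by fun_prop) hζ (fun _ => rfl)] at h1
  rw [compProd_comap_map_prodMap _ _ hZ (u := fun γ : Hist M₁ M₂ 𝓢₁ 𝓢₂ 𝓢₃ 𝓨₃ n =>
    (γ.1.1, lets (fun l => l.2.1) γ)) (by fun_prop) hζ (fun _ => rfl)] at h2
  rw [procLaw_map_sourceRelay, ← stepLaw_map_relayOut, ← h2, Measure.map_map (by fun_prop)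
    (by fun_prop), Measure.map_map (by fun_prop) (by fun_prop)] at h1
  exact h1

lemma cmi_of_map_eq {Ω Ω' α β γ : Type*} [MeasurableSpace Ω] [MeasurableSpace Ω']
    [MeasurableSpace α] [MeasurableSpace β] [MeasurableSpace γ] [StandardBorelSpace α] [Nonempty α]
    [StandardBorelSpace β] [Nonempty β] {μ : Measure Ω} {ν : Measure Ω'} [IsFiniteMeasure μ]
    [IsFiniteMeasure ν] {u : Ω → Ω'} (hu : Measurable u) (h : μ.map u = ν) {A : Ω' → α}
    {B : Ω' → β} {C : Ω' → γ} (hA : Measurable A) (hB : Measurable B) (hC : Measurable C) :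
    cmi ν A B C = cmi μ (fun ω => A (u ω)) (fun ω => B (u ω)) (fun ω => C (u ω)) := by
  subst h
  exact cmi_map hu hA hB hC

/-! ### Upper bounds for the information about the copies -/

section Upper

variable {n : ℕ} {β γ : Type*} [MeasurableSpace β] [MeasurableSpace γ] [StandardBorelSpace β]
  [Nonempty β] [StandardBorelSpace γ] [Nonempty γ] {B : Hist M₁ M₂ 𝓢₁ 𝓢₂ 𝓢₃ 𝓨₃ n → β}
  {C : Hist M₁ M₂ 𝓢₁ 𝓢₂ 𝓢₃ 𝓨₃ n → γ}

/-- W₂ alone determines X₂, so given past V₂ nothing else in the history says more about the new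
copy than W₂ does. -/
lemma cmi_copy₂_le (hB : Measurable B) (hC : Measurable C) {f : γ → Fin n → 𝓢₂}
    (hf : Measurable f) (hfC : ∀ γ, lets (fun l => l.1.2) γ = f (C γ)) :
    cmi (ch.stepLaw c n) (fun p => B p.1.1) (fun p => p.1.2.2) (fun p => C p.1.1) ≤
      ch.info₂ c n := by
  have he : Measurable fun w => c.e₂ w n := measurable_of_finite _
  have h := cmi_le_cmi_state (μ := ch.procLaw c n) (κ := ch.pS₂)
    (hZ := (measurable_inp c).snd.fst) (A := B) (C := C) (C₀ := lets fun l => l.1.2)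
    (Z' := fun γ => γ.1.2) (g := Prod.snd) hB hC (by fun_prop) (by fun_prop) (by fun_prop) hf hfC
    (h := fun q => c.e₂ q.2 n) (by fun_prop) (fun _ => rfl)
  rw [cmi_of_map_eq (by fun_prop) (stepLaw_map_copy₂ ch c n) (by fun_prop) (by fun_prop)
    (by fun_prop), cmi_of_map_eq (by fun_prop) (stepLaw_map_copy₂ ch c n) (by fun_prop)
    (by fun_prop) (by fun_prop)] at h
  rw [info₂_eq_copy]
  exact h

/-- The law of V₁ depends on X₁ and X₃, and X₃ requires the past of Y₃. This is why `info₁` measures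
the information of W₁ together with the relay outputs. -/
lemma cmi_copy₁_le (hB : Measurable B) (hC : Measurable C) {f : γ → Fin n → 𝓢₁}
    (hf : Measurable f) (hfC : ∀ γ, lets (fun l => l.1.1.1) γ = f (C γ)) :
    cmi (ch.stepLaw c n) (fun p => B p.1.1) (fun p => p.1.2.1.1) (fun p => C p.1.1) ≤
      ch.info₁ c n := by
  have he : Measurable fun w => c.e₁ w n := measurable_of_finite _
  have hr := c.r.measurable_φ n
  have h := cmi_le_cmi_state (μ := ch.procLaw c n) (κ := ch.pS₁)
    (hZ := (measurable_inp c).fst.prodMk (measurable_inp c).snd.snd) (A := B) (C := C)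
    (C₀ := lets fun l => l.1.1.1) (Z' := fun γ => (γ.1.1, lets (fun l => l.2.1.2) γ))
    (g := fun q => q.2.1) hB hC (by fun_prop) (by fun_prop) (by fun_prop) hf hfC
    (h := fun q => (c.e₁ q.2.1 n, c.r.φ n q.2.2)) (by fun_prop) (fun _ => rfl)
  rw [cmi_of_map_eq (by fun_prop) (stepLaw_map_copy₁ ch c n) (by fun_prop) (by fun_prop)
    (by fun_prop), cmi_of_map_eq (by fun_prop) (stepLaw_map_copy₁ ch c n) (by fun_prop)
    (by fun_prop) (by fun_prop)] at h
  rw [info₁_eq_copy]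
  exact h

/-- (S₁, S₃) and (S₁, Y₃) carry the same information, by the injectivity of f₂(x₂, ·) at the fixed
x₂. -/
lemma injective_relayOut : Function.Injective fun s : 𝓢₁ × 𝓢₃ => (s.1, ch.relayOut s) := by
  intro s t h
  apply ch.injective_f₂ (Classical.arbitrary 𝓧₂)
  simp only [Prod.mk.injEq] at h ⊢
  exact ⟨by rw [h.1], h.2⟩

/-- With past Y₃ in the conditioning, W₁ alone determines the inputs X₁ and X₃. The full copy (V₁,
V₃) is then re-encoded as V₁ with its relay output, whose law is that of the true (S₁, Y₃). -/
lemma cmi_copy₁₃_le (hB : Measurable B) (hC : Measurable C) {f : γ → Fin n → 𝓢₁ × 𝓨₃}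
    (hf : Measurable f) (hfC : ∀ γ, lets (fun l => (l.1.1.1, l.2.1.2)) γ = f (C γ)) :
    cmi (ch.stepLaw c n) (fun p => B p.1.1) (fun p => p.1.2.1) (fun p => C p.1.1) ≤
      ch.info₁₃ c n := by
  have he : Measurable fun w => c.e₁ w n := measurable_of_finite _
  have hr := c.r.measurable_φ n
  have h := cmi_le_cmi_state (μ := ch.procLaw c n) (κ := ch.pS₁)
    (hZ := (measurable_inp c).fst.prodMk (measurable_inp c).snd.snd) (A := B) (C := C)
    (C₀ := lets fun l => (l.1.1.1, l.2.1.2)) (Z' := fun γ => γ.1.1)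
    (g := fun q => q.2) hB hC (by fun_prop) (by fun_prop) (by fun_prop) hf hfC
    (h := fun q => (c.e₁ q.2 n, c.r.φ n fun j => (q.1 j).2)) (by fun_prop) (fun _ => rfl)
  rw [cmi_of_map_eq (by fun_prop) (stepLaw_map_copy₁ ch c n) (by fun_prop) (by fun_prop)
    (by fun_prop), cmi_of_map_eq (by fun_prop) (stepLaw_map_copy₁ ch c n) (by fun_prop)
    (by fun_prop) (by fun_prop)] at h
  refine h.trans ?_
  have hm : Measurable fun s : 𝓢₁ × 𝓢₃ => (s.1, ch.relayOut s) := by fun_prop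
  have hemb := hm.measurableEmbedding ch.injective_relayOut
  have h2 : cmi (ch.stepLaw c n) (fun p => p.1.1.1.1) (fun p => p.1.2.1)
      (fun p => lets (fun l => (l.1.1.1, l.2.1.2)) p.1.1) ≤
      cmi (ch.stepLaw c n) (fun p => p.1.1.1.1) (fun p => (p.1.2.1.1, ch.relayOut p.1.2.1))
      (fun p => lets (fun l => (l.1.1.1, l.2.1.2)) p.1.1) :=
    cmi_mono (by fun_prop) (by fun_prop) (by fun_prop) id id Prod.snd
      (fun q => hemb.invFun q.2) measurable_id measurable_id (by fun_prop)
      (hemb.measurable_invFun.comp measurable_snd) (fun _ => rfl) (fun _ => rfl) (fun _ => rfl)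
      (fun p => (hemb.leftInverse_invFun p.1.2.1).symm)
  refine h2.trans (le_of_eq ?_)
  refine cmi_congr_law (by fun_prop) (by fun_prop) (by fun_prop) (by fun_prop) (by fun_prop)
    (by fun_prop) ?_
  have h3 := congrArg (Measure.map (Prod.map Prod.swap id)) (stepLaw_map_copy_eq_noise ch c n)
  rw [Measure.map_map (by fun_prop) (by fun_prop), Measure.map_map (by fun_prop) (by fun_prop)]
    at h3
  exact h3

end Upper

end ISIRC


namespace ISIRC

variable {𝓧₁ 𝓧₂ 𝓧₃ 𝓢₁ 𝓢₂ 𝓢₃ 𝓨₁ 𝓨₂ 𝓨₃ : Type*} [MeasurableSpace 𝓧₁] [MeasurableSpace 𝓧₂]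
  [MeasurableSpace 𝓧₃] [MeasurableSpace 𝓢₁] [MeasurableSpace 𝓢₂] [MeasurableSpace 𝓢₃]
  [MeasurableSpace 𝓨₁] [MeasurableSpace 𝓨₂] [MeasurableSpace 𝓨₃]
  [StandardBorelSpace 𝓧₁] [StandardBorelSpace 𝓧₂] [StandardBorelSpace 𝓧₃]
  [StandardBorelSpace 𝓢₁] [StandardBorelSpace 𝓢₂] [StandardBorelSpace 𝓢₃]
  [StandardBorelSpace 𝓨₁] [StandardBorelSpace 𝓨₂] [StandardBorelSpace 𝓨₃]
  [Nonempty 𝓧₁] [Nonempty 𝓧₂] [Nonempty 𝓧₃] [Nonempty 𝓢₁] [Nonempty 𝓢₂] [Nonempty 𝓢₃]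
  [Nonempty 𝓨₁] [Nonempty 𝓨₂] [Nonempty 𝓨₃]
  {M₁ M₂ : ℕ} (ch : ISIRC 𝓧₁ 𝓧₂ 𝓧₃ 𝓢₁ 𝓢₂ 𝓢₃ 𝓨₁ 𝓨₂ 𝓨₃) (c : Scheme 𝓧₁ 𝓧₂ 𝓧₃ 𝓨₃ M₁ M₂)
  [NeZero M₁] [NeZero M₂]

/-! ### Lower bounds for the information of the past about the outputs -/

/-- The letters `(u(V), g(inputs, noise))`. -/
def obs {υ β : Type*} (u : (𝓢₁ × 𝓢₃) × 𝓢₂ → υ)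
    (g : (𝓧₁ × 𝓧₂ × 𝓧₃) × ((𝓢₁ × 𝓨₃) × 𝓢₂) → β) (n : ℕ)
    (p : Step M₁ M₂ 𝓢₁ 𝓢₂ 𝓢₃ 𝓨₃ n) : υ × β := (u p.1.2, g (inp c p.1.1, p.2))

@[fun_prop]
lemma measurable_obs {υ β : Type*} [MeasurableSpace υ] [MeasurableSpace β]
    {u : (𝓢₁ × 𝓢₃) × 𝓢₂ → υ} {g : (𝓧₁ × 𝓧₂ × 𝓧₃) × ((𝓢₁ × 𝓨₃) × 𝓢₂) → β} (hu : Measurable u)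
    (hg : Measurable g) (n : ℕ) : Measurable (obs c u g n : Step M₁ M₂ 𝓢₁ 𝓢₂ 𝓢₃ 𝓨₃ n → _) := by
  have := measurable_inp c (𝓢₁ := 𝓢₁) (𝓢₂ := 𝓢₂) (𝓢₃ := 𝓢₃) (n := n)
  unfold obs
  fun_prop

/-- An injective measurable map between standard Borel spaces has a measurable inverse; keeping x₁
and x₃ in the image makes the inverse jointly measurable. -/
lemma exists_recover₁ : ∃ ψ : 𝓧₁ × 𝓧₃ × 𝓨₁ → 𝓢₂, Measurable ψ ∧
    ∀ x₁ x₃ s, ψ (x₁, x₃, ch.f₁ x₁ x₃ s) = s := by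
  have hm : Measurable fun q : 𝓧₁ × 𝓧₃ × 𝓢₂ => (q.1, q.2.1, ch.f₁ q.1 q.2.1 q.2.2) := by fun_prop
  have hinj : Function.Injective fun q : 𝓧₁ × 𝓧₃ × 𝓢₂ => (q.1, q.2.1, ch.f₁ q.1 q.2.1 q.2.2) := by
    rintro ⟨a, b, s⟩ ⟨a', b', s'⟩ h
    simp only [Prod.mk.injEq] at h ⊢
    obtain ⟨rfl, rfl, h⟩ := h
    exact ⟨rfl, rfl, ch.injective_f₁ _ _ h⟩
  have hemb := hm.measurableEmbedding hinj
  exact ⟨fun q => (hemb.invFun q).2.2, hemb.measurable_invFun.snd.snd, fun x₁ x₃ s =>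
    congrArg (fun q => q.2.2) (hemb.leftInverse_invFun (x₁, x₃, s))⟩

lemma exists_recover₂ : ∃ ψ : 𝓧₂ × 𝓨₂ → 𝓢₁, Measurable ψ ∧ ∀ x₂ s, ψ (x₂, ch.f₂' x₂ s) = s := by
  have hm : Measurable fun q : 𝓧₂ × 𝓢₁ => (q.1, ch.f₂' q.1 q.2) := by fun_prop
  have hinj : Function.Injective fun q : 𝓧₂ × 𝓢₁ => (q.1, ch.f₂' q.1 q.2) := by
    rintro ⟨a, s⟩ ⟨a', s'⟩ h
    simp only [Prod.mk.injEq] at h ⊢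
    obtain ⟨rfl, h⟩ := h
    exact ⟨rfl, ch.injective_f₂' _ h⟩
  have hemb := hm.measurableEmbedding hinj
  exact ⟨fun q => (hemb.invFun q).2, hemb.measurable_invFun.snd, fun x₂ s =>
    congrArg (fun q => q.2) (hemb.leftInverse_invFun (x₂, s))⟩

section Lower

variable {υ β : Type*} [MeasurableSpace υ] [MeasurableSpace β] [StandardBorelSpace β] [Nonempty β]

/-- The stream S₂ is independent of everything on the side of source 1 and the relay. That side
together with past S₂ reproduces the conditioning, and with X₁ and X₃ known the output Y₁ reveals
the new S₂. The maps g and k allow the output to be Y₁ or (Y₁, Y₃). -/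
lemma info₂_le {u : 𝓢₁ × 𝓢₃ → υ} (hu : Measurable u) {g : 𝓨₁ × 𝓨₃ → β} (hg : Measurable g)
    {k : β → 𝓨₁} (hk : Measurable k) (hkg : ∀ y, k (g y) = y.1) (n : ℕ) :
    ch.info₂ c n ≤ cmi (ch.stepLaw c n) Prod.fst
      (fun p => g ((ch.out (inp c p.1.1) p.2).1, (ch.out (inp c p.1.1) p.2).2.2))
      (fun p => ((((), hist (obs c (fun v => u v.1)
        fun q => g ((ch.out q.1 q.2).1, (ch.out q.1 q.2).2.2)) p.1.1), u p.1.2.1), p.1.1.1.1)) := by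
  obtain ⟨ψ, hψ, hψs⟩ := ch.exists_recover₁
  have hi := measurable_inp c (𝓢₁ := 𝓢₁) (𝓢₂ := 𝓢₂) (𝓢₃ := 𝓢₃) (n := n)
  have he : ∀ n, Measurable fun w => c.e₁ w n := fun n => measurable_of_finite _
  have hr := c.r.measurable_φ
  refine cmi_le_cmi_of_recover (F := fun p => past₁ p.1) (by fun_prop) (by fun_prop) (by fun_prop)
    (a := fun x => x.1.1.2) (by fun_prop) (fun _ => rfl)
    (η' := fun x => lets (fun l => l.2.2) x.1) (by fun_prop) (fun _ => rfl) (δ' := past₁)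
    (by fun_prop) (fun _ => rfl) (indepFun_past₁ ch c n)
    (f := fun q => ((((), fun j => (u (q.2.2.1 j).1, g (ch.f₁ (c.e₁ q.2.1 j)
      (c.r.φ j fun l => (q.2.2.1 (l.castLE j.2.le)).2) (q.1 j), (q.2.2.1 j).2))), u q.2.2.2),
        q.2.1))
    ?_ (fun _ => rfl)
    (ψ := fun q => ψ (c.e₁ q.1.2.1 n, c.r.φ n fun l => (q.1.2.2.1 l).2, k q.2)) (by fun_prop)
    (fun p => ?_)
  · fun_prop
  · rw [hkg]
    exact (hψs _ _ _).symm

/-- The roles of the sources are exchanged: Y₂ reveals S₁ once W₂ is known. Past Y₃ must stay out of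
the conditioning, since it is not a function of past S₁ and the side of source 2. -/
lemma info₁_le {u : 𝓢₂ → υ} (hu : Measurable u) (n : ℕ) :
    ch.info₁ c n ≤ cmi (ch.stepLaw c n) Prod.fst (fun p => (ch.out (inp c p.1.1) p.2).2.1)
      (fun p => ((((), hist (obs c (fun v => u v.2) fun q => (ch.out q.1 q.2).2.1) p.1.1),
        u p.1.2.2), p.1.1.1.2)) := by
  obtain ⟨ψ, hψ, hψs⟩ := ch.exists_recover₂
  have hi := measurable_inp c (𝓢₁ := 𝓢₁) (𝓢₂ := 𝓢₂) (𝓢₃ := 𝓢₃) (n := n)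
  have he : ∀ n, Measurable fun w => c.e₂ w n := fun n => measurable_of_finite _
  have hind : IndepFun ((fun p : Step M₁ M₂ 𝓢₁ 𝓢₂ 𝓢₃ 𝓨₃ n => lets (fun l => l.2.1.1) p.1.1) ⋈
      fun p => p.2.1.1) (fun p => past₂ p.1) (ch.stepLaw c n) :=
    (indepFun_past₂ ch c n).comp (ψ := id)
      (φ := fun q : (Fin n → 𝓢₁ × 𝓨₃) × (𝓢₁ × 𝓨₃) => ((fun j => (q.1 j).1), q.2.1))
      (by fun_prop) (by fun_prop)
  refine cmi_le_cmi_of_recover (F := fun p => past₂ p.1) (by fun_prop) (by fun_prop) (by fun_prop)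
    (a := fun x => (x.1.1.1, lets (fun l => l.2.1.2) x.1)) (by fun_prop) (fun _ => rfl)
    (η' := fun x => lets (fun l => l.2.1.1) x.1) (by fun_prop) (fun _ => rfl) (δ' := past₂)
    (by fun_prop) (fun _ => rfl) hind
    (f := fun q => ((((), fun j => (u (q.2.2.1 j), ch.f₂' (c.e₂ q.2.1 j) (q.1 j))),
      u q.2.2.2), q.2.1))
    ?_ (fun _ => rfl)
    (ψ := fun q => ψ (c.e₂ q.1.2.1 n, q.2)) (by fun_prop)
    (fun p => (hψs _ _).symm)
  fun_prop

/-- With (Y₂, Y₃) observed, the recovered stream is the pair (S₁, Y₃), so past Y₃ may stand in the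
conditioning. -/
lemma info₁₃_le {u : 𝓢₂ → υ} (hu : Measurable u) (n : ℕ) :
    ch.info₁₃ c n ≤ cmi (ch.stepLaw c n) Prod.fst
      (fun p => ((ch.out (inp c p.1.1) p.2).2.1, (ch.out (inp c p.1.1) p.2).2.2))
      (fun p => ((((), hist (obs c (fun v => u v.2)
        fun q => ((ch.out q.1 q.2).2.1, (ch.out q.1 q.2).2.2)) p.1.1), u p.1.2.2), p.1.1.1.2)) := by
  obtain ⟨ψ, hψ, hψs⟩ := ch.exists_recover₂
  have hi := measurable_inp c (𝓢₁ := 𝓢₁) (𝓢₂ := 𝓢₂) (𝓢₃ := 𝓢₃) (n := n)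
  have he : ∀ n, Measurable fun w => c.e₂ w n := fun n => measurable_of_finite _
  refine cmi_le_cmi_of_recover (F := fun p => past₂ p.1) (by fun_prop) (by fun_prop) (by fun_prop)
    (a := fun x => x.1.1.1) (by fun_prop) (fun _ => rfl)
    (η' := fun x => lets (fun l => l.2.1) x.1) (by fun_prop) (fun _ => rfl) (δ' := past₂)
    (by fun_prop) (fun _ => rfl) (indepFun_past₂ ch c n)
    (f := fun q => ((((), fun j => (u (q.2.2.1 j), (ch.f₂' (c.e₂ q.2.1 j) (q.1 j).1, (q.1 j).2))),
      u q.2.2.2), q.2.1))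
    ?_ (fun _ => rfl)
    (ψ := fun q => (ψ (c.e₂ q.1.2.1 n, q.2.1), q.2.2)) (by fun_prop)
    (fun p => ?_)
  · fun_prop
  · exact Prod.ext (hψs _ _).symm rfl

end Lower

/-! ### Sums over the channel uses -/

lemma procLaw_map_fst (n : ℕ) :
    (ch.procLaw c n).map (fun γ => γ.1) = (unif M₁).prod (unif M₂) := by
  induction n with
  | zero =>
    rw [procLaw, seqLaw, Measure.map_map (by fun_prop) (by fun_prop)]
    exact Measure.map_id
  | succ n ih =>
    rw [← stepLaw_map_next, Measure.map_map (by fun_prop) (by fun_prop), ← ih,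
      ← stepLaw_map_hist, Measure.map_map (by fun_prop) (by fun_prop)]
    rfl

/-- Chain rule over time; each history is a marginal of the following step. -/
lemma cmi_hist_le_sum {ω ε 𝓓 : Type*} [MeasurableSpace ω] [MeasurableSpace ε] [MeasurableSpace 𝓓]
    [StandardBorelSpace ω] [Nonempty ω] [StandardBorelSpace 𝓓] [Nonempty 𝓓]
    {W : Fin M₁ × Fin M₂ → ω} {E : Fin M₁ × Fin M₂ → ε}
    {d : ∀ n, Step M₁ M₂ 𝓢₁ 𝓢₂ 𝓢₃ 𝓨₃ n → 𝓓} (hd : ∀ n, Measurable (d n)) (hW : Measurable W)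
    (hE : Measurable E) (N : ℕ) :
    cmi (ch.procLaw c N) (fun γ => W γ.1) (hist d) (fun γ => E γ.1) ≤
      ∑ n ∈ Finset.range N, cmi (ch.stepLaw c n) (fun p => W p.1.1.1) (d n)
        (fun p => (E p.1.1.1, hist d p.1.1)) := by
  induction N with
  | zero =>
    have h : (hist d : Hist M₁ M₂ 𝓢₁ 𝓢₂ 𝓢₃ 𝓨₃ 0 → _) = fun _ => Fin.elim0 := by
      funext γ j
      exact j.elim0
    have h0 : cmi (ch.procLaw c 0) (fun _ => (Fin.elim0 : Fin 0 → 𝓓)) (fun γ => W γ.1)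
        (fun γ => E γ.1) = 0 :=
      cmi_eq_zero_of_indepFun (by fun_prop) (by fun_prop) (by fun_prop) (indepFun_const_right _ _)
    rw [h, cmi_comm (by fun_prop) (by fun_prop) (by fun_prop), h0]
    exact zero_le
  | succ N ih =>
    have hh : Measurable (hist d : Hist M₁ M₂ 𝓢₁ 𝓢₂ 𝓢₃ 𝓨₃ N → _) := measurable_hist hd
    have hh' : Measurable (hist d : Hist M₁ M₂ 𝓢₁ 𝓢₂ 𝓢₃ 𝓨₃ (N + 1) → _) := measurable_hist hd
    have hdN := hd N
    rw [Finset.sum_range_succ]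
    refine le_trans ?_ (add_le_add_left ih _)
    rw [cmi_of_map_eq (by fun_prop) (stepLaw_map_next ch c N) (by fun_prop) hh' (by fun_prop),
      cmi_of_map_eq (by fun_prop) (stepLaw_map_hist ch c N) (by fun_prop) hh (by fun_prop)]
    have h := cmi_prod_right (μ := ch.stepLaw c N) (A := fun p => W p.1.1.1)
      (B := fun p => hist d p.1.1) (B' := d N) (C := fun p => E p.1.1.1) (by fun_prop)
      (by fun_prop) (by fun_prop) (by fun_prop)
    refine le_trans ?_ h.le
    exact cmi_mono (by fun_prop) (by fun_prop) (by fun_prop) id id Prod.snd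
      (fun q => Fin.snoc q.2.1 q.2.2) measurable_id measurable_id measurable_snd
      (measurable_snoc (by fun_prop) (by fun_prop)) (fun _ => rfl) (fun _ => rfl) (fun _ => rfl)
      (fun p => hist_next d p)

/-- The information about a message, split into the contributions of the copies and of the
outputs. -/
lemma cmi_le_sum_obs {ω ε υ β 𝓓 : Type*} [MeasurableSpace ω] [MeasurableSpace ε]
    [MeasurableSpace υ] [MeasurableSpace β] [MeasurableSpace 𝓓] [StandardBorelSpace ω] [Nonempty ω]
    [StandardBorelSpace ε] [Nonempty ε] [StandardBorelSpace υ] [Nonempty υ] [StandardBorelSpace β]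
    [Nonempty β] [StandardBorelSpace 𝓓] [Nonempty 𝓓]
    {W : Fin M₁ × Fin M₂ → ω} {E : Fin M₁ × Fin M₂ → ε} (hW : Measurable W) (hE : Measurable E)
    (hind : IndepFun W E ((unif M₁).prod (unif M₂))) {u : (𝓢₁ × 𝓢₃) × 𝓢₂ → υ}
    {g : (𝓧₁ × 𝓧₂ × 𝓧₃) × ((𝓢₁ × 𝓨₃) × 𝓢₂) → β} (hu : Measurable u) (hg : Measurable g)
    {k : β → 𝓓} (hk : Measurable k) (N : ℕ) :
    cmi (ch.procLaw c N) (fun γ => W γ.1) (hist fun _ p => k (g (inp c p.1.1, p.2))) (fun _ => ()) ≤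
      ∑ n ∈ Finset.range N, (cmi (ch.stepLaw c n) (fun p => W p.1.1.1) (fun p => u p.1.2)
        (fun p => (E p.1.1.1, hist (obs c u g) p.1.1)) +
        cmi (ch.stepLaw c n) (fun p => W p.1.1.1) (fun p => g (inp c p.1.1, p.2))
        (fun p => ((E p.1.1.1, hist (obs c u g) p.1.1), u p.1.2))) := by
  have hi := fun n => measurable_inp c (𝓢₁ := 𝓢₁) (𝓢₂ := 𝓢₂) (𝓢₃ := 𝓢₃) (n := n)
  have hobs := measurable_obs (𝓢₁ := 𝓢₁) (𝓢₂ := 𝓢₂) (𝓢₃ := 𝓢₃) c hu hg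
  have hh := fun n => measurable_hist (n := n) hobs
  have hkm : ∀ n, Measurable fun p : Step M₁ M₂ 𝓢₁ 𝓢₂ 𝓢₃ 𝓨₃ n => k (g (inp c p.1.1, p.2)) := by
    fun_prop
  have hm := measurable_hist (n := N) hkm
  have hi1 : IndepFun (fun γ => W γ.1) (fun γ => E γ.1) (ch.procLaw c N) := by
    rw [← procLaw_map_fst ch c N] at hind
    rw [indepFun_iff_map_prod_eq_prod_map_map (by fun_prop) (by fun_prop)] at hind ⊢
    rw [Measure.map_map (by fun_prop) (by fun_prop), Measure.map_map (by fun_prop) (by fun_prop),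
      Measure.map_map (by fun_prop) (by fun_prop)] at hind
    exact hind
  -- The side information E, the other message or a constant, is independent of W, so conditioning
  -- on it only increases the information.
  have h1 : cmi (ch.procLaw c N) (fun γ => W γ.1) (hist fun _ p => k (g (inp c p.1.1, p.2)))
      (fun _ => ()) ≤ cmi (ch.procLaw c N) (fun γ => W γ.1)
      (hist fun _ p => k (g (inp c p.1.1, p.2))) (fun γ => E γ.1) := by
    rw [cmi_comm (by fun_prop) hm (by fun_prop), cmi_comm (by fun_prop) hm (by fun_prop)]
    have hi2 : IndepFun ((fun _ => ()) ⋈ fun γ => W γ.1) (fun γ => E γ.1) (ch.procLaw c N) :=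
      hi1.comp (φ := fun w => ((), w)) (ψ := id) (by fun_prop) (by fun_prop)
    refine (cmi_le_of_indepFun hm (by fun_prop) (by fun_prop) (by fun_prop)
      hi2).trans (le_of_eq ?_)
    exact (cmi_congr_cond hm (by fun_prop) (by fun_prop) Prod.snd (fun e => ((), e))
      (by fun_prop) (by fun_prop) (fun _ => rfl) (fun _ => rfl)).symm
  have h2 : cmi (ch.procLaw c N) (fun γ => W γ.1) (hist fun _ p => k (g (inp c p.1.1, p.2)))
      (fun γ => E γ.1) ≤ cmi (ch.procLaw c N) (fun γ => W γ.1) (hist (obs c u g))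
      (fun γ => E γ.1) :=
    cmi_mono (by fun_prop) (hh N) (by fun_prop) id id Prod.snd (fun q j => k (q.2 j).2)
      measurable_id measurable_id measurable_snd (by fun_prop) (fun _ => rfl) (fun _ => rfl)
      (fun _ => rfl) (fun _ => rfl)
  refine (h1.trans h2).trans ((cmi_hist_le_sum ch c hobs hW hE N).trans ?_)
  refine Finset.sum_le_sum fun n _ => le_of_eq ?_
  have hhn := hh n
  exact cmi_prod_right (μ := ch.stepLaw c n) (A := fun p => W p.1.1.1) (B := fun p => u p.1.2)
    (B' := fun p => g (inp c p.1.1, p.2)) (C := fun p => (E p.1.1.1, hist (obs c u g) p.1.1))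
    (by fun_prop) (by fun_prop) (by fun_prop) (by fun_prop)

end ISIRC


namespace ISIRC

variable {𝓧₁ 𝓧₂ 𝓧₃ 𝓢₁ 𝓢₂ 𝓢₃ 𝓨₁ 𝓨₂ 𝓨₃ : Type*} [MeasurableSpace 𝓧₁] [MeasurableSpace 𝓧₂]
  [MeasurableSpace 𝓧₃] [MeasurableSpace 𝓢₁] [MeasurableSpace 𝓢₂] [MeasurableSpace 𝓢₃]
  [MeasurableSpace 𝓨₁] [MeasurableSpace 𝓨₂] [MeasurableSpace 𝓨₃]
  [StandardBorelSpace 𝓧₁] [StandardBorelSpace 𝓧₂] [StandardBorelSpace 𝓧₃]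
  [StandardBorelSpace 𝓢₁] [StandardBorelSpace 𝓢₂] [StandardBorelSpace 𝓢₃]
  [StandardBorelSpace 𝓨₁] [StandardBorelSpace 𝓨₂] [StandardBorelSpace 𝓨₃]
  [Nonempty 𝓧₁] [Nonempty 𝓧₂] [Nonempty 𝓧₃] [Nonempty 𝓢₁] [Nonempty 𝓢₂] [Nonempty 𝓢₃]
  [Nonempty 𝓨₁] [Nonempty 𝓨₂] [Nonempty 𝓨₃]
  {M₁ M₂ : ℕ} (ch : ISIRC 𝓧₁ 𝓧₂ 𝓧₃ 𝓢₁ 𝓢₂ 𝓢₃ 𝓨₁ 𝓨₂ 𝓨₃) (c : Scheme 𝓧₁ 𝓧₂ 𝓧₃ 𝓨₃ M₁ M₂)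
  [NeZero M₁] [NeZero M₂]


/-! ### The inputs and the single-letter quantities -/

/-- The law of the channel inputs at time `n`. -/
def inpLaw (n : ℕ) : Measure (𝓧₁ × 𝓧₂ × 𝓧₃) := (ch.procLaw c n).map (inp c)

instance (n : ℕ) : IsProbabilityMeasure (ch.inpLaw c n) :=
  Measure.isProbabilityMeasure_map (measurable_inp c).aemeasurable

/-- The inputs, the copies and the outputs at time `n`. -/
def Step.view {n : ℕ} (p : Step M₁ M₂ 𝓢₁ 𝓢₂ 𝓢₃ 𝓨₃ n) :
    View Unit 𝓧₁ 𝓧₂ 𝓧₃ 𝓢₁ 𝓢₂ 𝓢₃ 𝓨₁ 𝓨₂ 𝓨₃ :=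
  ((), inp c p.1.1, p.1.2, ch.out (inp c p.1.1) p.2)

lemma measurable_view {n : ℕ} :
    Measurable (Step.view ch c : Step M₁ M₂ 𝓢₁ 𝓢₂ 𝓢₃ 𝓨₃ n → _) := by
  have hi := measurable_inp c (𝓢₁ := 𝓢₁) (𝓢₂ := 𝓢₂) (𝓢₃ := 𝓢₃) (n := n)
  unfold Step.view
  fun_prop

lemma stepLaw_map_view (n : ℕ) :
    (ch.stepLaw c n).map (Step.view ch c) = ch.viewLaw () (ch.inpLaw c n) := by
  have hi := measurable_inp c (𝓢₁ := 𝓢₁) (𝓢₂ := 𝓢₂) (𝓢₃ := 𝓢₃) (n := n)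
  refine Measure.ext_of_lintegral _ fun F hF => ?_
  have hv := measurable_view ch c (n := n)
  rw [lintegral_map hF hv, stepLaw, Measure.lintegral_compProd (by fun_prop),
    Measure.lintegral_compProd (by
      exact Measurable.lintegral_kernel_prod_right' (f := fun p => F (Step.view ch c p))
        (by fun_prop)),
    viewLaw, lintegral_map hF (by fun_prop), Measure.lintegral_compProd (by fun_prop), inpLaw,
    lintegral_map (by
      exact Measurable.lintegral_kernel_prod_right'
        (f := fun p : (𝓧₁ × 𝓧₂ × 𝓧₃) × (((𝓢₁ × 𝓢₃) × 𝓢₂) × 𝓨₁ × 𝓨₂ × 𝓨₃) => F ((), p))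
        (by fun_prop)) hi]
  refine lintegral_congr fun γ => ?_
  rw [Kernel.comap_apply, Kernel.prod_apply, lintegral_prod _ (by fun_prop)]
  refine lintegral_congr fun v => ?_
  rw [Kernel.comap_apply, channel_apply, lintegral_map (by fun_prop) (by fun_prop)]
  rfl

lemma cmi_viewLaw {α β γ : Type*} [MeasurableSpace α] [MeasurableSpace β] [MeasurableSpace γ]
    [StandardBorelSpace α] [Nonempty α] [StandardBorelSpace β] [Nonempty β] (n : ℕ)
    {A : View Unit 𝓧₁ 𝓧₂ 𝓧₃ 𝓢₁ 𝓢₂ 𝓢₃ 𝓨₁ 𝓨₂ 𝓨₃ → α}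
    {B : View Unit 𝓧₁ 𝓧₂ 𝓧₃ 𝓢₁ 𝓢₂ 𝓢₃ 𝓨₁ 𝓨₂ 𝓨₃ → β}
    {C : View Unit 𝓧₁ 𝓧₂ 𝓧₃ 𝓢₁ 𝓢₂ 𝓢₃ 𝓨₁ 𝓨₂ 𝓨₃ → γ} (hA : Measurable A) (hB : Measurable B)
    (hC : Measurable C) : cmi (ch.viewLaw () (ch.inpLaw c n)) A B C =
      cmi (ch.stepLaw c n) (fun p => A (p.view ch c)) (fun p => B (p.view ch c))
        (fun p => C (p.view ch c)) :=
  cmi_of_map_eq (measurable_view ch c) (stepLaw_map_view ch c n) hA hB hC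

/-- The relay output carries no information when the inputs `(x₁, x₃)` are known. -/
lemma cmi_drop_relay {α γ : Type*} [MeasurableSpace α] [MeasurableSpace γ]
    [StandardBorelSpace α] [Nonempty α] {n : ℕ}
    {A : Hist M₁ M₂ 𝓢₁ 𝓢₂ 𝓢₃ 𝓨₃ n × ((𝓢₁ × 𝓢₃) × 𝓢₂) → α}
    {C : Hist M₁ M₂ 𝓢₁ 𝓢₂ 𝓢₃ 𝓨₃ n × ((𝓢₁ × 𝓢₃) × 𝓢₂) → γ} (hA : Measurable A)
    (hC : Measurable C) {f : γ → 𝓧₁ × 𝓧₃} (hf : Measurable f)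
    (hfC : ∀ x, f (C x) = ((inp c x.1).1, (inp c x.1).2.2)) :
    cmi (ch.stepLaw c n) (fun p => A p.1)
      (fun p => ((ch.out (inp c p.1.1) p.2).2.1, (ch.out (inp c p.1.1) p.2).2.2))
      (fun p => C p.1) ≤
    cmi (ch.stepLaw c n) (fun p => A p.1) (fun p => (ch.out (inp c p.1.1) p.2).2.1)
      (fun p => C p.1) := by
  have hi := measurable_inp c (𝓢₁ := 𝓢₁) (𝓢₂ := 𝓢₂) (𝓢₃ := 𝓢₃) (n := n)
  set μ := ch.procLaw c n ⊗ₘ ch.signal.comap (inp c) (measurable_inp c)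
  have hz : Measurable fun x : Hist M₁ M₂ 𝓢₁ 𝓢₂ 𝓢₃ 𝓨₃ n × ((𝓢₁ × 𝓢₃) × 𝓢₂) =>
    ((inp c x.1).1, (inp c x.1).2.2) :=
    (hi.comp measurable_fst).fst.prodMk (hi.comp measurable_fst).snd.snd
  have hx : Measurable fun x : Hist M₁ M₂ 𝓢₁ 𝓢₂ 𝓢₃ 𝓨₃ n × ((𝓢₁ × 𝓢₃) × 𝓢₂) => inp c x.1 :=
    hi.comp measurable_fst
  -- The noise is drawn in stages, Y₃ last, so that Y₃ is a letter from a kernel of (x₁, x₃) and is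
  -- conditionally independent of Y₂ and the past.
  have hlaw : (ch.stepLaw c n).map (fun p => ((p.1, p.2.1.1), p.2.1.2)) =
      (μ ⊗ₘ ch.kS.comap _ hz) ⊗ₘ ch.kT.comap (fun q => ((inp c q.1.1).1, (inp c q.1.1).2.2))
        (hz.comp measurable_fst) := by
    have h1 := compProd_prod_map_assoc μ (ch.kS.comap _ hz) (ch.kT.comap _ hz)
    have h2 : ch.kS.comap _ hz ×ₖ ch.kT.comap _ hz =
        (ch.noise.comap _ hx).map Prod.fst := by
      ext1 γ
      rw [Kernel.map_apply _ measurable_fst, Kernel.comap_apply, noise,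
        Kernel.prod_apply (κ := (ch.kS ×ₖ ch.kT).comap _ _), Measure.map_fst_prod, measure_univ,
        one_smul, Kernel.comap_apply, Kernel.prod_apply, Kernel.prod_apply, Kernel.comap_apply,
        Kernel.comap_apply]
    rw [h2, Measure.compProd_map measurable_fst, Measure.map_map (by fun_prop) (by fun_prop)] at h1
    exact h1
  have h1 := cmi_prod_right (μ := ch.stepLaw c n) (A := fun p => A p.1)
    (B := fun p => (ch.out (inp c p.1.1) p.2).2.1) (B' := fun p => p.2.1.2)
    (C := fun p => C p.1) (by fun_prop) (by fun_prop) (by fun_prop) (by fun_prop)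
  refine h1.le.trans (le_of_eq ?_)
  have h2 : cmi (ch.stepLaw c n) (fun p => A p.1) (fun p => p.2.1.2)
      ((fun p => C p.1) ⋈ fun p => (ch.out (inp c p.1.1) p.2).2.1) = 0 := by
    have h3 := cmi_compProd_comap_eq_zero (μ := μ ⊗ₘ ch.kS.comap _ hz) ch.kT
      (Z := fun q => ((inp c q.1.1).1, (inp c q.1.1).2.2)) (hz.comp measurable_fst)
      (A := fun q => A q.1)
      (C := fun q => (C q.1, ch.f₂' (inp c q.1.1).2.1 q.2)) (by fun_prop) (by fun_prop)
      (ζ := fun q => f q.1) (by fun_prop) (fun q => hfC q.1)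
    rw [cmi_of_map_eq (by fun_prop) hlaw (by fun_prop) (by fun_prop) (by fun_prop)] at h3
    exact h3
  rw [h2, add_zero]

lemma cmi_const_right {Ω α β γ : Type*} [MeasurableSpace Ω] [MeasurableSpace α] [MeasurableSpace β]
    [MeasurableSpace γ] [StandardBorelSpace α] [Nonempty α] [StandardBorelSpace β] [Nonempty β]
    {P : Measure Ω} [IsProbabilityMeasure P] {A : Ω → α} {C : Ω → γ} (hA : Measurable A)
    (hC : Measurable C) (b : β) : cmi P A (fun _ => b) C = 0 := by
  rw [cmi_comm hA (by fun_prop) hC]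
  exact cmi_eq_zero_of_indepFun (by fun_prop) hA hC (indepFun_const_right _ _)

lemma indepFun_unif : IndepFun (Prod.fst : Fin M₁ × Fin M₂ → Fin M₁) Prod.snd
    ((unif M₁).prod (unif M₂)) := by
  rw [indepFun_iff_map_prod_eq_prod_map_map (by fun_prop) (by fun_prop), Measure.map_fst_prod,
    Measure.map_snd_prod, measure_univ, measure_univ, one_smul, one_smul]
  exact Measure.map_id

/-! ### The sixteen inequalities -/

/-- `I(W₁; Y₁ᴺ)`. -/
def msgInfo₁ (N : ℕ) : ℝ≥0∞ :=
  cmi (ch.procLaw c N) (fun γ => γ.1.1) (hist fun _ p => (ch.out (inp c p.1.1) p.2).1) (fun _ => ())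

/-- `I(W₂; Y₂ᴺ)`. -/
def msgInfo₂ (N : ℕ) : ℝ≥0∞ :=
  cmi (ch.procLaw c N) (fun γ => γ.1.2) (hist fun _ p => (ch.out (inp c p.1.1) p.2).2.1)
    (fun _ => ())

/-- Destination 1 is given W₂ and the relay outputs. W₂ produces X₂ and past Y₃ produces X₃, so both
are kept as conditioning. -/
lemma msgInfo₁_le_relay_given_x₂x₃ (N : ℕ) :
    ch.msgInfo₁ c N ≤
      ∑ n ∈ Finset.range N, terms (ch.viewLaw () (ch.inpLaw c n)) 0 := by
  have he₁ : ∀ n, Measurable fun w => c.e₁ w n := fun n => measurable_of_finite _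
  have he₂ : ∀ n, Measurable fun w => c.e₂ w n := fun n => measurable_of_finite _
  have hr := c.r.measurable_φ
  have hi := fun n => measurable_inp c (𝓢₁ := 𝓢₁) (𝓢₂ := 𝓢₂) (𝓢₃ := 𝓢₃) (n := n)
  have hh := fun n => measurable_hist (n := n) (measurable_obs (𝓢₁ := 𝓢₁) (𝓢₂ := 𝓢₂) (𝓢₃ := 𝓢₃) c
    (u := fun v : (𝓢₁ × 𝓢₃) × 𝓢₂ => ()) (g := fun q => ((ch.out q.1 q.2).1, (ch.out q.1 q.2).2.2))
    (by fun_prop) (by fun_prop))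
  have h := cmi_le_sum_obs ch c (W := Prod.fst) (E := Prod.snd) (by fun_prop)
    (by fun_prop) indepFun_unif (u := fun v : (𝓢₁ × 𝓢₃) × 𝓢₂ => ())
    (g := fun q => ((ch.out q.1 q.2).1,
        (ch.out q.1 q.2).2.2)) (by fun_prop) (by fun_prop) (k := Prod.fst) (by fun_prop) N
  refine h.trans (Finset.sum_le_sum fun n _ => ?_)
  have hhn := hh n
  refine (add_le_add ?_ ?_).trans (zero_add _).le
  · exact (cmi_const_right (by fun_prop) (by fun_prop) _).le
  · exact (cmi_le_cmi_state (μ := ch.procLaw c n ⊗ₘ ch.signal.comap (inp c) (measurable_inp c))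
      (κ := ch.noise)
      (hZ := (measurable_inp c).comp measurable_fst)
      (A := fun x => x.1.1.1) (C := fun x => ((x.1.1.2,
          hist (obs c (fun v : (𝓢₁ × 𝓢₃) × 𝓢₂ => ()) fun q => ((ch.out q.1 q.2).1,
          (ch.out q.1 q.2).2.2)) x.1), ()))
      (C₀ := fun x => ((inp c x.1).2.1, (inp c x.1).2.2, ())) (Z' := fun x => (inp c x.1).1)
      (g := fun q => ((ch.out q.1 q.2).1,
          (ch.out q.1 q.2).2.2)) (by fun_prop) (by fun_prop) (by fun_prop)
      (by fun_prop) (by fun_prop) (f := fun q => (c.e₂ q.1.1 n, (c.r.φ n fun j => (q.1.2 j).2.2),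
          ())) (by fun_prop)
      (fun _ => rfl) (h := fun q => (q.2, q.1.1, q.1.2.1)) (by fun_prop) (fun _ => rfl)).trans
      (cmi_viewLaw ch c n (by fun_prop) (by fun_prop) (by fun_prop)).ge

/-- Without the relay outputs X₃ is not determined by the conditioning, so it joins X₁ on the left.
-/
lemma msgInfo₁_le_given_x₂ (N : ℕ) :
    ch.msgInfo₁ c N ≤
      ∑ n ∈ Finset.range N, terms (ch.viewLaw () (ch.inpLaw c n)) 1 := by
  have he₁ : ∀ n, Measurable fun w => c.e₁ w n := fun n => measurable_of_finite _
  have he₂ : ∀ n, Measurable fun w => c.e₂ w n := fun n => measurable_of_finite _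
  have hr := c.r.measurable_φ
  have hi := fun n => measurable_inp c (𝓢₁ := 𝓢₁) (𝓢₂ := 𝓢₂) (𝓢₃ := 𝓢₃) (n := n)
  have hh := fun n => measurable_hist (n := n) (measurable_obs (𝓢₁ := 𝓢₁) (𝓢₂ := 𝓢₂) (𝓢₃ := 𝓢₃) c
    (u := fun v : (𝓢₁ × 𝓢₃) × 𝓢₂ => ()) (g := fun q => (ch.out q.1 q.2).1)
    (by fun_prop) (by fun_prop))
  have h := cmi_le_sum_obs ch c (W := Prod.fst) (E := Prod.snd) (by fun_prop)
    (by fun_prop) indepFun_unif (u := fun v : (𝓢₁ × 𝓢₃) × 𝓢₂ => ())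
    (g := fun q => (ch.out q.1 q.2).1) (by fun_prop) (by fun_prop) (k := id) (by fun_prop) N
  refine h.trans (Finset.sum_le_sum fun n _ => ?_)
  have hhn := hh n
  refine (add_le_add ?_ ?_).trans (zero_add _).le
  · exact (cmi_const_right (by fun_prop) (by fun_prop) _).le
  · exact (cmi_le_cmi_state (μ := ch.procLaw c n ⊗ₘ ch.signal.comap (inp c) (measurable_inp c))
      (κ := ch.noise)
      (hZ := (measurable_inp c).comp measurable_fst)
      (A := fun x => x.1.1.1) (C := fun x => ((x.1.1.2,
          hist (obs c (fun v : (𝓢₁ × 𝓢₃) × 𝓢₂ => ()) fun q => (ch.out q.1 q.2).1) x.1), ()))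
      (C₀ := fun x => ((inp c x.1).2.1, ())) (Z' := fun x => ((inp c x.1).1, (inp c x.1).2.2))
      (g := fun q => (ch.out q.1 q.2).1) (by fun_prop) (by fun_prop) (by fun_prop)
      (by fun_prop) (by fun_prop) (f := fun q => (c.e₂ q.1.1 n, ())) (by fun_prop)
      (fun _ => rfl) (h := fun q => (q.2.1, q.1.1, q.2.2)) (by fun_prop) (fun _ => rfl)).trans
      (cmi_viewLaw ch c n (by fun_prop) (by fun_prop) (by fun_prop)).ge

/-- The genie supplies W₂ and the copies of S₁; the copies cost `info₁`. With W₂ known there is no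
interference information to gain. -/
lemma msgInfo₁_le_given_v₁x₂ (N : ℕ) :
    ch.msgInfo₁ c N ≤
      ∑ n ∈ Finset.range N, (ch.info₁ c n + terms (ch.viewLaw () (ch.inpLaw c n)) 2) := by
  have he₁ : ∀ n, Measurable fun w => c.e₁ w n := fun n => measurable_of_finite _
  have he₂ : ∀ n, Measurable fun w => c.e₂ w n := fun n => measurable_of_finite _
  have hr := c.r.measurable_φ
  have hi := fun n => measurable_inp c (𝓢₁ := 𝓢₁) (𝓢₂ := 𝓢₂) (𝓢₃ := 𝓢₃) (n := n)
  have hh := fun n => measurable_hist (n := n) (measurable_obs (𝓢₁ := 𝓢₁) (𝓢₂ := 𝓢₂) (𝓢₃ := 𝓢₃) c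
    (u := fun v : (𝓢₁ × 𝓢₃) × 𝓢₂ => v.1.1) (g := fun q => (ch.out q.1 q.2).1)
    (by fun_prop) (by fun_prop))
  have h := cmi_le_sum_obs ch c (W := Prod.fst) (E := Prod.snd) (by fun_prop)
    (by fun_prop) indepFun_unif (u := fun v : (𝓢₁ × 𝓢₃) × 𝓢₂ => v.1.1)
    (g := fun q => (ch.out q.1 q.2).1) (by fun_prop) (by fun_prop) (k := id) (by fun_prop) N
  refine h.trans (Finset.sum_le_sum fun n _ => ?_)
  have hhn := hh n
  refine add_le_add ?_ ?_
  · exact cmi_copy₁_le ch c (B := fun γ => γ.1.1)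
      (C := fun γ => (γ.1.2,
          hist (obs c (fun v : (𝓢₁ × 𝓢₃) × 𝓢₂ => v.1.1) fun q => (ch.out q.1 q.2).1) γ))
      (by fun_prop) (by fun_prop) (f := fun q j => (q.2 j).1) (by fun_prop) (fun _ => rfl)
  · exact (cmi_le_cmi_state (μ := ch.procLaw c n ⊗ₘ ch.signal.comap (inp c) (measurable_inp c))
      (κ := ch.noise)
      (hZ := (measurable_inp c).comp measurable_fst)
      (A := fun x => x.1.1.1) (C := fun x => ((x.1.1.2,
          hist (obs c (fun v : (𝓢₁ × 𝓢₃) × 𝓢₂ => v.1.1) fun q => (ch.out q.1 q.2).1) x.1), x.2.1.1))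
      (C₀ := fun x => (x.2.1.1, (inp c x.1).2.1, ())) (Z' := fun x => ((inp c x.1).1,
          (inp c x.1).2.2))
      (g := fun q => (ch.out q.1 q.2).1) (by fun_prop) (by fun_prop) (by fun_prop)
      (by fun_prop) (by fun_prop) (f := fun q => (q.2, c.e₂ q.1.1 n, ())) (by fun_prop)
      (fun _ => rfl) (h := fun q => (q.2.1, q.1.2.1, q.2.2)) (by fun_prop) (fun _ => rfl)).trans
      (cmi_viewLaw ch c n (by fun_prop) (by fun_prop) (by fun_prop)).ge

/-- W₂ is withheld, so what the past still says about Y₁ after W₁ is known contributes at least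
`info₂`. -/
lemma msgInfo₁_add_le_given_v₁ (N : ℕ) :
    ch.msgInfo₁ c N + ∑ n ∈ Finset.range N, ch.info₂ c n ≤
      ∑ n ∈ Finset.range N, (ch.info₁ c n + terms (ch.viewLaw () (ch.inpLaw c n)) 3) := by
  have he₁ : ∀ n, Measurable fun w => c.e₁ w n := fun n => measurable_of_finite _
  have he₂ : ∀ n, Measurable fun w => c.e₂ w n := fun n => measurable_of_finite _
  have hr := c.r.measurable_φ
  have hi := fun n => measurable_inp c (𝓢₁ := 𝓢₁) (𝓢₂ := 𝓢₂) (𝓢₃ := 𝓢₃) (n := n)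
  have hh := fun n => measurable_hist (n := n) (measurable_obs (𝓢₁ := 𝓢₁) (𝓢₂ := 𝓢₂) (𝓢₃ := 𝓢₃) c
    (u := fun v : (𝓢₁ × 𝓢₃) × 𝓢₂ => v.1.1) (g := fun q => (ch.out q.1 q.2).1)
    (by fun_prop) (by fun_prop))
  have h := cmi_le_sum_obs ch c (W := Prod.fst) (E := fun _ => ()) (by fun_prop)
    (by fun_prop) (indepFun_const_right _ _) (u := fun v : (𝓢₁ × 𝓢₃) × 𝓢₂ => v.1.1)
    (g := fun q => (ch.out q.1 q.2).1) (by fun_prop) (by fun_prop) (k := id) (by fun_prop) N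
  refine (add_le_add_left h _).trans ?_
  rw [← Finset.sum_add_distrib]
  refine Finset.sum_le_sum fun n _ => ?_
  rw [add_assoc]
  have hhn := hh n
  refine add_le_add ?_ ?_
  · exact cmi_copy₁_le ch c (B := fun γ => γ.1.1)
      (C := fun γ => ((), hist (obs c (fun v : (𝓢₁ × 𝓢₃) × 𝓢₂ => v.1.1) fun q => (ch.out q.1
          q.2).1) γ))
      (by fun_prop) (by fun_prop) (f := fun q j => (q.2 j).1) (by fun_prop) (fun _ => rfl)
  · refine (add_le_add_right (info₂_le ch c (u := Prod.fst) (by fun_prop) (g := Prod.fst) (by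
      fun_prop) (k := id)
      (by fun_prop) (fun _ => rfl) n) _).trans ?_
    exact (cmi_add_cmi_le (μ := ch.procLaw c n ⊗ₘ ch.signal.comap (inp c) (measurable_inp c)) (κ :=
        ch.noise)
      (hZ := (measurable_inp c).comp measurable_fst)
      (A := fun x => x.1.1.1) (C := fun x => (((),
          hist (obs c (fun v : (𝓢₁ × 𝓢₃) × 𝓢₂ => v.1.1) fun q => (ch.out q.1 q.2).1) x.1), x.2.1.1))
      (C₀ := fun x => (x.2.1.1, ())) (Z' := fun x => inp c x.1)
      (g := fun q => (ch.out q.1 q.2).1) (by fun_prop) (by fun_prop) (by fun_prop)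
      (by fun_prop) (by fun_prop) (f := fun q => (q.2, ())) (by fun_prop)
      (fun _ => rfl) (h := fun q => q.2) (by fun_prop) (fun _ => rfl)).trans
      (cmi_viewLaw ch c n (by fun_prop) (by fun_prop) (by fun_prop)).ge

lemma msgInfo₁_add_le (N : ℕ) :
    ch.msgInfo₁ c N + ∑ n ∈ Finset.range N, ch.info₂ c n ≤
      ∑ n ∈ Finset.range N, terms (ch.viewLaw () (ch.inpLaw c n)) 4 := by
  have he₁ : ∀ n, Measurable fun w => c.e₁ w n := fun n => measurable_of_finite _
  have he₂ : ∀ n, Measurable fun w => c.e₂ w n := fun n => measurable_of_finite _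
  have hr := c.r.measurable_φ
  have hi := fun n => measurable_inp c (𝓢₁ := 𝓢₁) (𝓢₂ := 𝓢₂) (𝓢₃ := 𝓢₃) (n := n)
  have hh := fun n => measurable_hist (n := n) (measurable_obs (𝓢₁ := 𝓢₁) (𝓢₂ := 𝓢₂) (𝓢₃ := 𝓢₃) c
    (u := fun v : (𝓢₁ × 𝓢₃) × 𝓢₂ => ()) (g := fun q => (ch.out q.1 q.2).1)
    (by fun_prop) (by fun_prop))
  have h := cmi_le_sum_obs ch c (W := Prod.fst) (E := fun _ => ()) (by fun_prop)
    (by fun_prop) (indepFun_const_right _ _) (u := fun v : (𝓢₁ × 𝓢₃) × 𝓢₂ => ())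
    (g := fun q => (ch.out q.1 q.2).1) (by fun_prop) (by fun_prop) (k := id) (by fun_prop) N
  refine (add_le_add_left h _).trans ?_
  rw [← Finset.sum_add_distrib]
  refine Finset.sum_le_sum fun n _ => ?_
  rw [add_assoc]
  have hhn := hh n
  refine (add_le_add ?_ ?_).trans (zero_add _).le
  · exact (cmi_const_right (by fun_prop) (by fun_prop) _).le
  · refine (add_le_add_right (info₂_le ch c (u := fun _ => ()) (by fun_prop) (g := Prod.fst) (by
      fun_prop) (k := id)
      (by fun_prop) (fun _ => rfl) n) _).trans ?_
    exact (cmi_add_cmi_le (μ := ch.procLaw c n ⊗ₘ ch.signal.comap (inp c) (measurable_inp c)) (κ :=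
        ch.noise)
      (hZ := (measurable_inp c).comp measurable_fst)
      (A := fun x => x.1.1.1) (C := fun x => (((),
          hist (obs c (fun v : (𝓢₁ × 𝓢₃) × 𝓢₂ => ()) fun q => (ch.out q.1 q.2).1) x.1), ()))
      (C₀ := fun x => ()) (Z' := fun x => inp c x.1)
      (g := fun q => (ch.out q.1 q.2).1) (by fun_prop) (by fun_prop) (by fun_prop)
      (by fun_prop) (by fun_prop) (f := fun q => ()) (by fun_prop)
      (fun _ => rfl) (h := fun q => q.2) (by fun_prop) (fun _ => rfl)).trans
      (cmi_viewLaw ch c n (by fun_prop) (by fun_prop) (by fun_prop)).ge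

/-- The relay outputs are given, yet only V₁ and not V₃ is supplied; the copy is still charged at
the cost `info₁`. -/
lemma msgInfo₁_le_relay_given_v₁x₂x₃ (N : ℕ) :
    ch.msgInfo₁ c N ≤
      ∑ n ∈ Finset.range N, (ch.info₁ c n + terms (ch.viewLaw () (ch.inpLaw c n)) 5) := by
  have he₁ : ∀ n, Measurable fun w => c.e₁ w n := fun n => measurable_of_finite _
  have he₂ : ∀ n, Measurable fun w => c.e₂ w n := fun n => measurable_of_finite _
  have hr := c.r.measurable_φ
  have hi := fun n => measurable_inp c (𝓢₁ := 𝓢₁) (𝓢₂ := 𝓢₂) (𝓢₃ := 𝓢₃) (n := n)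
  have hh := fun n => measurable_hist (n := n) (measurable_obs (𝓢₁ := 𝓢₁) (𝓢₂ := 𝓢₂) (𝓢₃ := 𝓢₃) c
    (u := fun v : (𝓢₁ × 𝓢₃) × 𝓢₂ => v.1.1) (g := fun q => ((ch.out q.1 q.2).1,
        (ch.out q.1 q.2).2.2))
    (by fun_prop) (by fun_prop))
  have h := cmi_le_sum_obs ch c (W := Prod.fst) (E := Prod.snd) (by fun_prop)
    (by fun_prop) indepFun_unif (u := fun v : (𝓢₁ × 𝓢₃) × 𝓢₂ => v.1.1)
    (g := fun q => ((ch.out q.1 q.2).1,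
        (ch.out q.1 q.2).2.2)) (by fun_prop) (by fun_prop) (k := Prod.fst) (by fun_prop) N
  refine h.trans (Finset.sum_le_sum fun n _ => ?_)
  have hhn := hh n
  refine add_le_add ?_ ?_
  · exact cmi_copy₁_le ch c (B := fun γ => γ.1.1)
      (C := fun γ => (γ.1.2,
          hist (obs c (fun v : (𝓢₁ × 𝓢₃) × 𝓢₂ => v.1.1) fun q => ((ch.out q.1 q.2).1,
          (ch.out q.1 q.2).2.2)) γ))
      (by fun_prop) (by fun_prop) (f := fun q j => (q.2 j).1) (by fun_prop) (fun _ => rfl)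
  · exact (cmi_le_cmi_state (μ := ch.procLaw c n ⊗ₘ ch.signal.comap (inp c) (measurable_inp c))
      (κ := ch.noise)
      (hZ := (measurable_inp c).comp measurable_fst)
      (A := fun x => x.1.1.1) (C := fun x => ((x.1.1.2,
          hist (obs c (fun v : (𝓢₁ × 𝓢₃) × 𝓢₂ => v.1.1) fun q => ((ch.out q.1 q.2).1,
          (ch.out q.1 q.2).2.2)) x.1), x.2.1.1))
      (C₀ := fun x => (x.2.1.1, (inp c x.1).2.1, (inp c x.1).2.2,
          ())) (Z' := fun x => (inp c x.1).1)
      (g := fun q => ((ch.out q.1 q.2).1,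
          (ch.out q.1 q.2).2.2)) (by fun_prop) (by fun_prop) (by fun_prop)
      (by fun_prop) (by fun_prop) (f := fun q => (q.2, c.e₂ q.1.1 n,
          (c.r.φ n fun j => (q.1.2 j).2.2), ())) (by fun_prop)
      (fun _ => rfl) (h := fun q => (q.2, q.1.2.1, q.1.2.2.1)) (by fun_prop) (fun _ => rfl)).trans
      (cmi_viewLaw ch c n (by fun_prop) (by fun_prop) (by fun_prop)).ge

lemma msgInfo₁_add_le_relay_given_v₁x₃ (N : ℕ) :
    ch.msgInfo₁ c N + ∑ n ∈ Finset.range N, ch.info₂ c n ≤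
      ∑ n ∈ Finset.range N, (ch.info₁ c n + terms (ch.viewLaw () (ch.inpLaw c n)) 6) := by
  have he₁ : ∀ n, Measurable fun w => c.e₁ w n := fun n => measurable_of_finite _
  have he₂ : ∀ n, Measurable fun w => c.e₂ w n := fun n => measurable_of_finite _
  have hr := c.r.measurable_φ
  have hi := fun n => measurable_inp c (𝓢₁ := 𝓢₁) (𝓢₂ := 𝓢₂) (𝓢₃ := 𝓢₃) (n := n)
  have hh := fun n => measurable_hist (n := n) (measurable_obs (𝓢₁ := 𝓢₁) (𝓢₂ := 𝓢₂) (𝓢₃ := 𝓢₃) c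
    (u := fun v : (𝓢₁ × 𝓢₃) × 𝓢₂ => v.1.1) (g := fun q => ((ch.out q.1 q.2).1,
        (ch.out q.1 q.2).2.2))
    (by fun_prop) (by fun_prop))
  have h := cmi_le_sum_obs ch c (W := Prod.fst) (E := fun _ => ()) (by fun_prop)
    (by fun_prop) (indepFun_const_right _ _) (u := fun v : (𝓢₁ × 𝓢₃) × 𝓢₂ => v.1.1)
    (g := fun q => ((ch.out q.1 q.2).1,
        (ch.out q.1 q.2).2.2)) (by fun_prop) (by fun_prop) (k := Prod.fst) (by fun_prop) N
  refine (add_le_add_left h _).trans ?_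
  rw [← Finset.sum_add_distrib]
  refine Finset.sum_le_sum fun n _ => ?_
  rw [add_assoc]
  have hhn := hh n
  refine add_le_add ?_ ?_
  · exact cmi_copy₁_le ch c (B := fun γ => γ.1.1)
      (C := fun γ => ((), hist (obs c (fun v : (𝓢₁ × 𝓢₃) × 𝓢₂ => v.1.1) fun q => ((ch.out q.1
          q.2).1, (ch.out q.1 q.2).2.2)) γ))
      (by fun_prop) (by fun_prop) (f := fun q j => (q.2 j).1) (by fun_prop) (fun _ => rfl)
  · refine (add_le_add_right (info₂_le ch c (u := Prod.fst) (by fun_prop) (g := id) (by fun_prop)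
      (k := Prod.fst)
      (by fun_prop) (fun _ => rfl) n) _).trans ?_
    exact (cmi_add_cmi_le (μ := ch.procLaw c n ⊗ₘ ch.signal.comap (inp c) (measurable_inp c)) (κ :=
        ch.noise)
      (hZ := (measurable_inp c).comp measurable_fst)
      (A := fun x => x.1.1.1) (C := fun x => (((),
          hist (obs c (fun v : (𝓢₁ × 𝓢₃) × 𝓢₂ => v.1.1) fun q => ((ch.out q.1 q.2).1,
          (ch.out q.1 q.2).2.2)) x.1), x.2.1.1))
      (C₀ := fun x => (x.2.1.1, (inp c x.1).2.2, ())) (Z' := fun x => ((inp c x.1).1,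
          (inp c x.1).2.1))
      (g := fun q => ((ch.out q.1 q.2).1,
          (ch.out q.1 q.2).2.2)) (by fun_prop) (by fun_prop) (by fun_prop)
      (by fun_prop) (by fun_prop) (f := fun q => (q.2, (c.r.φ n fun j => (q.1.2 j).2.2),
          ())) (by fun_prop)
      (fun _ => rfl) (h := fun q => (q.2.1, q.2.2, q.1.2.1)) (by fun_prop) (fun _ => rfl)).trans
      (cmi_viewLaw ch c n (by fun_prop) (by fun_prop) (by fun_prop)).ge

lemma msgInfo₁_add_le_relay_given_x₃ (N : ℕ) :
    ch.msgInfo₁ c N + ∑ n ∈ Finset.range N, ch.info₂ c n ≤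
      ∑ n ∈ Finset.range N, terms (ch.viewLaw () (ch.inpLaw c n)) 7 := by
  have he₁ : ∀ n, Measurable fun w => c.e₁ w n := fun n => measurable_of_finite _
  have he₂ : ∀ n, Measurable fun w => c.e₂ w n := fun n => measurable_of_finite _
  have hr := c.r.measurable_φ
  have hi := fun n => measurable_inp c (𝓢₁ := 𝓢₁) (𝓢₂ := 𝓢₂) (𝓢₃ := 𝓢₃) (n := n)
  have hh := fun n => measurable_hist (n := n) (measurable_obs (𝓢₁ := 𝓢₁) (𝓢₂ := 𝓢₂) (𝓢₃ := 𝓢₃) c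
    (u := fun v : (𝓢₁ × 𝓢₃) × 𝓢₂ => ()) (g := fun q => ((ch.out q.1 q.2).1, (ch.out q.1 q.2).2.2))
    (by fun_prop) (by fun_prop))
  have h := cmi_le_sum_obs ch c (W := Prod.fst) (E := fun _ => ()) (by fun_prop)
    (by fun_prop) (indepFun_const_right _ _) (u := fun v : (𝓢₁ × 𝓢₃) × 𝓢₂ => ())
    (g := fun q => ((ch.out q.1 q.2).1,
        (ch.out q.1 q.2).2.2)) (by fun_prop) (by fun_prop) (k := Prod.fst) (by fun_prop) N
  refine (add_le_add_left h _).trans ?_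
  rw [← Finset.sum_add_distrib]
  refine Finset.sum_le_sum fun n _ => ?_
  rw [add_assoc]
  have hhn := hh n
  refine (add_le_add ?_ ?_).trans (zero_add _).le
  · exact (cmi_const_right (by fun_prop) (by fun_prop) _).le
  · refine (add_le_add_right (info₂_le ch c (u := fun _ => ()) (by fun_prop) (g := id) (by
      fun_prop) (k := Prod.fst)
      (by fun_prop) (fun _ => rfl) n) _).trans ?_
    exact (cmi_add_cmi_le (μ := ch.procLaw c n ⊗ₘ ch.signal.comap (inp c) (measurable_inp c)) (κ :=
        ch.noise)
      (hZ := (measurable_inp c).comp measurable_fst)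
      (A := fun x => x.1.1.1) (C := fun x => (((),
          hist (obs c (fun v : (𝓢₁ × 𝓢₃) × 𝓢₂ => ()) fun q => ((ch.out q.1 q.2).1,
          (ch.out q.1 q.2).2.2)) x.1), ()))
      (C₀ := fun x => ((inp c x.1).2.2, ())) (Z' := fun x => ((inp c x.1).1, (inp c x.1).2.1))
      (g := fun q => ((ch.out q.1 q.2).1,
          (ch.out q.1 q.2).2.2)) (by fun_prop) (by fun_prop) (by fun_prop)
      (by fun_prop) (by fun_prop) (f := fun q => ((c.r.φ n fun j => (q.1.2 j).2.2),
          ())) (by fun_prop)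
      (fun _ => rfl) (h := fun q => (q.2.1, q.2.2, q.1.1)) (by fun_prop) (fun _ => rfl)).trans
      (cmi_viewLaw ch c n (by fun_prop) (by fun_prop) (by fun_prop)).ge

/-- The full vector copy costs `info₁₃`, which is finite and matches the gain of destination 2 when
it has the relay outputs. -/
lemma msgInfo₁_le_relay_given_v₁v₃x₂x₃ (N : ℕ) :
    ch.msgInfo₁ c N ≤
      ∑ n ∈ Finset.range N, (ch.info₁₃ c n + terms (ch.viewLaw () (ch.inpLaw c n)) 8) := by
  have he₁ : ∀ n, Measurable fun w => c.e₁ w n := fun n => measurable_of_finite _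
  have he₂ : ∀ n, Measurable fun w => c.e₂ w n := fun n => measurable_of_finite _
  have hr := c.r.measurable_φ
  have hi := fun n => measurable_inp c (𝓢₁ := 𝓢₁) (𝓢₂ := 𝓢₂) (𝓢₃ := 𝓢₃) (n := n)
  have hh := fun n => measurable_hist (n := n) (measurable_obs (𝓢₁ := 𝓢₁) (𝓢₂ := 𝓢₂) (𝓢₃ := 𝓢₃) c
    (u := fun v : (𝓢₁ × 𝓢₃) × 𝓢₂ => v.1) (g := fun q => ((ch.out q.1 q.2).1, (ch.out q.1 q.2).2.2))
    (by fun_prop) (by fun_prop))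
  have h := cmi_le_sum_obs ch c (W := Prod.fst) (E := Prod.snd) (by fun_prop)
    (by fun_prop) indepFun_unif (u := fun v : (𝓢₁ × 𝓢₃) × 𝓢₂ => v.1)
    (g := fun q => ((ch.out q.1 q.2).1,
        (ch.out q.1 q.2).2.2)) (by fun_prop) (by fun_prop) (k := Prod.fst) (by fun_prop) N
  refine h.trans (Finset.sum_le_sum fun n _ => ?_)
  have hhn := hh n
  refine add_le_add ?_ ?_
  · exact cmi_copy₁₃_le ch c (B := fun γ => γ.1.1)
      (C := fun γ => (γ.1.2,
          hist (obs c (fun v : (𝓢₁ × 𝓢₃) × 𝓢₂ => v.1) fun q => ((ch.out q.1 q.2).1,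
          (ch.out q.1 q.2).2.2)) γ))
      (by fun_prop) (by fun_prop) (f := fun q j => ((q.2 j).1.1,
          (q.2 j).2.2)) (by fun_prop) (fun _ => rfl)
  · exact (cmi_le_cmi_state (μ := ch.procLaw c n ⊗ₘ ch.signal.comap (inp c) (measurable_inp c))
      (κ := ch.noise)
      (hZ := (measurable_inp c).comp measurable_fst)
      (A := fun x => x.1.1.1) (C := fun x => ((x.1.1.2,
          hist (obs c (fun v : (𝓢₁ × 𝓢₃) × 𝓢₂ => v.1) fun q => ((ch.out q.1 q.2).1,
          (ch.out q.1 q.2).2.2)) x.1), x.2.1))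
      (C₀ := fun x => (x.2.1, (inp c x.1).2.1, (inp c x.1).2.2, ())) (Z' := fun x => (inp c x.1).1)
      (g := fun q => ((ch.out q.1 q.2).1,
          (ch.out q.1 q.2).2.2)) (by fun_prop) (by fun_prop) (by fun_prop)
      (by fun_prop) (by fun_prop) (f := fun q => (q.2, c.e₂ q.1.1 n,
          (c.r.φ n fun j => (q.1.2 j).2.2), ())) (by fun_prop)
      (fun _ => rfl) (h := fun q => (q.2, q.1.2.1, q.1.2.2.1)) (by fun_prop) (fun _ => rfl)).trans
      (cmi_viewLaw ch c n (by fun_prop) (by fun_prop) (by fun_prop)).ge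

lemma msgInfo₁_add_le_relay_given_v₁v₃x₃ (N : ℕ) :
    ch.msgInfo₁ c N + ∑ n ∈ Finset.range N, ch.info₂ c n ≤
      ∑ n ∈ Finset.range N, (ch.info₁₃ c n + terms (ch.viewLaw () (ch.inpLaw c n)) 9) := by
  have he₁ : ∀ n, Measurable fun w => c.e₁ w n := fun n => measurable_of_finite _
  have he₂ : ∀ n, Measurable fun w => c.e₂ w n := fun n => measurable_of_finite _
  have hr := c.r.measurable_φ
  have hi := fun n => measurable_inp c (𝓢₁ := 𝓢₁) (𝓢₂ := 𝓢₂) (𝓢₃ := 𝓢₃) (n := n)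
  have hh := fun n => measurable_hist (n := n) (measurable_obs (𝓢₁ := 𝓢₁) (𝓢₂ := 𝓢₂) (𝓢₃ := 𝓢₃) c
    (u := fun v : (𝓢₁ × 𝓢₃) × 𝓢₂ => v.1) (g := fun q => ((ch.out q.1 q.2).1, (ch.out q.1 q.2).2.2))
    (by fun_prop) (by fun_prop))
  have h := cmi_le_sum_obs ch c (W := Prod.fst) (E := fun _ => ()) (by fun_prop)
    (by fun_prop) (indepFun_const_right _ _) (u := fun v : (𝓢₁ × 𝓢₃) × 𝓢₂ => v.1)
    (g := fun q => ((ch.out q.1 q.2).1,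
        (ch.out q.1 q.2).2.2)) (by fun_prop) (by fun_prop) (k := Prod.fst) (by fun_prop) N
  refine (add_le_add_left h _).trans ?_
  rw [← Finset.sum_add_distrib]
  refine Finset.sum_le_sum fun n _ => ?_
  rw [add_assoc]
  have hhn := hh n
  refine add_le_add ?_ ?_
  · exact cmi_copy₁₃_le ch c (B := fun γ => γ.1.1)
      (C := fun γ => ((), hist (obs c (fun v : (𝓢₁ × 𝓢₃) × 𝓢₂ => v.1) fun q => ((ch.out q.1 q.2).1,
          (ch.out q.1 q.2).2.2)) γ))
      (by fun_prop) (by fun_prop) (f := fun q j => ((q.2 j).1.1,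
          (q.2 j).2.2)) (by fun_prop) (fun _ => rfl)
  · refine (add_le_add_right (info₂_le ch c (u := id) (by fun_prop) (g := id) (by fun_prop) (k :=
      Prod.fst)
      (by fun_prop) (fun _ => rfl) n) _).trans ?_
    exact (cmi_add_cmi_le (μ := ch.procLaw c n ⊗ₘ ch.signal.comap (inp c) (measurable_inp c)) (κ :=
        ch.noise)
      (hZ := (measurable_inp c).comp measurable_fst)
      (A := fun x => x.1.1.1) (C := fun x => (((),
          hist (obs c (fun v : (𝓢₁ × 𝓢₃) × 𝓢₂ => v.1) fun q => ((ch.out q.1 q.2).1,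
          (ch.out q.1 q.2).2.2)) x.1), x.2.1))
      (C₀ := fun x => (x.2.1, (inp c x.1).2.2, ())) (Z' := fun x => ((inp c x.1).1,
          (inp c x.1).2.1))
      (g := fun q => ((ch.out q.1 q.2).1,
          (ch.out q.1 q.2).2.2)) (by fun_prop) (by fun_prop) (by fun_prop)
      (by fun_prop) (by fun_prop) (f := fun q => (q.2, (c.r.φ n fun j => (q.1.2 j).2.2),
          ())) (by fun_prop)
      (fun _ => rfl) (h := fun q => (q.2.1, q.2.2, q.1.2.1)) (by fun_prop) (fun _ => rfl)).trans
      (cmi_viewLaw ch c n (by fun_prop) (by fun_prop) (by fun_prop)).ge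

/-- Y₃ is given to destination 2 only so that X₃ can be computed from the history. The current Y₃ is
then dropped, since it is pure noise given X₁ and X₃. -/
lemma msgInfo₂_le_given_x₁x₃ (N : ℕ) :
    ch.msgInfo₂ c N ≤
      ∑ n ∈ Finset.range N, terms (ch.viewLaw () (ch.inpLaw c n)) 10 := by
  have he₁ : ∀ n, Measurable fun w => c.e₁ w n := fun n => measurable_of_finite _
  have he₂ : ∀ n, Measurable fun w => c.e₂ w n := fun n => measurable_of_finite _
  have hr := c.r.measurable_φ
  have hi := fun n => measurable_inp c (𝓢₁ := 𝓢₁) (𝓢₂ := 𝓢₂) (𝓢₃ := 𝓢₃) (n := n)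
  have hh := fun n => measurable_hist (n := n) (measurable_obs (𝓢₁ := 𝓢₁) (𝓢₂ := 𝓢₂) (𝓢₃ := 𝓢₃) c
    (u := fun v : (𝓢₁ × 𝓢₃) × 𝓢₂ => ()) (g := fun q => ((ch.out q.1 q.2).2.1, (ch.out q.1 q.2).2.2))
    (by fun_prop) (by fun_prop))
  have h := cmi_le_sum_obs ch c (W := Prod.snd) (E := Prod.fst) (by fun_prop)
    (by fun_prop) indepFun_unif.symm (u := fun v : (𝓢₁ × 𝓢₃) × 𝓢₂ => ())
    (g := fun q => ((ch.out q.1 q.2).2.1,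
        (ch.out q.1 q.2).2.2)) (by fun_prop) (by fun_prop) (k := Prod.fst) (by fun_prop) N
  refine h.trans (Finset.sum_le_sum fun n _ => ?_)
  have hhn := hh n
  refine (add_le_add ?_ ?_).trans (zero_add _).le
  · exact (cmi_const_right (by fun_prop) (by fun_prop) _).le
  · refine (cmi_drop_relay ch c (A := fun x => x.1.1.2)
      (C := fun x => ((x.1.1.1,
          hist (obs c (fun v : (𝓢₁ × 𝓢₃) × 𝓢₂ => ()) fun q => ((ch.out q.1 q.2).2.1,
          (ch.out q.1 q.2).2.2)) x.1), ()))
      (by fun_prop) (by fun_prop) (f := fun q => (c.e₁ q.1.1 n,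
          c.r.φ n fun j => (q.1.2 j).2.2)) (by fun_prop)
      (fun _ => rfl)).trans ?_
    exact (cmi_le_cmi_state (μ := ch.procLaw c n ⊗ₘ ch.signal.comap (inp c) (measurable_inp c))
      (κ := ch.noise)
      (hZ := (measurable_inp c).comp measurable_fst)
      (A := fun x => x.1.1.2) (C := fun x => ((x.1.1.1,
          hist (obs c (fun v : (𝓢₁ × 𝓢₃) × 𝓢₂ => ()) fun q => ((ch.out q.1 q.2).2.1,
          (ch.out q.1 q.2).2.2)) x.1), ()))
      (C₀ := fun x => ((inp c x.1).1, (inp c x.1).2.2, ())) (Z' := fun x => (inp c x.1).2.1)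
      (g := fun q => (ch.out q.1 q.2).2.1) (by fun_prop) (by fun_prop) (by fun_prop)
      (by fun_prop) (by fun_prop) (f := fun q => (c.e₁ q.1.1 n, (c.r.φ n fun j => (q.1.2 j).2.2),
          ())) (by fun_prop)
      (fun _ => rfl) (h := fun q => (q.1.1, q.2, q.1.2.1)) (by fun_prop) (fun _ => rfl)).trans
      (cmi_viewLaw ch c n (by fun_prop) (by fun_prop) (by fun_prop)).ge

/-- Neither copies nor relay outputs are supplied, so there is no copy cost and the gain is the
possibly infinite `info₁`. -/
lemma msgInfo₂_add_le (N : ℕ) :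
    ch.msgInfo₂ c N + ∑ n ∈ Finset.range N, ch.info₁ c n ≤
      ∑ n ∈ Finset.range N, terms (ch.viewLaw () (ch.inpLaw c n)) 11 := by
  have he₁ : ∀ n, Measurable fun w => c.e₁ w n := fun n => measurable_of_finite _
  have he₂ : ∀ n, Measurable fun w => c.e₂ w n := fun n => measurable_of_finite _
  have hr := c.r.measurable_φ
  have hi := fun n => measurable_inp c (𝓢₁ := 𝓢₁) (𝓢₂ := 𝓢₂) (𝓢₃ := 𝓢₃) (n := n)
  have hh := fun n => measurable_hist (n := n) (measurable_obs (𝓢₁ := 𝓢₁) (𝓢₂ := 𝓢₂) (𝓢₃ := 𝓢₃) c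
    (u := fun v : (𝓢₁ × 𝓢₃) × 𝓢₂ => ()) (g := fun q => (ch.out q.1 q.2).2.1)
    (by fun_prop) (by fun_prop))
  have h := cmi_le_sum_obs ch c (W := Prod.snd) (E := fun _ => ()) (by fun_prop)
    (by fun_prop) (indepFun_const_right _ _) (u := fun v : (𝓢₁ × 𝓢₃) × 𝓢₂ => ())
    (g := fun q => (ch.out q.1 q.2).2.1) (by fun_prop) (by fun_prop) (k := id) (by fun_prop) N
  refine (add_le_add_left h _).trans ?_
  rw [← Finset.sum_add_distrib]
  refine Finset.sum_le_sum fun n _ => ?_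
  rw [add_assoc]
  have hhn := hh n
  refine (add_le_add ?_ ?_).trans (zero_add _).le
  · exact (cmi_const_right (by fun_prop) (by fun_prop) _).le
  · refine (add_le_add_right (info₁_le ch c (u := fun _ => ()) (by fun_prop) n) _).trans ?_
    exact (cmi_add_cmi_le (μ := ch.procLaw c n ⊗ₘ ch.signal.comap (inp c) (measurable_inp c)) (κ :=
        ch.noise)
      (hZ := (measurable_inp c).comp measurable_fst)
      (A := fun x => x.1.1.2) (C := fun x => (((),
          hist (obs c (fun v : (𝓢₁ × 𝓢₃) × 𝓢₂ => ()) fun q => (ch.out q.1 q.2).2.1) x.1), ()))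
      (C₀ := fun x => ()) (Z' := fun x => inp c x.1)
      (g := fun q => (ch.out q.1 q.2).2.1) (by fun_prop) (by fun_prop) (by fun_prop)
      (by fun_prop) (by fun_prop) (f := fun q => ()) (by fun_prop)
      (fun _ => rfl) (h := fun q => q.2) (by fun_prop) (fun _ => rfl)).trans
      (cmi_viewLaw ch c n (by fun_prop) (by fun_prop) (by fun_prop)).ge

lemma msgInfo₂_add_le_given_v₂ (N : ℕ) :
    ch.msgInfo₂ c N + ∑ n ∈ Finset.range N, ch.info₁ c n ≤
      ∑ n ∈ Finset.range N, (ch.info₂ c n + terms (ch.viewLaw () (ch.inpLaw c n)) 12) := by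
  have he₁ : ∀ n, Measurable fun w => c.e₁ w n := fun n => measurable_of_finite _
  have he₂ : ∀ n, Measurable fun w => c.e₂ w n := fun n => measurable_of_finite _
  have hr := c.r.measurable_φ
  have hi := fun n => measurable_inp c (𝓢₁ := 𝓢₁) (𝓢₂ := 𝓢₂) (𝓢₃ := 𝓢₃) (n := n)
  have hh := fun n => measurable_hist (n := n) (measurable_obs (𝓢₁ := 𝓢₁) (𝓢₂ := 𝓢₂) (𝓢₃ := 𝓢₃) c
    (u := fun v : (𝓢₁ × 𝓢₃) × 𝓢₂ => v.2) (g := fun q => (ch.out q.1 q.2).2.1)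
    (by fun_prop) (by fun_prop))
  have h := cmi_le_sum_obs ch c (W := Prod.snd) (E := fun _ => ()) (by fun_prop)
    (by fun_prop) (indepFun_const_right _ _) (u := fun v : (𝓢₁ × 𝓢₃) × 𝓢₂ => v.2)
    (g := fun q => (ch.out q.1 q.2).2.1) (by fun_prop) (by fun_prop) (k := id) (by fun_prop) N
  refine (add_le_add_left h _).trans ?_
  rw [← Finset.sum_add_distrib]
  refine Finset.sum_le_sum fun n _ => ?_
  rw [add_assoc]
  have hhn := hh n
  refine add_le_add ?_ ?_
  · exact cmi_copy₂_le ch c (B := fun γ => γ.1.2)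
      (C := fun γ => ((), hist (obs c (fun v : (𝓢₁ × 𝓢₃) × 𝓢₂ => v.2) fun q => (ch.out q.1
          q.2).2.1) γ))
      (by fun_prop) (by fun_prop) (f := fun q j => (q.2 j).1) (by fun_prop) (fun _ => rfl)
  · refine (add_le_add_right (info₁_le ch c (u := id) (by fun_prop) n) _).trans ?_
    exact (cmi_add_cmi_le (μ := ch.procLaw c n ⊗ₘ ch.signal.comap (inp c) (measurable_inp c)) (κ :=
        ch.noise)
      (hZ := (measurable_inp c).comp measurable_fst)
      (A := fun x => x.1.1.2) (C := fun x => (((),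
          hist (obs c (fun v : (𝓢₁ × 𝓢₃) × 𝓢₂ => v.2) fun q => (ch.out q.1 q.2).2.1) x.1), x.2.2))
      (C₀ := fun x => (x.2.2, ())) (Z' := fun x => inp c x.1)
      (g := fun q => (ch.out q.1 q.2).2.1) (by fun_prop) (by fun_prop) (by fun_prop)
      (by fun_prop) (by fun_prop) (f := fun q => (q.2, ())) (by fun_prop)
      (fun _ => rfl) (h := fun q => q.2) (by fun_prop) (fun _ => rfl)).trans
      (cmi_viewLaw ch c n (by fun_prop) (by fun_prop) (by fun_prop)).ge

/-- W₁ and the copies of S₂ are supplied at the cost `info₂`, and the auxiliary Y₃ is again dropped.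
-/
lemma msgInfo₂_le_given_x₁v₂x₃ (N : ℕ) :
    ch.msgInfo₂ c N ≤
      ∑ n ∈ Finset.range N, (ch.info₂ c n + terms (ch.viewLaw () (ch.inpLaw c n)) 13) := by
  have he₁ : ∀ n, Measurable fun w => c.e₁ w n := fun n => measurable_of_finite _
  have he₂ : ∀ n, Measurable fun w => c.e₂ w n := fun n => measurable_of_finite _
  have hr := c.r.measurable_φ
  have hi := fun n => measurable_inp c (𝓢₁ := 𝓢₁) (𝓢₂ := 𝓢₂) (𝓢₃ := 𝓢₃) (n := n)
  have hh := fun n => measurable_hist (n := n) (measurable_obs (𝓢₁ := 𝓢₁) (𝓢₂ := 𝓢₂) (𝓢₃ := 𝓢₃) c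
    (u := fun v : (𝓢₁ × 𝓢₃) × 𝓢₂ => v.2) (g := fun q => ((ch.out q.1 q.2).2.1,
        (ch.out q.1 q.2).2.2))
    (by fun_prop) (by fun_prop))
  have h := cmi_le_sum_obs ch c (W := Prod.snd) (E := Prod.fst) (by fun_prop)
    (by fun_prop) indepFun_unif.symm (u := fun v : (𝓢₁ × 𝓢₃) × 𝓢₂ => v.2)
    (g := fun q => ((ch.out q.1 q.2).2.1,
        (ch.out q.1 q.2).2.2)) (by fun_prop) (by fun_prop) (k := Prod.fst) (by fun_prop) N
  refine h.trans (Finset.sum_le_sum fun n _ => ?_)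
  have hhn := hh n
  refine add_le_add ?_ ?_
  · exact cmi_copy₂_le ch c (B := fun γ => γ.1.2)
      (C := fun γ => (γ.1.1,
          hist (obs c (fun v : (𝓢₁ × 𝓢₃) × 𝓢₂ => v.2) fun q => ((ch.out q.1 q.2).2.1,
          (ch.out q.1 q.2).2.2)) γ))
      (by fun_prop) (by fun_prop) (f := fun q j => (q.2 j).1) (by fun_prop) (fun _ => rfl)
  · refine (cmi_drop_relay ch c (A := fun x => x.1.1.2)
      (C := fun x => ((x.1.1.1,
          hist (obs c (fun v : (𝓢₁ × 𝓢₃) × 𝓢₂ => v.2) fun q => ((ch.out q.1 q.2).2.1,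
          (ch.out q.1 q.2).2.2)) x.1), x.2.2))
      (by fun_prop) (by fun_prop) (f := fun q => (c.e₁ q.1.1 n,
          c.r.φ n fun j => (q.1.2 j).2.2)) (by fun_prop)
      (fun _ => rfl)).trans ?_
    exact (cmi_le_cmi_state (μ := ch.procLaw c n ⊗ₘ ch.signal.comap (inp c) (measurable_inp c))
      (κ := ch.noise)
      (hZ := (measurable_inp c).comp measurable_fst)
      (A := fun x => x.1.1.2) (C := fun x => ((x.1.1.1,
          hist (obs c (fun v : (𝓢₁ × 𝓢₃) × 𝓢₂ => v.2) fun q => ((ch.out q.1 q.2).2.1,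
          (ch.out q.1 q.2).2.2)) x.1), x.2.2))
      (C₀ := fun x => ((inp c x.1).1, x.2.2, (inp c x.1).2.2, ())) (Z' := fun x => (inp c x.1).2.1)
      (g := fun q => (ch.out q.1 q.2).2.1) (by fun_prop) (by fun_prop) (by fun_prop)
      (by fun_prop) (by fun_prop) (f := fun q => (c.e₁ q.1.1 n, q.2,
          (c.r.φ n fun j => (q.1.2 j).2.2), ())) (by fun_prop)
      (fun _ => rfl) (h := fun q => (q.1.1, q.2, q.1.2.2.1)) (by fun_prop) (fun _ => rfl)).trans
      (cmi_viewLaw ch c n (by fun_prop) (by fun_prop) (by fun_prop)).ge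

/-- Destination 2 keeps the relay outputs, so past Y₃ fixes X₃ and the gain is `info₁₃`. -/
lemma msgInfo₂_add_le_relay_given_x₃ (N : ℕ) :
    ch.msgInfo₂ c N + ∑ n ∈ Finset.range N, ch.info₁₃ c n ≤
      ∑ n ∈ Finset.range N, terms (ch.viewLaw () (ch.inpLaw c n)) 14 := by
  have he₁ : ∀ n, Measurable fun w => c.e₁ w n := fun n => measurable_of_finite _
  have he₂ : ∀ n, Measurable fun w => c.e₂ w n := fun n => measurable_of_finite _
  have hr := c.r.measurable_φ
  have hi := fun n => measurable_inp c (𝓢₁ := 𝓢₁) (𝓢₂ := 𝓢₂) (𝓢₃ := 𝓢₃) (n := n)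
  have hh := fun n => measurable_hist (n := n) (measurable_obs (𝓢₁ := 𝓢₁) (𝓢₂ := 𝓢₂) (𝓢₃ := 𝓢₃) c
    (u := fun v : (𝓢₁ × 𝓢₃) × 𝓢₂ => ()) (g := fun q => ((ch.out q.1 q.2).2.1, (ch.out q.1 q.2).2.2))
    (by fun_prop) (by fun_prop))
  have h := cmi_le_sum_obs ch c (W := Prod.snd) (E := fun _ => ()) (by fun_prop)
    (by fun_prop) (indepFun_const_right _ _) (u := fun v : (𝓢₁ × 𝓢₃) × 𝓢₂ => ())
    (g := fun q => ((ch.out q.1 q.2).2.1,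
        (ch.out q.1 q.2).2.2)) (by fun_prop) (by fun_prop) (k := Prod.fst) (by fun_prop) N
  refine (add_le_add_left h _).trans ?_
  rw [← Finset.sum_add_distrib]
  refine Finset.sum_le_sum fun n _ => ?_
  rw [add_assoc]
  have hhn := hh n
  refine (add_le_add ?_ ?_).trans (zero_add _).le
  · exact (cmi_const_right (by fun_prop) (by fun_prop) _).le
  · refine (add_le_add_right (info₁₃_le ch c (u := fun _ => ()) (by fun_prop) n) _).trans ?_
    exact (cmi_add_cmi_le (μ := ch.procLaw c n ⊗ₘ ch.signal.comap (inp c) (measurable_inp c)) (κ :=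
        ch.noise)
      (hZ := (measurable_inp c).comp measurable_fst)
      (A := fun x => x.1.1.2) (C := fun x => (((),
          hist (obs c (fun v : (𝓢₁ × 𝓢₃) × 𝓢₂ => ()) fun q => ((ch.out q.1 q.2).2.1,
          (ch.out q.1 q.2).2.2)) x.1), ()))
      (C₀ := fun x => ((inp c x.1).2.2, ())) (Z' := fun x => ((inp c x.1).1, (inp c x.1).2.1))
      (g := fun q => ((ch.out q.1 q.2).2.1,
          (ch.out q.1 q.2).2.2)) (by fun_prop) (by fun_prop) (by fun_prop)
      (by fun_prop) (by fun_prop) (f := fun q => ((c.r.φ n fun j => (q.1.2 j).2.2),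
          ())) (by fun_prop)
      (fun _ => rfl) (h := fun q => (q.2.1, q.2.2, q.1.1)) (by fun_prop) (fun _ => rfl)).trans
      (cmi_viewLaw ch c n (by fun_prop) (by fun_prop) (by fun_prop)).ge

lemma msgInfo₂_add_le_relay_given_v₂x₃ (N : ℕ) :
    ch.msgInfo₂ c N + ∑ n ∈ Finset.range N, ch.info₁₃ c n ≤
      ∑ n ∈ Finset.range N, (ch.info₂ c n + terms (ch.viewLaw () (ch.inpLaw c n)) 15) := by
  have he₁ : ∀ n, Measurable fun w => c.e₁ w n := fun n => measurable_of_finite _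
  have he₂ : ∀ n, Measurable fun w => c.e₂ w n := fun n => measurable_of_finite _
  have hr := c.r.measurable_φ
  have hi := fun n => measurable_inp c (𝓢₁ := 𝓢₁) (𝓢₂ := 𝓢₂) (𝓢₃ := 𝓢₃) (n := n)
  have hh := fun n => measurable_hist (n := n) (measurable_obs (𝓢₁ := 𝓢₁) (𝓢₂ := 𝓢₂) (𝓢₃ := 𝓢₃) c
    (u := fun v : (𝓢₁ × 𝓢₃) × 𝓢₂ => v.2) (g := fun q => ((ch.out q.1 q.2).2.1,
        (ch.out q.1 q.2).2.2))
    (by fun_prop) (by fun_prop))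
  have h := cmi_le_sum_obs ch c (W := Prod.snd) (E := fun _ => ()) (by fun_prop)
    (by fun_prop) (indepFun_const_right _ _) (u := fun v : (𝓢₁ × 𝓢₃) × 𝓢₂ => v.2)
    (g := fun q => ((ch.out q.1 q.2).2.1,
        (ch.out q.1 q.2).2.2)) (by fun_prop) (by fun_prop) (k := Prod.fst) (by fun_prop) N
  refine (add_le_add_left h _).trans ?_
  rw [← Finset.sum_add_distrib]
  refine Finset.sum_le_sum fun n _ => ?_
  rw [add_assoc]
  have hhn := hh n
  refine add_le_add ?_ ?_
  · exact cmi_copy₂_le ch c (B := fun γ => γ.1.2)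
      (C := fun γ => ((), hist (obs c (fun v : (𝓢₁ × 𝓢₃) × 𝓢₂ => v.2) fun q => ((ch.out q.1
          q.2).2.1, (ch.out q.1 q.2).2.2)) γ))
      (by fun_prop) (by fun_prop) (f := fun q j => (q.2 j).1) (by fun_prop) (fun _ => rfl)
  · refine (add_le_add_right (info₁₃_le ch c (u := id) (by fun_prop) n) _).trans ?_
    exact (cmi_add_cmi_le (μ := ch.procLaw c n ⊗ₘ ch.signal.comap (inp c) (measurable_inp c)) (κ :=
        ch.noise)
      (hZ := (measurable_inp c).comp measurable_fst)
      (A := fun x => x.1.1.2) (C := fun x => (((),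
          hist (obs c (fun v : (𝓢₁ × 𝓢₃) × 𝓢₂ => v.2) fun q => ((ch.out q.1 q.2).2.1,
          (ch.out q.1 q.2).2.2)) x.1), x.2.2))
      (C₀ := fun x => (x.2.2, (inp c x.1).2.2, ())) (Z' := fun x => ((inp c x.1).1,
          (inp c x.1).2.1))
      (g := fun q => ((ch.out q.1 q.2).2.1,
          (ch.out q.1 q.2).2.2)) (by fun_prop) (by fun_prop) (by fun_prop)
      (by fun_prop) (by fun_prop) (f := fun q => (q.2, (c.r.φ n fun j => (q.1.2 j).2.2),
          ())) (by fun_prop)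
      (fun _ => rfl) (h := fun q => (q.2.1, q.2.2, q.1.2.1)) (by fun_prop) (fun _ => rfl)).trans
      (cmi_viewLaw ch c n (by fun_prop) (by fun_prop) (by fun_prop)).ge

end ISIRC


namespace ISIRC

variable {𝓧₁ 𝓧₂ 𝓧₃ 𝓢₁ 𝓢₂ 𝓢₃ 𝓨₁ 𝓨₂ 𝓨₃ : Type*} [MeasurableSpace 𝓧₁] [MeasurableSpace 𝓧₂]
  [MeasurableSpace 𝓧₃] [MeasurableSpace 𝓢₁] [MeasurableSpace 𝓢₂] [MeasurableSpace 𝓢₃]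
  [MeasurableSpace 𝓨₁] [MeasurableSpace 𝓨₂] [MeasurableSpace 𝓨₃]
  [StandardBorelSpace 𝓧₁] [StandardBorelSpace 𝓧₂] [StandardBorelSpace 𝓧₃]
  [StandardBorelSpace 𝓢₁] [StandardBorelSpace 𝓢₂] [StandardBorelSpace 𝓢₃]
  [StandardBorelSpace 𝓨₁] [StandardBorelSpace 𝓨₂] [StandardBorelSpace 𝓨₃]
  [Nonempty 𝓧₁] [Nonempty 𝓧₂] [Nonempty 𝓧₃] [Nonempty 𝓢₁] [Nonempty 𝓢₂] [Nonempty 𝓢₃]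
  [Nonempty 𝓨₁] [Nonempty 𝓨₂] [Nonempty 𝓨₃]
  {M₁ M₂ : ℕ} (ch : ISIRC 𝓧₁ 𝓧₂ 𝓧₃ 𝓢₁ 𝓢₂ 𝓢₃ 𝓨₁ 𝓨₂ 𝓨₃) (c : Scheme 𝓧₁ 𝓧₂ 𝓧₃ 𝓨₃ M₁ M₂)
  [NeZero M₁] [NeZero M₂]

/-! ### Combination of the inequalities -/

/-- Adding two inequalities with p on opposite sides and cancelling it, which in [0, ∞] requires p
to be finite. -/
lemma add_add_le_of_le {x y p q r s t : ℝ≥0∞} (hp : p ≠ ⊤) (h₁ : x + p ≤ q + s)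
    (h₂ : y + r ≤ p + t) : x + y + r ≤ q + (s + t) := by
  refine ENNReal.le_of_add_le_add_left hp ?_
  calc p + (x + y + r) = (x + p) + (y + r) := by ring
    _ ≤ (q + s) + (p + t) := add_le_add h₁ h₂
    _ = p + (q + (s + t)) := by ring

/-- The twenty bounds follow from the sixteen inequalities. -/
lemma bounds_of_le {x y : ℝ} (hx0 : 0 ≤ x) (hy0 : 0 ≤ y) {i j a A A' : ℝ≥0∞} {t : Fin 16 → ℝ≥0∞}
    (hx : ENNReal.ofReal x ≤ i) (hy : ENNReal.ofReal y ≤ j) (ha : a ≠ ⊤) (hA' : A' ≠ ⊤)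
    (l₀ : i ≤ t 0) (l₁ : i ≤ t 1) (l₂ : i ≤ A + t 2) (l₃ : i + a ≤ A + t 3) (l₄ : i + a ≤ t 4)
    (l₅ : i ≤ A + t 5) (l₆ : i + a ≤ A + t 6) (l₇ : i + a ≤ t 7) (l₈ : i ≤ A' + t 8)
    (l₉ : i + a ≤ A' + t 9) (k₀ : j ≤ t 10) (k₁ : j + A ≤ t 11) (k₂ : j + A ≤ a + t 12)
    (k₃ : j ≤ a + t 13) (k₄ : j + A' ≤ t 14) (k₅ : j + A' ≤ a + t 15) : Bounds (x, y) t := by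
  have e₁ : ENNReal.ofReal (x + y) ≤ i + j := by
    rw [ENNReal.ofReal_add hx0 hy0]; exact add_le_add hx hy
  have e₂ : ENNReal.ofReal (2 * x + y) ≤ i + (i + j) := by
    rw [two_mul, add_assoc, ENNReal.ofReal_add hx0 (by positivity)]; exact add_le_add hx e₁
  have e₃ : ENNReal.ofReal (x + 2 * y) ≤ i + j + j := by
    rw [two_mul, ← add_assoc, ENNReal.ofReal_add (by positivity) hy0]; exact add_le_add e₁ hy
  -- combinations in which only `a` and `A'` are cancelled
  have c₄ : i + j + A ≤ t 4 + t 12 := by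
    simpa using add_add_le_of_le (q := 0) ha (by simpa using l₄) k₂
  have c₇ : i + j + A ≤ t 7 + t 12 := by
    simpa using add_add_le_of_le (q := 0) ha (by simpa using l₇) k₂
  have d₄ : i + j ≤ t 4 + t 13 := by
    simpa using add_add_le_of_le (q := 0) (r := 0) ha (by simpa using l₄) (by simpa using k₃)
  have d₇ : i + j ≤ t 7 + t 13 := by
    simpa using add_add_le_of_le (q := 0) (r := 0) ha (by simpa using l₇) (by simpa using k₃)
  have d₃ : i + j ≤ A + (t 3 + t 13) := by
    simpa using add_add_le_of_le (r := 0) ha l₃ (by simpa using k₃)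
  have d₆ : i + j ≤ A + (t 6 + t 13) := by
    simpa using add_add_le_of_le (r := 0) ha l₆ (by simpa using k₃)
  have d₉ : i + j ≤ A' + (t 9 + t 13) := by
    simpa using add_add_le_of_le (r := 0) ha l₉ (by simpa using k₃)
  have f₄ : i + j + A' ≤ t 4 + t 15 := by
    simpa using add_add_le_of_le (q := 0) ha (by simpa using l₄) k₅
  have f₇ : i + j + A' ≤ t 7 + t 15 := by
    simpa using add_add_le_of_le (q := 0) ha (by simpa using l₇) k₅
  have f₉ : i + j + A' ≤ A' + (t 9 + t 15) := add_add_le_of_le ha l₉ k₅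
  have cancel : ∀ {u v s r : ℝ≥0∞}, u + A' ≤ s → v ≤ A' + r → v + u ≤ r + s := by
    intro u v s r h₁ h₂
    have := add_add_le_of_le (q := 0) (r := 0) hA' (by simpa using h₁) (by simpa using h₂)
    simpa [add_comm] using this
  -- combinations in which `A` is cancelled
  have cancel' : ∀ {u v s r : ℝ≥0∞}, u + A ≤ s → v ≤ A + r → v + u ≤ r + s := by
    intro u v s r h₁ h₂
    -- A may be infinite; then s is infinite and there is nothing to prove.
    rcases eq_or_ne A ⊤ with rfl | hA
    · have : s = ⊤ := top_le_iff.1 (by simpa using h₁)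
      simp [this]
    · have := add_add_le_of_le (q := 0) (r := 0) hA (by simpa using h₁) (by simpa using h₂)
      simpa [add_comm] using this
  have g₃ : i + j ≤ t 3 + t 12 := by
    -- If A is infinite, then so is a + t 12, and since a is finite, t 12 is infinite.
    rcases eq_or_ne A ⊤ with rfl | hA
    · have : a + t 12 = ⊤ := top_le_iff.1 (by simpa using k₂)
      simp [(ENNReal.add_eq_top.1 this).resolve_left ha]
    · exact ENNReal.le_of_add_le_add_left hA (by simpa [add_comm] using add_add_le_of_le ha l₃ k₂)
  have g₆ : i + j ≤ t 6 + t 12 := by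
    rcases eq_or_ne A ⊤ with rfl | hA
    · have : a + t 12 = ⊤ := top_le_iff.1 (by simpa using k₂)
      simp [(ENNReal.add_eq_top.1 this).resolve_left ha]
    · exact ENNReal.le_of_add_le_add_left hA (by simpa [add_comm] using add_add_le_of_le ha l₆ k₂)
  have g₉ : i + j ≤ t 9 + t 15 :=
    ENNReal.le_of_add_le_add_left hA' (by simpa [add_comm] using f₉)
  refine ⟨hx.trans l₀, hx.trans l₁, hy.trans k₀, e₁.trans (cancel' k₁ l₂), e₁.trans g₃,
    e₁.trans d₄, e₁.trans (cancel' k₁ l₅), e₁.trans g₆, e₁.trans d₇, e₁.trans (cancel k₄ l₈),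
    e₁.trans g₉, ?_, ?_, ?_, ?_, ?_, ?_, ?_, ?_, ?_⟩
  · exact e₂.trans ((cancel' c₄ l₂).trans (by rw [add_assoc]))
  · exact e₂.trans ((cancel' c₇ l₂).trans (by rw [add_assoc]))
  · exact e₂.trans ((cancel' c₄ l₅).trans (by rw [add_assoc]))
  · exact e₂.trans ((cancel' c₇ l₅).trans (by rw [add_assoc]))
  · exact e₂.trans ((cancel f₄ l₈).trans (by rw [add_assoc]))
  · exact e₂.trans ((cancel f₇ l₈).trans (by rw [add_assoc]))
  · exact e₃.trans (cancel' k₁ d₃)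
  · exact e₃.trans (cancel' k₁ d₆)
  · exact e₃.trans (cancel k₄ d₉)

/-- All bounds are homogeneous; with s = N log 2 this converts nats per block into bits per channel
use. -/
lemma Bounds.div {R : ℝ × ℝ} {t : Fin 16 → ℝ≥0∞} {s : ℝ} (hs : 0 < s)
    (h : Bounds (s * R.1, s * R.2) t) : Bounds R (fun k => t k / ENNReal.ofReal s) := by
  have key : ∀ {z : ℝ} {u : ℝ≥0∞}, ENNReal.ofReal (s * z) ≤ u →
      ENNReal.ofReal z ≤ u / ENNReal.ofReal s := by
    intro z u h
    rw [ENNReal.le_div_iff_mul_le (Or.inl (by simpa using hs)) (Or.inl ENNReal.ofReal_ne_top),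
      mul_comm, ← ENNReal.ofReal_mul hs.le]
    exact h
  have e₁ : s * R.1 + s * R.2 = s * (R.1 + R.2) := by ring
  have e₂ : 2 * (s * R.1) + s * R.2 = s * (2 * R.1 + R.2) := by ring
  have e₃ : s * R.1 + 2 * (s * R.2) = s * (R.1 + 2 * R.2) := by ring
  simp only [Bounds, e₁, e₂, e₃] at h
  simp only [Bounds, ← ENNReal.add_div]
  obtain ⟨h1, h2, h3, h4, h5, h6, h7, h8, h9, h10, h11, h12, h13, h14, h15, h16, h17, h18, h19,
    h20⟩ := h
  exact ⟨key h1, key h2, key h3, key h4, key h5, key h6, key h7, key h8, key h9, key h10, key h11,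
    key h12, key h13, key h14, key h15, key h16, key h17, key h18, key h19, key h20⟩

lemma bounds_sum {N : ℕ} {x y : ℝ} (hx0 : 0 ≤ x) (hy0 : 0 ≤ y)
    (hx : ENNReal.ofReal x ≤ ch.msgInfo₁ c N) (hy : ENNReal.ofReal y ≤ ch.msgInfo₂ c N) :
    Bounds (x, y) (fun k => ∑ n ∈ Finset.range N, terms (ch.viewLaw () (ch.inpLaw c n)) k) := by
  -- `info₂` and `info₁₃` are informations of a message and hence finite. `info₁` also involves the
  -- relay outputs, so no such claim is made for it.
  have ha : ∑ n ∈ Finset.range N, ch.info₂ c n ≠ ⊤ :=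
    ENNReal.sum_ne_top.2 fun n _ => cmi_ne_top_of_finite (by fun_prop) (by fun_prop) (by fun_prop)
  have hA' : ∑ n ∈ Finset.range N, ch.info₁₃ c n ≠ ⊤ :=
    ENNReal.sum_ne_top.2 fun n _ => cmi_ne_top_of_finite (by fun_prop) (by fun_prop) (by fun_prop)
  refine bounds_of_le (A := ∑ n ∈ Finset.range N, ch.info₁ c n) hx0 hy0 hx hy ha hA' ?_ ?_ ?_ ?_ ?_
    ?_ ?_ ?_ ?_ ?_ ?_ ?_ ?_ ?_ ?_ ?_
  all_goals try rw [← Finset.sum_add_distrib]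
  · exact ch.msgInfo₁_le_relay_given_x₂x₃ c N
  · exact ch.msgInfo₁_le_given_x₂ c N
  · exact ch.msgInfo₁_le_given_v₁x₂ c N
  · exact ch.msgInfo₁_add_le_given_v₁ c N
  · exact ch.msgInfo₁_add_le c N
  · exact ch.msgInfo₁_le_relay_given_v₁x₂x₃ c N
  · exact ch.msgInfo₁_add_le_relay_given_v₁x₃ c N
  · exact ch.msgInfo₁_add_le_relay_given_x₃ c N
  · exact ch.msgInfo₁_le_relay_given_v₁v₃x₂x₃ c N
  · exact ch.msgInfo₁_add_le_relay_given_v₁v₃x₃ c N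
  · exact ch.msgInfo₂_le_given_x₁x₃ c N
  · exact ch.msgInfo₂_add_le c N
  · exact ch.msgInfo₂_add_le_given_v₂ c N
  · exact ch.msgInfo₂_le_given_x₁v₂x₃ c N
  · exact ch.msgInfo₂_add_le_relay_given_x₃ c N
  · exact ch.msgInfo₂_add_le_relay_given_v₂x₃ c N

end ISIRC


/-- The scheme of a code. -/
def Code.scheme {𝓧₁ 𝓧₂ 𝓧₃ 𝓨₁ 𝓨₂ 𝓨₃ : Type*} [MeasurableSpace 𝓧₃] [MeasurableSpace 𝓨₁]
    [MeasurableSpace 𝓨₂] [MeasurableSpace 𝓨₃] [Nonempty 𝓧₁] [Nonempty 𝓧₂] {n M₁ M₂ : ℕ}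
    (κ : Code 𝓧₁ 𝓧₂ 𝓧₃ 𝓨₁ 𝓨₂ 𝓨₃ n M₁ M₂) : Scheme 𝓧₁ 𝓧₂ 𝓧₃ 𝓨₃ M₁ M₂ where
  -- Inputs after the block are arbitrary: only times before n are ever used.
  e₁ w i := if h : i < n then κ.enc₁ w ⟨i, h⟩ else Classical.arbitrary _
  e₂ w i := if h : i < n then κ.enc₂ w ⟨i, h⟩ else Classical.arbitrary _
  r := κ.relay

instance {𝓧₁ 𝓧₂ 𝓧₃ 𝓨₁ 𝓨₂ 𝓨₃ : Type*} [MeasurableSpace 𝓧₁] [MeasurableSpace 𝓧₂]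
    [MeasurableSpace 𝓧₃] [MeasurableSpace 𝓨₁] [MeasurableSpace 𝓨₂] [MeasurableSpace 𝓨₃]
    (W : Kernel (𝓧₁ × 𝓧₂ × 𝓧₃) (𝓨₁ × 𝓨₂ × 𝓨₃)) [IsMarkovKernel W] (r : Relay 𝓧₃ 𝓨₃) (n : ℕ)
    (x : Fin n → 𝓧₁ × 𝓧₂) : IsProbabilityMeasure (outputLaw W r n x) := by
  induction n with
  | zero => rw [outputLaw]; infer_instance
  | succ n ih =>
    have := ih (Fin.init x)
    exact Measure.isProbabilityMeasure_map
      (measurable_snoc measurable_fst measurable_snd).aemeasurable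

lemma lintegral_unif {M : ℕ} (f : Fin M → ℝ≥0∞) :
    ∫⁻ w, f w ∂unif M = (M : ℝ≥0∞)⁻¹ * ∑ w, f w := by
  rw [unif, lintegral_smul_measure, lintegral_count, tsum_fintype, smul_eq_mul]

namespace ISIRC

variable {𝓧₁ 𝓧₂ 𝓧₃ 𝓢₁ 𝓢₂ 𝓢₃ 𝓨₁ 𝓨₂ 𝓨₃ : Type*} [MeasurableSpace 𝓧₁] [MeasurableSpace 𝓧₂]
  [MeasurableSpace 𝓧₃] [MeasurableSpace 𝓢₁] [MeasurableSpace 𝓢₂] [MeasurableSpace 𝓢₃]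
  [MeasurableSpace 𝓨₁] [MeasurableSpace 𝓨₂] [MeasurableSpace 𝓨₃]
  [StandardBorelSpace 𝓧₁] [StandardBorelSpace 𝓧₂] [StandardBorelSpace 𝓧₃]
  [StandardBorelSpace 𝓢₁] [StandardBorelSpace 𝓢₂] [StandardBorelSpace 𝓢₃]
  [StandardBorelSpace 𝓨₁] [StandardBorelSpace 𝓨₂] [StandardBorelSpace 𝓨₃]
  [Nonempty 𝓧₁] [Nonempty 𝓧₂] [Nonempty 𝓧₃] [Nonempty 𝓢₁] [Nonempty 𝓢₂] [Nonempty 𝓢₃]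
  [Nonempty 𝓨₁] [Nonempty 𝓨₂] [Nonempty 𝓨₃]
  {M₁ M₂ : ℕ} (ch : ISIRC 𝓧₁ 𝓧₂ 𝓧₃ 𝓢₁ 𝓢₂ 𝓢₃ 𝓨₁ 𝓨₂ 𝓨₃) (c : Scheme 𝓧₁ 𝓧₂ 𝓧₃ 𝓨₃ M₁ M₂)
  [NeZero M₁] [NeZero M₂]

/-! ### The outputs of the process -/

/-- The outputs of the first `n` channel uses. -/
def outs {n : ℕ} : Hist M₁ M₂ 𝓢₁ 𝓢₂ 𝓢₃ 𝓨₃ n → Fin n → 𝓨₁ × 𝓨₂ × 𝓨₃ :=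
  hist fun _ p => ch.out (inp c p.1.1) p.2

@[fun_prop]
lemma measurable_outs {n : ℕ} : Measurable (outs ch c : Hist M₁ M₂ 𝓢₁ 𝓢₂ 𝓢₃ 𝓨₃ n → _) :=
  measurable_hist fun _ => by fun_prop

/-- The copies influence neither the relay nor the outputs, so they integrate out, and the process
reproduces the channel output law used in the definition of the error probability. -/
lemma lintegral_outs {n : ℕ} {F : (Fin M₁ × Fin M₂) × (Fin n → 𝓨₁ × 𝓨₂ × 𝓨₃) → ℝ≥0∞}
    (hF : Measurable F) : ∫⁻ γ, F (γ.1, outs ch c γ) ∂ch.procLaw c n =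
      ∫⁻ m, ∫⁻ y, F (m, y) ∂outputLaw ch.channel c.r n (fun i => (c.e₁ m.1 i, c.e₂ m.2 i))
        ∂((unif M₁).prod (unif M₂)) := by
  induction n with
  | zero =>
    rw [procLaw, seqLaw, lintegral_map (by fun_prop) (by fun_prop)]
    refine lintegral_congr fun m => ?_
    rw [outputLaw, lintegral_dirac' _ (by fun_prop)]
    congr 2
    exact Subsingleton.elim _ _
  | succ n ih =>
    have he₁ : Measurable fun w => c.e₁ w n := measurable_of_finite _
    have he₂ : Measurable fun w => c.e₂ w n := measurable_of_finite _
    have hr := c.r.measurable_φ n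
    have hs : Measurable fun q : (Fin n → 𝓨₁ × 𝓨₂ × 𝓨₃) × (𝓨₁ × 𝓨₂ × 𝓨₃) =>
        (Fin.snoc q.1 q.2 : Fin (n + 1) → 𝓨₁ × 𝓨₂ × 𝓨₃) :=
      measurable_snoc (by fun_prop) (by fun_prop)
    have hZ : Measurable fun q : (Fin M₁ × Fin M₂) × (Fin n → 𝓨₁ × 𝓨₂ × 𝓨₃) =>
        c.r.inputs n (c.e₁ q.1.1 n, c.e₂ q.1.2 n) q.2 := by
      unfold Relay.inputs; fun_prop
    have hG : Measurable fun q : (Fin M₁ × Fin M₂) × (Fin n → 𝓨₁ × 𝓨₂ × 𝓨₃) =>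
        ∫⁻ y, F (q.1, Fin.snoc q.2 y) ∂ch.channel (c.r.inputs n (c.e₁ q.1.1 n, c.e₂ q.1.2 n) q.2) :=
      Measurable.lintegral_kernel_prod_right' (κ := ch.channel.comap _ hZ)
        (f := fun q => F (q.1.1, Fin.snoc q.1.2 q.2))
        (hF.comp ((by fun_prop : Measurable fun q : ((Fin M₁ × Fin M₂) ×
          (Fin n → 𝓨₁ × 𝓨₂ × 𝓨₃)) × (𝓨₁ × 𝓨₂ × 𝓨₃) => q.1.1).prodMk
            (measurable_snoc (by fun_prop) (by fun_prop))))
    have h1 := ih hG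
    rw [← stepLaw_map_next, lintegral_map (by fun_prop) (by fun_prop), stepLaw,
      Measure.lintegral_compProd (by fun_prop), Measure.lintegral_compProd (by
        exact Measurable.lintegral_kernel_prod_right'
          (f := fun p : Step M₁ M₂ 𝓢₁ 𝓢₂ 𝓢₃ 𝓨₃ n => F (p.next.1, outs ch c p.next))
          (by fun_prop))]
    refine Eq.trans (lintegral_congr fun γ => ?_) (h1.trans (lintegral_congr fun m => ?_))
    · have h2 : ∀ v o, F ((Step.next ((γ, v), o)).1, outs ch c (Step.next ((γ, v), o))) =
          F (γ.1, Fin.snoc (outs ch c γ) (ch.out (inp c γ) o)) := by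
        intro v o
        rw [outs, hist_next]
        rfl
      simp only [h2, Kernel.comap_apply, lintegral_const, measure_univ, mul_one]
      have h3 : c.r.inputs n (c.e₁ γ.1.1 n, c.e₂ γ.1.2 n) (outs ch c γ) = inp c γ := rfl
      have h4 : Measurable fun y : 𝓨₁ × 𝓨₂ × 𝓨₃ =>
          F (γ.1, (Fin.snoc (outs ch c γ) y : Fin (n + 1) → 𝓨₁ × 𝓨₂ × 𝓨₃)) :=
        hF.comp (measurable_const.prodMk (measurable_snoc measurable_const measurable_id))
      rw [h3, channel_apply, lintegral_map h4 (by fun_prop)]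
    · rw [outputLaw, lintegral_map (by fun_prop) hs, Measure.lintegral_compProd (by fun_prop)]
      rfl

lemma measure_outs_ne {n : ℕ} (κ : Code 𝓧₁ 𝓧₂ 𝓧₃ 𝓨₁ 𝓨₂ 𝓨₃ n M₁ M₂) :
    ch.procLaw κ.scheme n {γ | (κ.dec₁ (fun i => (outs ch κ.scheme γ i).1),
      κ.dec₂ (fun i => (outs ch κ.scheme γ i).2.1)) ≠ γ.1} = κ.errorProb ch.channel := by
  have hd₁ := κ.measurable_dec₁
  have hd₂ := κ.measurable_dec₂
  set S : Set ((Fin M₁ × Fin M₂) × (Fin n → 𝓨₁ × 𝓨₂ × 𝓨₃)) :=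
    {q | (κ.dec₁ (fun i => (q.2 i).1), κ.dec₂ (fun i => (q.2 i).2.1)) ≠ q.1} with hSdef
  have hS : MeasurableSet S := by
    refine (measurableSet_eq_fun ?_ ?_).compl <;> fun_prop
  have h := lintegral_outs ch κ.scheme (F := S.indicator 1) (measurable_one.indicator hS)
  have h1 : ∫⁻ γ, S.indicator 1 (γ.1, outs ch κ.scheme γ) ∂ch.procLaw κ.scheme n =
      ch.procLaw κ.scheme n ((fun γ => (γ.1, outs ch κ.scheme γ)) ⁻¹' S) :=
    lintegral_indicator_one (hS.preimage (by fun_prop))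
  refine h1.symm.trans (h.trans ?_)
  have h2 : ∀ m : Fin M₁ × Fin M₂, (fun i : Fin n => (κ.scheme.e₁ m.1 i, κ.scheme.e₂ m.2 i)) =
      fun i => (κ.enc₁ m.1 i, κ.enc₂ m.2 i) := by
    intro m
    funext i
    simp [Code.scheme]
  have h3 : ∀ m : Fin M₁ × Fin M₂, ∫⁻ y, S.indicator 1 (m, y) ∂outputLaw ch.channel κ.scheme.r n
      (fun i => (κ.scheme.e₁ m.1 i, κ.scheme.e₂ m.2 i)) =
      outputLaw ch.channel κ.relay n (fun i => (κ.enc₁ m.1 i, κ.enc₂ m.2 i))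
      {y | (κ.dec₁ (fun i => (y i).1), κ.dec₂ (fun i => (y i).2.1)) ≠ (m.1, m.2)} := by
    intro m
    rw [h2]
    exact lintegral_indicator_one (hS.preimage measurable_prodMk_left)
  simp only [h3]
  rw [lintegral_prod _ (measurable_of_finite _).aemeasurable, lintegral_unif, Code.errorProb,
    ENNReal.div_eq_inv_mul, ENNReal.mul_inv (by simp) (by simp)]
  simp only [lintegral_unif]
  rw [← Finset.mul_sum, mul_assoc]

end ISIRC


namespace ISIRC

variable {𝓧₁ 𝓧₂ 𝓧₃ 𝓢₁ 𝓢₂ 𝓢₃ 𝓨₁ 𝓨₂ 𝓨₃ : Type*} [MeasurableSpace 𝓧₁] [MeasurableSpace 𝓧₂]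
  [MeasurableSpace 𝓧₃] [MeasurableSpace 𝓢₁] [MeasurableSpace 𝓢₂] [MeasurableSpace 𝓢₃]
  [MeasurableSpace 𝓨₁] [MeasurableSpace 𝓨₂] [MeasurableSpace 𝓨₃]
  [StandardBorelSpace 𝓧₁] [StandardBorelSpace 𝓧₂] [StandardBorelSpace 𝓧₃]
  [StandardBorelSpace 𝓢₁] [StandardBorelSpace 𝓢₂] [StandardBorelSpace 𝓢₃]
  [StandardBorelSpace 𝓨₁] [StandardBorelSpace 𝓨₂] [StandardBorelSpace 𝓨₃]
  [Nonempty 𝓧₁] [Nonempty 𝓧₂] [Nonempty 𝓧₃] [Nonempty 𝓢₁] [Nonempty 𝓢₂] [Nonempty 𝓢₃]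
  [Nonempty 𝓨₁] [Nonempty 𝓨₂] [Nonempty 𝓨₃]
  {M₁ M₂ : ℕ} (ch : ISIRC 𝓧₁ 𝓧₂ 𝓧₃ 𝓢₁ 𝓢₂ 𝓢₃ 𝓨₁ 𝓨₂ 𝓨₃) (c : Scheme 𝓧₁ 𝓧₂ 𝓧₃ 𝓨₃ M₁ M₂)
  [NeZero M₁] [NeZero M₂]

/-! ### Fano's inequality for the two messages -/

lemma procLaw_msg₁ (n : ℕ) (w : Fin M₁) :
    ch.procLaw c n ((fun γ => γ.1.1) ⁻¹' {w}) = (M₁ : ℝ≥0∞)⁻¹ := by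
  have h : (ch.procLaw c n).map (fun γ => γ.1.1) = unif M₁ := by
    have h2 := congrArg (Measure.map Prod.fst) (procLaw_map_fst ch c n)
    rwa [Measure.map_map (by fun_prop) (by fun_prop), Measure.map_fst_prod, measure_univ,
      one_smul] at h2
  rw [← unif_singleton, ← h, Measure.map_apply (by fun_prop) (measurableSet_singleton w)]

lemma procLaw_msg₂ (n : ℕ) (w : Fin M₂) :
    ch.procLaw c n ((fun γ => γ.1.2) ⁻¹' {w}) = (M₂ : ℝ≥0∞)⁻¹ := by
  have h : (ch.procLaw c n).map (fun γ => γ.1.2) = unif M₂ := by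
    have h2 := congrArg (Measure.map Prod.snd) (procLaw_map_fst ch c n)
    rwa [Measure.map_map (by fun_prop) (by fun_prop), Measure.map_snd_prod, measure_univ,
      one_smul] at h2
  rw [← unif_singleton, ← h, Measure.map_apply (by fun_prop) (measurableSet_singleton w)]

lemma le_msgInfo₁ {n : ℕ} (κ : Code 𝓧₁ 𝓧₂ 𝓧₃ 𝓨₁ 𝓨₂ 𝓨₃ n M₁ M₂) {ε : ℝ} (hε : 0 ≤ ε)
    (hε2 : ε ≤ 2⁻¹) (herr : κ.errorProb ch.channel ≤ ENNReal.ofReal ε) :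
    ENNReal.ofReal ((1 - ε) * Real.log M₁ - Real.binEntropy ε) ≤ ch.msgInfo₁ κ.scheme n := by
  have hd₁ := κ.measurable_dec₁
  have ho : ∀ n, Measurable fun p : Step M₁ M₂ 𝓢₁ 𝓢₂ 𝓢₃ 𝓨₃ n =>
    (ch.out (inp κ.scheme p.1.1) p.2).1 := fun n => (ch.measurable_out
      ((measurable_inp κ.scheme).comp measurable_fst.fst) measurable_snd).fst
  refine fano (by fun_prop) (measurable_hist ho) (procLaw_msg₁ ch κ.scheme n) hd₁ hε hε2
    (le_trans (measure_mono fun γ hγ => ?_) ((measure_outs_ne ch κ).le.trans herr))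
  exact fun h => hγ (congrArg Prod.fst h)

lemma le_msgInfo₂ {n : ℕ} (κ : Code 𝓧₁ 𝓧₂ 𝓧₃ 𝓨₁ 𝓨₂ 𝓨₃ n M₁ M₂) {ε : ℝ} (hε : 0 ≤ ε)
    (hε2 : ε ≤ 2⁻¹) (herr : κ.errorProb ch.channel ≤ ENNReal.ofReal ε) :
    ENNReal.ofReal ((1 - ε) * Real.log M₂ - Real.binEntropy ε) ≤ ch.msgInfo₂ κ.scheme n := by
  have hd₂ := κ.measurable_dec₂
  have ho : ∀ n, Measurable fun p : Step M₁ M₂ 𝓢₁ 𝓢₂ 𝓢₃ 𝓨₃ n =>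
    (ch.out (inp κ.scheme p.1.1) p.2).2.1 := fun n => (ch.measurable_out
      ((measurable_inp κ.scheme).comp measurable_fst.fst) measurable_snd).snd.fst
  refine fano (by fun_prop) (measurable_hist ho) (procLaw_msg₂ ch κ.scheme n) hd₂ hε hε2
    (le_trans (measure_mono fun γ hγ => ?_) ((measure_outs_ne ch κ).le.trans herr))
  exact fun h => hγ (congrArg Prod.snd h)

/-! ### The time-sharing distribution of a code -/

/-- The inputs `(x₁, x₃)` at time `n`. -/
def inp₁₃ (n : ℕ) (γ : Hist M₁ M₂ 𝓢₁ 𝓢₂ 𝓢₃ 𝓨₃ n) : 𝓧₁ × 𝓧₃ := ((inp c γ).1, (inp c γ).2.2)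

/-- The input `x₂` at time `n`. -/
def inp₂ (n : ℕ) (γ : Hist M₁ M₂ 𝓢₁ 𝓢₂ 𝓢₃ 𝓨₃ n) : 𝓧₂ := (inp c γ).2.1

@[fun_prop]
lemma measurable_inp₁₃ (n : ℕ) : Measurable (inp₁₃ c n : Hist M₁ M₂ 𝓢₁ 𝓢₂ 𝓢₃ 𝓨₃ n → _) :=
  (measurable_inp c).fst.prodMk (measurable_inp c).snd.snd

@[fun_prop]
lemma measurable_inp₂ (n : ℕ) : Measurable (inp₂ c n : Hist M₁ M₂ 𝓢₁ 𝓢₂ 𝓢₃ 𝓨₃ n → _) :=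
  (measurable_inp c).snd.fst

/-- At each time (X₁, X₃) is a function of the stream of source 1 and the relay, and X₂ of W₂; these
are independent, as the input laws require. -/
lemma inpLaw_eq (n : ℕ) : ch.inpLaw c n =
    inputsLaw ((ch.procLaw c n).map (inp₁₃ c n)) ((ch.procLaw c n).map (inp₂ c n)) := by
  have he₁ : Measurable fun w => c.e₁ w n := measurable_of_finite _
  have he₂ : Measurable fun w => c.e₂ w n := measurable_of_finite _
  have hr := c.r.measurable_φ n
  have h := (indepFun_of_map_eq_prod (by fun_prop) (by fun_prop)
    (procLaw_map_copyStream ch c n)).1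
  have h2 : IndepFun (inp₁₃ c n) (inp₂ c n) (ch.procLaw c n) :=
    h.comp (φ := fun q : Fin M₁ × (Fin n → (𝓢₁ × 𝓢₃) × 𝓨₃) =>
      (c.e₁ q.1 n, c.r.φ n fun j => (q.2 j).2))
      (ψ := fun q : Fin M₂ × (Fin n → 𝓢₂) => c.e₂ q.1 n) (by fun_prop) (by fun_prop)
  rw [indepFun_iff_map_prod_eq_prod_map_map (by fun_prop) (by fun_prop)] at h2
  rw [inputsLaw, ← h2, Measure.map_map (by fun_prop) (by fun_prop)]
  rfl

/-- The inputs of a scheme at a uniformly distributed time. -/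
def timeShare (N : ℕ) [NeZero N] : InputLaw 𝓧₁ 𝓧₂ 𝓧₃ where
  m := N
  pQ := unif N
  pX₁₃ := Kernel.ofFunOfCountable fun q : Fin N => (ch.procLaw c q).map (inp₁₃ c q)
  pX₂ := Kernel.ofFunOfCountable fun q : Fin N => (ch.procLaw c q).map (inp₂ c q)
  prob_pQ := inferInstance
  markov₁₃ := ⟨fun q => Measure.isProbabilityMeasure_map (by fun_prop)⟩
  markov₂ := ⟨fun q => Measure.isProbabilityMeasure_map (by fun_prop)⟩

lemma terms_timeShare (N : ℕ) [NeZero N] (k : Fin 16) :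
    terms ((ch.jointLaw (ch.timeShare c N)).map ch.toView) k =
      (∑ n ∈ Finset.range N, terms (ch.viewLaw () (ch.inpLaw c n)) k) / N := by
  have : IsProbabilityMeasure ((ch.jointLaw (ch.timeShare c N)).map ch.toView) :=
    Measure.isProbabilityMeasure_map ch.measurable_toView.aemeasurable
  have hp : ∀ q, IsProbabilityMeasure (inputsLaw ((ch.timeShare c N).pX₁₃ q)
    ((ch.timeShare c N).pX₂ q)) := fun q => inferInstance
  rw [terms_eq_sum ch (map_toView_jointLaw ch (ch.timeShare c N)) k, ENNReal.div_eq_inv_mul,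
    Finset.mul_sum, Finset.sum_range]
  refine Finset.sum_congr rfl fun q _ => ?_
  have h1 : ((((ch.timeShare c N).pQ {q}).toNNReal : NNReal) : ℝ≥0∞) = (N : ℝ≥0∞)⁻¹ := by
    rw [ENNReal.coe_toNNReal (measure_ne_top _ _)]
    exact unif_singleton N q
  rw [h1]
  congr 1
  simp only [inpLaw_eq]
  rfl

lemma mem_outerRegion_timeShare {N : ℕ} [NeZero N] {R : ℝ × ℝ} (h₁ : 0 ≤ R.1) (h₂ : 0 ≤ R.2)
    (hR₁ : ENNReal.ofReal (N * Real.log 2 * R.1) ≤ ch.msgInfo₁ c N)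
    (hR₂ : ENNReal.ofReal (N * Real.log 2 * R.2) ≤ ch.msgInfo₂ c N) :
    R ∈ ch.outerRegion (ch.timeShare c N) := by
  have hN : (0 : ℝ) < N := by exact_mod_cast Nat.pos_of_ne_zero (NeZero.ne N)
  have hl : 0 < Real.log 2 := Real.log_pos one_lt_two
  rw [mem_outerRegion_iff]
  refine ⟨h₁, h₂, ?_⟩
  have h := (bounds_sum ch c (by positivity) (by positivity) hR₁ hR₂).div (by positivity)
  convert h using 2 with k
  rw [terms_timeShare, ENNReal.ofReal_mul hN.le, ENNReal.ofReal_natCast, div_eq_mul_inv,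
    div_eq_mul_inv, div_eq_mul_inv, ENNReal.mul_inv (by simp) (by simp), mul_assoc]

/-- The rates that survive the loss in Fano's inequality. -/
def lossyRate (ε r : ℝ) : ℝ := max 0 ((1 - ε) * (r - ε) - Real.binEntropy ε / Real.log 2)

/-- The entropy loss in Fano's inequality occurs once per block, hence at most N times as N ≥ 1. No
growth of the block length is needed. -/
lemma ofReal_lossyRate_le {N M : ℕ} (hN : 0 < N) {ε r : ℝ} (hε : 0 ≤ ε) (hε2 : ε ≤ 2⁻¹)
    (hM : (2 : ℝ) ^ ((N : ℝ) * (r - ε)) ≤ M) :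
    ENNReal.ofReal (N * Real.log 2 * lossyRate ε r) ≤
      ENNReal.ofReal ((1 - ε) * Real.log M - Real.binEntropy ε) := by
  have hN' : (1 : ℝ) ≤ N := by exact_mod_cast hN
  have hl : 0 < Real.log 2 := Real.log_pos one_lt_two
  have hb : 0 ≤ Real.binEntropy ε := Real.binEntropy_nonneg hε (by linarith [hε2])
  have hlog : N * (r - ε) * Real.log 2 ≤ Real.log M := by
    rw [← Real.log_rpow two_pos]
    exact Real.log_le_log (by positivity) hM
  rw [lossyRate, mul_max_of_nonneg _ _ (by positivity), mul_zero, ENNReal.ofReal_max,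
    ENNReal.ofReal_zero, zero_max]
  refine ENNReal.ofReal_le_ofReal ?_
  have h1 : N * Real.log 2 * ((1 - ε) * (r - ε) - Real.binEntropy ε / Real.log 2) =
      (1 - ε) * (N * (r - ε) * Real.log 2) - N * Real.binEntropy ε := by
    field_simp
  rw [h1]
  have h2 := mul_le_mul_of_nonneg_left hlog (by linarith [hε2] : 0 ≤ 1 - ε)
  nlinarith

lemma exists_mem_outerRegion {R : ℝ × ℝ} (hR : Achievable ch.channel R) {ε : ℝ} (hε : 0 < ε)
    (hε2 : ε ≤ 2⁻¹) :
    ∃ P : InputLaw 𝓧₁ 𝓧₂ 𝓧₃, (lossyRate ε R.1, lossyRate ε R.2) ∈ ch.outerRegion P := by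
  obtain ⟨-, -, h⟩ := hR
  obtain ⟨N, hN, M₁, M₂, κ, hM₁, hM₂, herr⟩ := h ε hε
  have hpos : ∀ {M : ℕ} {x : ℝ}, (2 : ℝ) ^ x ≤ M → M ≠ 0 := by
    rintro M x hx rfl
    have := Real.rpow_pos_of_pos (two_pos (α := ℝ)) x
    simp only [Nat.cast_zero] at hx
    linarith
  have : NeZero N := ⟨hN.ne'⟩
  have : NeZero M₁ := ⟨hpos hM₁⟩
  have : NeZero M₂ := ⟨hpos hM₂⟩
  exact ⟨ch.timeShare κ.scheme N, mem_outerRegion_timeShare ch κ.scheme (le_max_left _ _)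
    (le_max_left _ _)
    ((ofReal_lossyRate_le hN hε.le hε2 hM₁).trans (le_msgInfo₁ ch κ hε.le hε2 herr))
    ((ofReal_lossyRate_le hN hε.le hε2 hM₂).trans (le_msgInfo₂ ch κ hε.le hε2 herr))⟩

lemma tendsto_lossyRate {r : ℝ} (hr : 0 ≤ r) :
    Filter.Tendsto (fun ε => lossyRate ε r) (nhdsWithin 0 (Set.Ioi 0)) (nhds r) := by
  have h : Continuous fun ε => lossyRate ε r := by
    have := Real.binEntropy_continuous
    unfold lossyRate
    fun_prop
  have h2 := (h.tendsto 0).mono_left (nhdsWithin_le_nhds (s := Set.Ioi 0))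
  simpa [lossyRate, hr] using h2

lemma mem_closure_outerRegion {R : ℝ × ℝ} (hR : Achievable ch.channel R) :
    R ∈ closure (⋃ P : InputLaw 𝓧₁ 𝓧₂ 𝓧₃, ch.outerRegion P) := by
  have h1 : Filter.Tendsto (fun ε => (lossyRate ε R.1, lossyRate ε R.2))
      (nhdsWithin 0 (Set.Ioi 0)) (nhds R) :=
    (tendsto_lossyRate hR.1).prodMk_nhds (tendsto_lossyRate hR.2.1)
  refine mem_closure_of_tendsto h1 ?_
  filter_upwards [Ioc_mem_nhdsGT (show (0 : ℝ) < 2⁻¹ by norm_num)] with ε hε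
  obtain ⟨P, hP⟩ := ch.exists_mem_outerRegion hR hε.1 hε.2
  exact Set.mem_iUnion.2 ⟨P, hP⟩

end ISIRC


/-! ### Continuity of the conditional mutual information on a finite space -/

section FiniteCmi

variable {Ω α β γ : Type*} [MeasurableSpace Ω] [MeasurableSpace α] [MeasurableSpace β]
  [MeasurableSpace γ] [Finite α] [Finite β] [Finite γ] [MeasurableSingletonClass α]
  [MeasurableSingletonClass β] [MeasurableSingletonClass γ] [StandardBorelSpace α] [Nonempty α]
  [StandardBorelSpace β] [Nonempty β]
  {P : Measure Ω} [IsProbabilityMeasure P] {A : Ω → α} {B : Ω → β} {C : Ω → γ}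

lemma llr_of_ac {X : Type*} [MeasurableSpace X] [MeasurableSingletonClass X] {μ ν : Measure X}
    [IsFiniteMeasure μ] [IsFiniteMeasure ν] (h : μ ≪ ν) {x : X} (hx : μ.real {x} ≠ 0) :
    llr μ ν x = Real.log (μ.real {x} / ν.real {x}) := by
  have h1 : μ.rnDeriv ν x * ν {x} = μ {x} := by
    rw [← lintegral_singleton, Measure.setLIntegral_rnDeriv h]
  have h2 : (μ.rnDeriv ν x).toReal * ν.real {x} = μ.real {x} := by
    rw [measureReal_def, measureReal_def, ← h1, ENNReal.toReal_mul]
  have h3 : ν.real {x} ≠ 0 := by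
    intro h0
    rw [h0, mul_zero] at h2
    exact hx h2.symm
  rw [llr, ← h2, mul_div_cancel_right₀ _ h3]

lemma compProd_singleton {X Y : Type*} [MeasurableSpace X] [MeasurableSpace Y]
    [MeasurableSingletonClass X] [MeasurableSingletonClass Y] (μ : Measure X) [SFinite μ]
    (κ : Kernel X Y) [IsSFiniteKernel κ] (x : X) (y : Y) :
    (μ ⊗ₘ κ) {(x, y)} = κ x {y} * μ {x} := by
  rw [← Set.singleton_prod_singleton, Measure.compProd_apply_prod (measurableSet_singleton _)
    (measurableSet_singleton _), lintegral_singleton]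

/-- The log-likelihood `log P(Z = z)`. -/
def logProb {ζ : Type*} (P : Measure Ω) (Z : Ω → ζ) (ω : Ω) : ℝ := Real.log (P.real (Z ⁻¹' {Z ω}))

/-- On atoms of positive mass the density is p(c,a,b) p(c) / (p(c,a) p(c,b)). -/
lemma llr_cmi (hA : Measurable A) (hB : Measurable B) (hC : Measurable C)
    (hac : P.map (C ⋈ A ⋈ B) ≪ (P.map C) ⊗ₘ (condDistrib A C P ×ₖ condDistrib B C P)) {ω : Ω}
    (hω : P.real ((C ⋈ A ⋈ B) ⁻¹' {(C ⋈ A ⋈ B) ω}) ≠ 0) :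
    llr (P.map (C ⋈ A ⋈ B)) ((P.map C) ⊗ₘ (condDistrib A C P ×ₖ condDistrib B C P))
        ((C ⋈ A ⋈ B) ω) =
      logProb P (C ⋈ A ⋈ B) ω + logProb P C ω - logProb P (C ⋈ A) ω - logProb P (C ⋈ B) ω := by
  have : IsProbabilityMeasure (P.map C) := Measure.isProbabilityMeasure_map hC.aemeasurable
  have hm : Measurable (C ⋈ A ⋈ B) := by fun_prop
  have : IsProbabilityMeasure (P.map (C ⋈ A ⋈ B)) :=
    Measure.isProbabilityMeasure_map hm.aemeasurable
  have e0 : (P.map (C ⋈ A ⋈ B)).real {(C ⋈ A ⋈ B) ω} =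
      P.real ((C ⋈ A ⋈ B) ⁻¹' {(C ⋈ A ⋈ B) ω}) :=
    map_measureReal_apply hm (measurableSet_singleton _)
  have eA : P.real ((C ⋈ A) ⁻¹' {(C ⋈ A) ω}) =
      (condDistrib A C P (C ω)).real {A ω} * P.real (C ⁻¹' {C ω}) := by
    rw [← map_measureReal_apply (by fun_prop) (measurableSet_singleton _),
      ← map_measureReal_apply hC (measurableSet_singleton _), map_rvPair_eq_compProd hA]
    simp only [measureReal_def, ← ENNReal.toReal_mul]
    exact congrArg _ (compProd_singleton _ _ _ _)
  have eB : P.real ((C ⋈ B) ⁻¹' {(C ⋈ B) ω}) =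
      (condDistrib B C P (C ω)).real {B ω} * P.real (C ⁻¹' {C ω}) := by
    rw [← map_measureReal_apply (by fun_prop) (measurableSet_singleton _),
      ← map_measureReal_apply hC (measurableSet_singleton _), map_rvPair_eq_compProd hB]
    simp only [measureReal_def, ← ENNReal.toReal_mul]
    exact congrArg _ (compProd_singleton _ _ _ _)
  have eN : ((P.map C) ⊗ₘ (condDistrib A C P ×ₖ condDistrib B C P)).real {(C ⋈ A ⋈ B) ω} =
      (condDistrib A C P (C ω)).real {A ω} * (condDistrib B C P (C ω)).real {B ω} *
        P.real (C ⁻¹' {C ω}) := by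
    rw [← map_measureReal_apply hC (measurableSet_singleton _)]
    simp only [measureReal_def, ← ENNReal.toReal_mul]
    refine congrArg _ ((compProd_singleton _ _ _ _).trans ?_)
    have : ({(A ⋈ B) ω} : Set (α × β)) = {A ω} ×ˢ {B ω} := Set.singleton_prod_singleton.symm
    rw [Kernel.prod_apply, this, Measure.prod_prod]
  have pos : ∀ {S : Set Ω}, (C ⋈ A ⋈ B) ⁻¹' {(C ⋈ A ⋈ B) ω} ⊆ S → 0 < P.real S := fun h =>
    (lt_of_le_of_ne measureReal_nonneg hω.symm).trans_le (measureReal_mono h)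
  have pC : 0 < P.real (C ⁻¹' {C ω}) := pos fun x hx => congrArg Prod.fst hx
  have pA : 0 < P.real ((C ⋈ A) ⁻¹' {(C ⋈ A) ω}) :=
    pos fun x hx => congrArg (fun q : γ × α × β => (q.1, q.2.1)) hx
  have pB : 0 < P.real ((C ⋈ B) ⁻¹' {(C ⋈ B) ω}) :=
    pos fun x hx => congrArg (fun q : γ × α × β => (q.1, q.2.2)) hx
  have pAB : 0 < P.real ((C ⋈ A ⋈ B) ⁻¹' {(C ⋈ A ⋈ B) ω}) := pos subset_rfl
  rw [llr_of_ac hac (by rwa [e0]), e0, eN]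
  simp only [logProb]
  have kA : 0 < (condDistrib A C P (C ω)).real {A ω} := by
    rw [eA] at pA; exact pos_of_mul_pos_left pA pC.le
  have kB : 0 < (condDistrib B C P (C ω)).real {B ω} := by
    rw [eB] at pB; exact pos_of_mul_pos_left pB pC.le
  rw [eA, eB, Real.log_div pAB.ne' (by positivity), Real.log_mul (by positivity) pC.ne',
    Real.log_mul kA.ne' kB.ne', Real.log_mul kA.ne' pC.ne', Real.log_mul kB.ne' pC.ne']
  ring

lemma integral_logProb {ζ : Type*} [MeasurableSpace ζ] [Fintype ζ] [MeasurableSingletonClass ζ]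
    {Z : Ω → ζ} (hZ : Measurable Z) : Integrable (logProb P Z) P ∧
      ∫ ω, logProb P Z ω ∂P = ∑ z, P.real (Z ⁻¹' {z}) * Real.log (P.real (Z ⁻¹' {z})) := by
  have hm : Measurable fun z : ζ => Real.log (P.real (Z ⁻¹' {z})) := measurable_of_finite _
  have : IsProbabilityMeasure (P.map Z) := Measure.isProbabilityMeasure_map hZ.aemeasurable
  have hi : Integrable (fun z : ζ => Real.log (P.real (Z ⁻¹' {z}))) (P.map Z) :=
    Integrable.of_finite
  refine ⟨hi.comp_measurable hZ, ?_⟩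
  have h := integral_map hZ.aemeasurable hm.aestronglyMeasurable (μ := P)
  refine h.symm.trans ?_
  rw [integral_fintype hi]
  refine Finset.sum_congr rfl fun z _ => ?_
  rw [map_measureReal_apply hZ (measurableSet_singleton _), smul_eq_mul]

/-- On finite alphabets the information is a combination of four entropies, each a finite sum of
terms x log x and therefore continuous in the law. -/
lemma toReal_cmi (hA : Measurable A) (hB : Measurable B) (hC : Measurable C) :
    (cmi P A B C).toReal = ∫ ω, logProb P (C ⋈ A ⋈ B) ω ∂P + ∫ ω, logProb P C ω ∂P -
      ∫ ω, logProb P (C ⋈ A) ω ∂P - ∫ ω, logProb P (C ⋈ B) ω ∂P := by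
  have := Fintype.ofFinite α
  have := Fintype.ofFinite β
  have := Fintype.ofFinite γ
  have : IsProbabilityMeasure (P.map C) := Measure.isProbabilityMeasure_map hC.aemeasurable
  have hm : Measurable (C ⋈ A ⋈ B) := by fun_prop
  have : IsProbabilityMeasure (P.map (C ⋈ A ⋈ B)) :=
    Measure.isProbabilityMeasure_map hm.aemeasurable
  have hne : cmi P A B C ≠ ⊤ := cmi_ne_top_of_finite hA hB hC
  have hac := (klDiv_ne_top_iff.1 hne).1
  have hCA : Measurable (C ⋈ A) := by fun_prop
  have hCB : Measurable (C ⋈ B) := by fun_prop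
  rw [cmi, toReal_klDiv_of_measure_eq hac (by simp),
    integral_map hm.aemeasurable (measurable_llr _ _).aestronglyMeasurable]
  have i₁ := integral_logProb (P := P) hm
  have i₂ := integral_logProb (P := P) hC
  have i₃ := integral_logProb (P := P) hCA
  have i₄ := integral_logProb (P := P) hCB
  have h1 : ∫ ω, (logProb P (C ⋈ A ⋈ B) ω + logProb P C ω - logProb P (C ⋈ A) ω -
      logProb P (C ⋈ B) ω) ∂P = ∫ ω, logProb P (C ⋈ A ⋈ B) ω ∂P + ∫ ω, logProb P C ω ∂P -
      ∫ ω, logProb P (C ⋈ A) ω ∂P - ∫ ω, logProb P (C ⋈ B) ω ∂P := by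
    have h1 := integral_sub ((i₁.1.add i₂.1).sub i₃.1) i₄.1
    have h2 := integral_sub (i₁.1.add i₂.1) i₃.1
    have h3 := integral_add i₁.1 i₂.1
    simp only [Pi.add_apply, Pi.sub_apply] at h1 h2
    rw [h1, h2, h3]
  rw [← h1]
  refine integral_congr_ae ?_
  have h0 : ∀ᵐ x ∂(P.map (C ⋈ A ⋈ B)), P.real ((C ⋈ A ⋈ B) ⁻¹' {x}) ≠ 0 := by
    rw [ae_iff_of_countable]
    intro x hx h
    rw [← map_measureReal_apply hm (measurableSet_singleton _)] at h
    exact hx ((measureReal_eq_zero_iff (measure_ne_top _ _)).1 h)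
  filter_upwards [ae_of_ae_map hm.aemeasurable h0] with ω hω
  exact llr_cmi hA hB hC hac hω

lemma continuous_measureReal {T : Type*} [TopologicalSpace T] [Finite Ω]
    [MeasurableSingletonClass Ω] {θ : T → Measure Ω} [∀ t, IsProbabilityMeasure (θ t)]
    (hθ : ∀ ω, Continuous fun t => (θ t).real {ω}) (S : Set Ω) :
    Continuous fun t => (θ t).real S := by
  classical
  have := Fintype.ofFinite Ω
  have : ∀ t, (θ t).real S = ∑ ω ∈ S.toFinset, (θ t).real {ω} := by
    intro t
    rw [sum_measureReal_singleton, Set.coe_toFinset]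
  simp only [this]
  exact continuous_finsetSum _ fun ω _ => hθ ω

lemma continuous_integral_logProb {T ζ : Type*} [TopologicalSpace T] [Finite Ω]
    [MeasurableSingletonClass Ω] [MeasurableSpace ζ] [Finite ζ] [MeasurableSingletonClass ζ]
    {θ : T → Measure Ω} [∀ t, IsProbabilityMeasure (θ t)]
    (hθ : ∀ ω, Continuous fun t => (θ t).real {ω}) {Z : Ω → ζ} (hZ : Measurable Z) :
    Continuous fun t => ∫ ω, logProb (θ t) Z ω ∂(θ t) := by
  have := Fintype.ofFinite ζ
  simp only [(integral_logProb hZ).2]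
  exact continuous_finsetSum _ fun z _ =>
    Real.continuous_mul_log.comp (continuous_measureReal hθ _)

lemma continuous_toReal_cmi {T : Type*} [TopologicalSpace T] [Finite Ω]
    [MeasurableSingletonClass Ω] {θ : T → Measure Ω} [∀ t, IsProbabilityMeasure (θ t)]
    (hθ : ∀ ω, Continuous fun t => (θ t).real {ω}) (hA : Measurable A) (hB : Measurable B)
    (hC : Measurable C) : Continuous fun t => (cmi (θ t) A B C).toReal := by
  simp only [toReal_cmi hA hB hC]
  exact (((continuous_integral_logProb hθ (by fun_prop)).add
    (continuous_integral_logProb hθ hC)).sub (continuous_integral_logProb hθ (by fun_prop))).sub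
    (continuous_integral_logProb hθ (by fun_prop))

end FiniteCmi



/-! ### Compact convex hulls -/

/-- By Carathéodory's theorem dim + 1 points suffice, so the hull is a continuous image of a simplex
times a power of s. -/
lemma isCompact_convexHull {E : Type*} [NormedAddCommGroup E] [NormedSpace ℝ E]
    [FiniteDimensional ℝ E] {s : Set E} (hs : IsCompact s) : IsCompact (convexHull ℝ s) := by
  rcases s.eq_empty_or_nonempty with rfl | ⟨x₀, hx₀⟩
  · simp
  set d := Module.finrank ℝ E + 1
  have h1 : IsCompact (stdSimplex ℝ (Fin d) ×ˢ Set.univ.pi fun _ : Fin d => s) :=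
    (isCompact_stdSimplex ℝ (Fin d)).prod (isCompact_univ_pi fun _ => hs)
  have h2 : Continuous fun p : (Fin d → ℝ) × (Fin d → E) => ∑ i, p.1 i • p.2 i := by fun_prop
  convert h1.image h2
  ext x
  constructor
  · intro hx
    obtain ⟨ι, _, z, w, hz, hai, hw, hw1, rfl⟩ := eq_pos_convex_span_of_mem_convexHull hx
    obtain ⟨e⟩ : Nonempty (ι ↪ Fin d) := by
      rw [Function.Embedding.nonempty_iff_card_le, Fintype.card_fin]
      exact hai.card_le_finrank_succ.trans
        (Nat.add_le_add_right (Submodule.finrank_le _) 1)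
    -- A combination of fewer points is padded with weight 0 at the point x₀.
    have hw0 : ∀ i, i ∉ Set.range e → Function.extend e w 0 i = 0 := fun i hi =>
      Function.extend_apply' _ _ _ hi
    have hz0 : ∀ i, i ∉ Set.range e → Function.extend e z (fun _ => x₀) i = x₀ := fun i hi =>
      Function.extend_apply' _ _ _ hi
    have hwe := e.injective.extend_apply w 0
    have hze := e.injective.extend_apply z fun _ => x₀
    refine ⟨(Function.extend e w 0, Function.extend e z fun _ => x₀), ⟨⟨fun i => ?_, ?_⟩,
      fun i _ => ?_⟩, ?_⟩
    · change 0 ≤ Function.extend e w 0 i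
      by_cases hi : i ∈ Set.range e
      · obtain ⟨a, rfl⟩ := hi
        exact (hw a).le.trans_eq (hwe a).symm
      · exact (hw0 i hi).ge
    · rw [← hw1]
      exact (Finset.sum_of_injOn e e.injective.injOn (by simp)
        (fun i _ hi => hw0 i (by simpa using hi))
        fun a _ => (hwe a).symm).symm
    · change Function.extend e z (fun _ => x₀) i ∈ s
      by_cases hi : i ∈ Set.range e
      · obtain ⟨a, rfl⟩ := hi
        rw [hze]
        exact hz ⟨a, rfl⟩
      · rwa [hz0 i hi]
    · refine (Finset.sum_of_injOn e e.injective.injOn (by simp) (fun i _ hi => ?_)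
        fun a _ => ?_).symm
      · simp only [hw0 i (by simpa using hi), zero_smul]
      · simp only [hwe, hze]
  · rintro ⟨⟨w, z⟩, ⟨⟨hw, hw1⟩, hz⟩, rfl⟩
    exact (convex_convexHull ℝ s).sum_mem (fun i _ => hw i) hw1
      fun i _ => subset_convexHull ℝ s (hz i trivial)

/-- In a discrete space every set is clopen, so its frontier is empty and weak convergence gives
convergence of its mass. -/
lemma continuous_probabilityMeasure_real {X : Type*} [MeasurableSpace X] [TopologicalSpace X]
    [DiscreteTopology X] [BorelSpace X] (S : Set X) :
    Continuous fun μ : ProbabilityMeasure X => (μ : Measure X).real S := by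
  rw [continuous_iff_continuousAt]
  intro μ
  refine (ENNReal.tendsto_toReal (measure_ne_top (μ : Measure X) S)).comp ?_
  refine ProbabilityMeasure.tendsto_measure_of_null_frontier_of_tendsto' Filter.tendsto_id ?_
  rw [(isClopen_discrete S).frontier_eq, measure_empty]


namespace ISIRC

variable {𝓧₁ 𝓧₂ 𝓧₃ 𝓢₁ 𝓢₂ 𝓢₃ 𝓨₁ 𝓨₂ 𝓨₃ : Type*} [MeasurableSpace 𝓧₁] [MeasurableSpace 𝓧₂]
  [MeasurableSpace 𝓧₃] [MeasurableSpace 𝓢₁] [MeasurableSpace 𝓢₂] [MeasurableSpace 𝓢₃]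
  [MeasurableSpace 𝓨₁] [MeasurableSpace 𝓨₂] [MeasurableSpace 𝓨₃]
  [StandardBorelSpace 𝓧₁] [StandardBorelSpace 𝓧₂] [StandardBorelSpace 𝓧₃]
  [StandardBorelSpace 𝓢₁] [StandardBorelSpace 𝓢₂] [StandardBorelSpace 𝓢₃]
  [StandardBorelSpace 𝓨₁] [StandardBorelSpace 𝓨₂] [StandardBorelSpace 𝓨₃]
  [Nonempty 𝓧₁] [Nonempty 𝓧₂] [Nonempty 𝓧₃] [Nonempty 𝓢₁] [Nonempty 𝓢₂] [Nonempty 𝓢₃]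
  [Nonempty 𝓨₁] [Nonempty 𝓨₂] [Nonempty 𝓨₃]
  {M₁ M₂ : ℕ} (ch : ISIRC 𝓧₁ 𝓧₂ 𝓧₃ 𝓢₁ 𝓢₂ 𝓢₃ 𝓨₁ 𝓨₂ 𝓨₃) (c : Scheme 𝓧₁ 𝓧₂ 𝓧₃ 𝓨₃ M₁ M₂)
  [NeZero M₁] [NeZero M₂]

/-! ### The region of a channel with finite alphabets -/

section FiniteAlphabets

variable [Finite 𝓧₁] [Finite 𝓧₂] [Finite 𝓧₃] [Finite 𝓢₁] [Finite 𝓢₂] [Finite 𝓢₃] [Finite 𝓨₁]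
  [Finite 𝓨₂] [Finite 𝓨₃]

lemma terms_ne_top (θ : Measure (View Unit 𝓧₁ 𝓧₂ 𝓧₃ 𝓢₁ 𝓢₂ 𝓢₃ 𝓨₁ 𝓨₂ 𝓨₃)) [IsProbabilityMeasure θ]
    (k : Fin 16) : terms θ k ≠ ⊤ := by
  fin_cases k <;> exact cmi_ne_top_of_finite (by fun_prop) (by fun_prop) (by fun_prop)

lemma continuous_toReal_terms {T : Type*} [TopologicalSpace T]
    {θ : T → Measure (View Unit 𝓧₁ 𝓧₂ 𝓧₃ 𝓢₁ 𝓢₂ 𝓢₃ 𝓨₁ 𝓨₂ 𝓨₃)} [∀ t, IsProbabilityMeasure (θ t)]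
    (hθ : ∀ ω, Continuous fun t => (θ t).real {ω}) (k : Fin 16) :
    Continuous fun t => (terms (θ t) k).toReal := by
  fin_cases k <;> exact continuous_toReal_cmi hθ (by fun_prop) (by fun_prop) (by fun_prop)

lemma viewLaw_inputsLaw_real (μ : Measure (𝓧₁ × 𝓧₃)) (ν : Measure 𝓧₂) [IsProbabilityMeasure μ]
    [IsProbabilityMeasure ν] (ω : View Unit 𝓧₁ 𝓧₂ 𝓧₃ 𝓢₁ 𝓢₂ 𝓢₃ 𝓨₁ 𝓨₂ 𝓨₃) :
    (ch.viewLaw () (inputsLaw μ ν)).real {ω} =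
      ((ch.signal ×ₖ ch.channel) ω.2.1).real {ω.2.2} *
        (μ.real {(ω.2.1.1, ω.2.1.2.2)} * ν.real {ω.2.1.2.1}) := by
  obtain ⟨_, ⟨x₁, x₂, x₃⟩, v⟩ := ω
  have h1 : (fun p : (𝓧₁ × 𝓧₂ × 𝓧₃) × ((𝓢₁ × 𝓢₃) × 𝓢₂) × (𝓨₁ × 𝓨₂ × 𝓨₃) => ((), p)) ⁻¹'
      {((), (x₁, x₂, x₃), v)} = {((x₁, x₂, x₃), v)} := by
    ext p
    simp
  have h2 : (fun p : (𝓧₁ × 𝓧₃) × 𝓧₂ => (p.1.1, p.2, p.1.2)) ⁻¹' {(x₁, x₂, x₃)} =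
      {(x₁, x₃)} ×ˢ {x₂} := by
    ext ⟨⟨a, b⟩, c⟩
    simp only [Set.mem_preimage, Set.mem_singleton_iff, Prod.mk.injEq, Set.mem_prod]
    tauto
  simp only [measureReal_def, ← ENNReal.toReal_mul]
  rw [viewLaw, Measure.map_apply (by fun_prop) (measurableSet_singleton _), h1,
    compProd_singleton, inputsLaw, Measure.map_apply (by fun_prop) (measurableSet_singleton _), h2,
    Measure.prod_prod]

/-- The sixteen mutual informations for given laws of `(X₁, X₃)` and `X₂`. -/
def infoVec (t : ProbabilityMeasure (𝓧₁ × 𝓧₃) × ProbabilityMeasure 𝓧₂) (k : Fin 16) : ℝ :=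
  (terms (ch.viewLaw () (inputsLaw (t.1 : Measure (𝓧₁ × 𝓧₃)) (t.2 : Measure 𝓧₂))) k).toReal

/-- The laws of `(X₁, X₃)` and `X₂` given `Q = q`. -/
def condInputs (P : InputLaw 𝓧₁ 𝓧₂ 𝓧₃) (q : Fin P.m) :
    ProbabilityMeasure (𝓧₁ × 𝓧₃) × ProbabilityMeasure 𝓧₂ :=
  (⟨P.pX₁₃ q, inferInstance⟩, ⟨P.pX₂ q, inferInstance⟩)

lemma terms_eq_ofReal_infoVec (P : InputLaw 𝓧₁ 𝓧₂ 𝓧₃) (k : Fin 16) :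
    terms ((ch.jointLaw P).map ch.toView) k = ENNReal.ofReal (∑ q, P.pQ.real {q} *
      ch.infoVec (condInputs P q) k) := by
  have : IsProbabilityMeasure ((ch.jointLaw P).map ch.toView) :=
    Measure.isProbabilityMeasure_map ch.measurable_toView.aemeasurable
  rw [terms_eq_sum ch (map_toView_jointLaw ch P) k, ENNReal.ofReal_sum_of_nonneg
    fun q _ => mul_nonneg measureReal_nonneg (by exact ENNReal.toReal_nonneg)]
  refine Finset.sum_congr rfl fun q _ => ?_
  rw [ENNReal.ofReal_mul measureReal_nonneg, ofReal_measureReal, infoVec,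
    ENNReal.ofReal_toReal (terms_ne_top _ _), ENNReal.coe_toNNReal (measure_ne_top _ _)]
  rfl

/-- Time sharing over finitely many values realizes exactly the convex combinations of the
information vectors, the weights being the law of Q. -/
lemma mem_iUnion_outerRegion_iff {R : ℝ × ℝ} :
    R ∈ ⋃ P : InputLaw 𝓧₁ 𝓧₂ 𝓧₃, ch.outerRegion P ↔
      ∃ v ∈ convexHull ℝ (Set.range ch.infoVec), 0 ≤ R.1 ∧ 0 ≤ R.2 ∧
        Bounds R fun k => ENNReal.ofReal (v k) / ENNReal.ofReal (Real.log 2) := by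
  simp only [Set.mem_iUnion, mem_outerRegion_iff, terms_eq_ofReal_infoVec]
  constructor
  · rintro ⟨P, h₁, h₂, h⟩
    refine ⟨∑ q, P.pQ.real {q} • ch.infoVec (condInputs P q), ?_, h₁, h₂, ?_⟩
    · refine (convex_convexHull ℝ _).sum_mem (fun q _ => measureReal_nonneg) ?_
        fun q _ => subset_convexHull ℝ _ ⟨_, rfl⟩
      rw [sum_measureReal_singleton, Finset.coe_univ, probReal_univ]
    · simpa using h
  · rintro ⟨v, hv, h₁, h₂, h⟩
    obtain ⟨ι, _, z, w, hz, -, hw, hw1, rfl⟩ := eq_pos_convex_span_of_mem_convexHull hv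
    choose t ht using fun i => hz ⟨i, rfl⟩
    let e := Fintype.equivFin ι
    let pQ : PMF (Fin (Fintype.card ι)) :=
        PMF.ofFintype (fun q => ENNReal.ofReal (w (e.symm q))) (by
      rw [← ENNReal.ofReal_sum_of_nonneg fun q _ => (hw _).le, e.symm.sum_comp, hw1,
        ENNReal.ofReal_one])
    let P : InputLaw 𝓧₁ 𝓧₂ 𝓧₃ :=
      { m := Fintype.card ι
        pQ := pQ.toMeasure
        pX₁₃ := Kernel.ofFunOfCountable fun q => ((t (e.symm q)).1 : Measure (𝓧₁ × 𝓧₃))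
        pX₂ := Kernel.ofFunOfCountable fun q => ((t (e.symm q)).2 : Measure 𝓧₂)
        prob_pQ := inferInstance
        markov₁₃ := ⟨fun q => (t (e.symm q)).1.2⟩
        markov₂ := ⟨fun q => (t (e.symm q)).2.2⟩ }
    refine ⟨P, h₁, h₂, ?_⟩
    convert h using 4 with k
    rw [Finset.sum_apply, ← e.symm.sum_comp]
    refine Finset.sum_congr rfl fun q _ => ?_
    rw [Pi.smul_apply, smul_eq_mul, ← ht]
    congr 1
    change (pQ.toMeasure {q}).toReal = _
    rw [PMF.toMeasure_apply_singleton _ _ (measurableSet_singleton _), PMF.ofFintype_apply,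
      ENNReal.toReal_ofReal (hw _).le]

lemma isClosed_bounds {ι : Type*} [TopologicalSpace ι] {r : ι → ℝ × ℝ} (hr : Continuous r)
    {t : ι → Fin 16 → ℝ≥0∞} (ht : ∀ k, Continuous fun i => t i k) :
    IsClosed {i | Bounds (r i) (t i)} := by
  have h₁ : Continuous fun i => ENNReal.ofReal (r i).1 :=
    ENNReal.continuous_ofReal.comp (by fun_prop)
  have h₂ : Continuous fun i => ENNReal.ofReal (r i).2 :=
    ENNReal.continuous_ofReal.comp (by fun_prop)
  have h₃ : Continuous fun i => ENNReal.ofReal ((r i).1 + (r i).2) :=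
    ENNReal.continuous_ofReal.comp (by fun_prop)
  have h₄ : Continuous fun i => ENNReal.ofReal (2 * (r i).1 + (r i).2) :=
    ENNReal.continuous_ofReal.comp (by fun_prop)
  have h₅ : Continuous fun i => ENNReal.ofReal ((r i).1 + 2 * (r i).2) :=
    ENNReal.continuous_ofReal.comp (by fun_prop)
  have hp := fun j k => (ht j).add (ht k)
  have hq := fun i j k => (hp i j).add (ht k)
  simp only [Bounds, Set.ofPred_and]
  refine (isClosed_le h₁ (ht _)).inter <| (isClosed_le h₁ (ht _)).inter <|
    (isClosed_le h₂ (ht _)).inter ?_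
  refine (isClosed_le h₃ (hp _ _)).inter <| (isClosed_le h₃ (hp _ _)).inter <|
    (isClosed_le h₃ (hp _ _)).inter <| (isClosed_le h₃ (hp _ _)).inter <|
    (isClosed_le h₃ (hp _ _)).inter <| (isClosed_le h₃ (hp _ _)).inter <|
    (isClosed_le h₃ (hp _ _)).inter <| (isClosed_le h₃ (hp _ _)).inter ?_
  exact (isClosed_le h₄ (hq _ _ _)).inter <| (isClosed_le h₄ (hq _ _ _)).inter <|
    (isClosed_le h₄ (hq _ _ _)).inter <| (isClosed_le h₄ (hq _ _ _)).inter <|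
    (isClosed_le h₄ (hq _ _ _)).inter <| (isClosed_le h₄ (hq _ _ _)).inter <|
    (isClosed_le h₅ (hq _ _ _)).inter <| (isClosed_le h₅ (hq _ _ _)).inter
    (isClosed_le h₅ (hq _ _ _))

lemma continuous_infoVec [TopologicalSpace (𝓧₁ × 𝓧₃)] [DiscreteTopology (𝓧₁ × 𝓧₃)]
    [BorelSpace (𝓧₁ × 𝓧₃)] [TopologicalSpace 𝓧₂] [DiscreteTopology 𝓧₂] [BorelSpace 𝓧₂] :
    Continuous ch.infoVec := by
  refine continuous_pi fun k => continuous_toReal_terms (fun ω => ?_) k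
  simp only [viewLaw_inputsLaw_real]
  exact continuous_const.mul (((continuous_probabilityMeasure_real _).comp continuous_fst).mul
    ((continuous_probabilityMeasure_real _).comp continuous_snd))

/-- The pairs (R, v) that satisfy the bounds form a closed set, v ranges over a compact hull, and
projection along a compact space is a closed map. -/
lemma isClosed_iUnion_outerRegion : IsClosed (⋃ P : InputLaw 𝓧₁ 𝓧₂ 𝓧₃, ch.outerRegion P) := by
  let _ : TopologicalSpace (𝓧₁ × 𝓧₃) := ⊥
  let _ : TopologicalSpace 𝓧₂ := ⊥
  have : DiscreteTopology (𝓧₁ × 𝓧₃) := ⟨rfl⟩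
  have : DiscreteTopology 𝓧₂ := ⟨rfl⟩
  have hK : IsCompact (convexHull ℝ (Set.range ch.infoVec)) :=
    isCompact_convexHull (isCompact_range ch.continuous_infoVec)
  have := isCompact_iff_compactSpace.1 hK
  have hv : ∀ k, Continuous fun p : (ℝ × ℝ) × convexHull ℝ (Set.range ch.infoVec) =>
      ENNReal.ofReal (p.2.1 k) / ENNReal.ofReal (Real.log 2) := fun k => by
    refine (ENNReal.continuous_div_const _ (by simp [Real.log_pos one_lt_two])).comp
      (ENNReal.continuous_ofReal.comp ?_)
    exact (continuous_apply k).comp (continuous_subtype_val.comp continuous_snd)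
  have h := isClosedMap_fst_of_compactSpace (X := ℝ × ℝ)
    (Y := convexHull ℝ (Set.range ch.infoVec)) _ ((isClosed_le (continuous_const (y := (0 : ℝ)))
    continuous_fst.fst).inter ((isClosed_le (continuous_const (y := (0 : ℝ)))
      continuous_fst.snd).inter
    (isClosed_bounds continuous_fst hv)))
  convert h
  ext R
  rw [mem_iUnion_outerRegion_iff]
  constructor
  · rintro ⟨v, hv, h⟩
    exact ⟨(R, ⟨v, hv⟩), h, rfl⟩
  · rintro ⟨⟨_, v⟩, h, rfl⟩
    exact ⟨v.1, v.2, h⟩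

end FiniteAlphabets

lemma mem_iUnion_outerRegion [Finite 𝓧₁] [Finite 𝓧₂] [Finite 𝓧₃] [Finite 𝓨₁] [Finite 𝓨₂]
    [Finite 𝓨₃] {R : ℝ × ℝ} (hR : Achievable ch.channel R) :
    R ∈ ⋃ P : InputLaw 𝓧₁ 𝓧₂ 𝓧₃, ch.outerRegion P := by
  obtain ⟨x₁, x₂, x₃⟩ : 𝓧₁ × 𝓧₂ × 𝓧₃ := Classical.arbitrary (𝓧₁ × 𝓧₂ × 𝓧₃)
  -- The signal alphabets inherit finiteness from the output alphabets through the injections f₁ and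
  -- f₂.
  have : Finite 𝓢₂ := Finite.of_injective _ (ch.injective_f₁ x₁ x₃)
  have hs : Finite (𝓢₁ × 𝓢₃) := Finite.of_injective _ (ch.injective_f₂ x₂)
  have : Finite 𝓢₁ := Finite.of_surjective (Prod.fst : 𝓢₁ × 𝓢₃ → 𝓢₁) Prod.fst_surjective
  have : Finite 𝓢₃ := Finite.of_surjective (Prod.snd : 𝓢₁ × 𝓢₃ → 𝓢₃) Prod.snd_surjective
  exact ch.isClosed_iUnion_outerRegion.closure_eq ▸ ch.mem_closure_outerRegion hR

end ISIRC

end IRC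

end

theorem mainTheorem4 {𝓧₁ 𝓧₂ 𝓧₃ 𝓢₁ 𝓢₂ 𝓢₃ 𝓨₁ 𝓨₂ 𝓨₃ : Type*}
    [MeasurableSpace 𝓧₁] [MeasurableSpace 𝓧₂] [MeasurableSpace 𝓧₃]
    [MeasurableSpace 𝓢₁] [MeasurableSpace 𝓢₂] [MeasurableSpace 𝓢₃]
    [MeasurableSpace 𝓨₁] [MeasurableSpace 𝓨₂] [MeasurableSpace 𝓨₃]
    [StandardBorelSpace 𝓧₁] [StandardBorelSpace 𝓧₂] [StandardBorelSpace 𝓧₃]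
    [StandardBorelSpace 𝓢₁] [StandardBorelSpace 𝓢₂] [StandardBorelSpace 𝓢₃]
    [StandardBorelSpace 𝓨₁] [StandardBorelSpace 𝓨₂] [StandardBorelSpace 𝓨₃]
    [Nonempty 𝓧₁] [Nonempty 𝓧₂] [Nonempty 𝓧₃] [Nonempty 𝓨₁] [Nonempty 𝓨₂] [Nonempty 𝓨₃]
    (ch : IRC.ISIRC 𝓧₁ 𝓧₂ 𝓧₃ 𝓢₁ 𝓢₂ 𝓢₃ 𝓨₁ 𝓨₂ 𝓨₃) (R : ℝ × ℝ)
    (hR : IRC.Achievable ch.channel R) :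
    R ∈ closure (⋃ P : IRC.InputLaw 𝓧₁ 𝓧₂ 𝓧₃, ch.outerRegion P) ∧
    (Finite 𝓧₁ → Finite 𝓧₂ → Finite 𝓧₃ → Finite 𝓨₁ → Finite 𝓨₂ → Finite 𝓨₃ →
      R ∈ ⋃ P : IRC.InputLaw 𝓧₁ 𝓧₂ 𝓧₃, ch.outerRegion P) := by
  obtain ⟨x₁, x₂, x₃⟩ : 𝓧₁ × 𝓧₂ × 𝓧₃ := Classical.arbitrary _
  -- The signal alphabets are nonempty because they carry probability laws.
  have hs : Nonempty (𝓢₁ × 𝓢₃) := (ch.pS₁ (x₁, x₃)).nonempty_of_neZero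
  have : Nonempty 𝓢₁ := hs.map Prod.fst
  have : Nonempty 𝓢₃ := hs.map Prod.snd
  have : Nonempty 𝓢₂ := (ch.pS₂ x₂).nonempty_of_neZero
  refine ⟨ch.mem_closure_outerRegion hR, fun _ _ _ _ _ _ => ch.mem_iUnion_outerRegion hR⟩
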